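/- Let $\beta>0$. On $SE(3)=\mathbb R^3\rtimes SO(3)$ let $\omega^1,\dots,\omega^6$ be the left-invariant coframe determined at $(\mathbf x,R)$ by $$R^T\mathrm d\mathbf x=(\omega^1,\omega^2,\omega^3)^T,\qquad R^T\mathrm dR=\begin{pmatrix}0&-\omega^6&\omega^5\\ \omega^6&0&-\omega^4\\ -\omega^5&\omega^4&0\end{pmatrix},$$ and let $\Delta=\ker\omega^1\cap\ker\omega^2\cap\ker\omega^6$ and $\mathcal G_\beta=\beta^2\,\omega^3\otimes\omega^3+\omega^4\otimes\omega^4+\omega^5\otimes\omega^5$. Let $\gamma=(\mathbf x,R):[0,L]\to SE(3)$, $L>0$, be a cuspless sub-Riemannian geodesic in $(SE(3),\Delta,\mathcal G_\beta)$ with $\gamma(0)=(\mathbf 0,I)$. This means that $\gamma$ is absolutely continuous, is tangent to $\Delta$ almost everywhere, is parametrized by the arc length $s$ of its spatial part ($\langle\omega^3,\dot\gamma\rangle=1$ a.e.), and has at least one of the following two properties: (i) $\mathbf x$ is a stationary curve of the energy $\mathcal E(\mathbf x)=\int\sqrt{\kappa^2+\beta^2}\,\mathrm ds$ ($\kappa$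 the curvature and $s$ the arc length of the curve), i.e. $\frac{\mathrm d}{\mathrm dh}\mathcal E(\mathbf x+h\boldsymbol\delta)|_{h=0}=0$ for every smooth $\boldsymbol\delta$ with compact support in $(0,L)$; (ii) $\gamma$ is locally length minimizing: each $s_0\in[0,L]$ has a neighbourhood such that for all $a\le b$ in it the arc $\gamma|_{[a,b]}$ is at most as long as any absolutely continuous horizontal curve $(\mathbf y,Q):[0,T]\to SE(3)$ with $(\mathbf y,Q)(0)=\gamma(a)$, $\mathbf y(T)=\mathbf x(b)$ and $Q(T)\mathbf e_z=R(b)\mathbf e_z$. Put $(\kappa_1,\kappa_2)=(\langle\omega^5,\dot\gamma\rangle,-\langle\omega^4,\dot\gamma\rangle)$. Then the normalized curvature $(\kappa_1,\kappa_2)/\sqrt{\kappa_1^2+\kappa_2^2+\beta^2}$ coincides almost everywhere on $[0,L]$ with a smooth function $\mathbf w=(w_1,w_2)$, namely $$\mathbf w(s)=\cosh(\beta s)\,\mathbf w(0)+\tfrac{\sinh(\beta s)}{\beta}\,\dot{\mathbf w}(0),$$ and $\|\mathbf w(s)\|<1$ for $0<s<L$. With $$W=w_1(0)\dot w_2(0)-w_2(0)\dot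 w_1(0),\qquad \mathfrak c=\sqrt{1-\|\mathbf w(0)\|^2+\beta^{-2}\|\dot{\mathbf w}(0)\|^2}$$ one has $\mathfrak c>0$, and for all $s\in[0,L]$ $$\mathbf x(s)=\tilde R(0)^T\big(\tilde{\mathbf x}(s)-\tilde{\mathbf x}(0)\big),\qquad \tilde{\mathbf x}(s)=(\tilde x(s),\tilde y(s),\tilde z(s))^T,\qquad \tilde x(s)=\frac1{\mathfrak c}\int_0^s\sqrt{1-\|\mathbf w(\tau)\|^2}\,\mathrm d\tau,$$ where $\tilde R(0)$, $\tilde y$ and $\tilde z$ are as follows. * If $\dot{\mathbf w}(0)=\mathbf 0$: $$\tilde R(0)=\begin{pmatrix}0&0&1\\0&1&0\\-1&0&0\end{pmatrix},\qquad \begin{pmatrix}\tilde y(s)\\ \tilde z(s)\end{pmatrix}=\frac1{\mathfrak c\beta}\begin{pmatrix}w_2(s)\\-w_1(s)\end{pmatrix}.$$ * If $\dot{\mathbf w}(0)\ne\mathbf 0$, put $q(s)=\sqrt{\mathfrak c^2\beta^2-\|\dot{\mathbf w}(s)\|^2}$; then $$\tilde R(0)=\frac1{\mathfrak c\beta}\begin{pmatrix}-\dot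 w_1(0)&-\dot w_2(0)&q(0)\\[2pt] \mathfrak c\beta\frac{\dot w_2(0)}{\|\dot{\mathbf w}(0)\|}&-\mathfrak c\beta\frac{\dot w_1(0)}{\|\dot{\mathbf w}(0)\|}&0\\[2pt] \frac{\dot w_1(0)\,q(0)}{\|\dot{\mathbf w}(0)\|}&\frac{\dot w_2(0)\,q(0)}{\|\dot{\mathbf w}(0)\|}&\|\dot{\mathbf w}(0)\|\end{pmatrix}.$$ - If moreover $W=0$: $\displaystyle\begin{pmatrix}\tilde y(s)\\ \tilde z(s)\end{pmatrix}=\frac{\mathbf w(s)\cdot\dot{\mathbf w}(0)}{\mathfrak c\beta\|\dot{\mathbf w}(0)\|}\begin{pmatrix}0\\1\end{pmatrix}.$ - If moreover $W\ne0$: $\|\mathbf w(s)\|^2>\frac{W^2}{\mathfrak c^2\beta^2}$ for all $s\in[0,L]$ and $$\begin{pmatrix}\tilde y(s)\\ \tilde z(s)\end{pmatrix}=\frac{e^{\int_0^sA(s')\,\mathrm ds'}}{\mathfrak c^2\beta^2\|\dot{\mathbf w}(0)\|}\begin{pmatrix}W\,q(0)\\ \mathfrak c\beta\,\mathbf w(0)\cdot\dot{\mathbf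 w}(0)\end{pmatrix},\qquad A(s)=\frac1{\|\mathbf w(s)\|^2-\frac{W^2}{\mathfrak c^2\beta^2}}\begin{pmatrix}\mathbf w(s)\cdot\dot{\mathbf w}(s)&-\frac{W}{\mathfrak c\beta}q(s)\\ \frac{W}{\mathfrak c\beta}q(s)&\mathbf w(s)\cdot\dot{\mathbf w}(s)\end{pmatrix}.$$ -/

import Mathlib

open MeasureTheory Set
open scoped Matrix ContDiff

noncomputable section

namespace SE3Geod

/-- Euclidean 3-space. -/
abbrev E3 := EuclideanSpace ℝ (Fin 3)

/-- Euclidean plane. -/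
abbrev E2 := EuclideanSpace ℝ (Fin 2)

/-- Real 3×3 matrices. -/
abbrev Mat3 := Matrix (Fin 3) (Fin 3) ℝ

/-- The unit vector along the third axis. -/
def ez : Fin 3 → ℝ := ![0, 0, 1]

/-! ### The sub-Riemannian structure on `SE(3) = ℝ³ ⋊ SO(3)`

A curve in `SE(3)` is a pair `(x, R)` with `x : ℝ → E3` and `R : ℝ → Mat3`, the values of `R` being
in `SO(3)` on the parameter interval. -/

/-- The entrywise derivative of a matrix-valued curve. -/
def matDeriv (R : ℝ → Mat3) (s : ℝ) : Mat3 :=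
  Matrix.of fun i j => deriv (fun t => R t i j) s

/-- The six left-invariant coframe components `⟨ωⁱ, γ'(s)⟩` of the velocity of `γ = (x, R)`,
`i = 1, …, 6` being indexed by `0, …, 5`. They are given by `Rᵀ x' = (ω¹, ω², ω³)` and
`Rᵀ R' = !![0, -ω⁶, ω⁵; ω⁶, 0, -ω⁴; -ω⁵, ω⁴, 0]`. -/
def coframe (x : ℝ → E3) (R : ℝ → Mat3) (s : ℝ) : Fin 6 → ℝ :=
  ![((R s)ᵀ *ᵥ (deriv x s).ofLp) 0,
    ((R s)ᵀ *ᵥ (deriv x s).ofLp) 1,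
    ((R s)ᵀ *ᵥ (deriv x s).ofLp) 2,
    ((R s)ᵀ * matDeriv R s) 2 1,
    ((R s)ᵀ * matDeriv R s) 0 2,
    ((R s)ᵀ * matDeriv R s) 1 0]

/-- `(x, R)` is an absolutely continuous curve in `SE(3)` on `[a, b]` which is tangent almost
everywhere to `Δ = ker ω¹ ∩ ker ω² ∩ ker ω⁶`. -/
structure IsHorizontalOn (x : ℝ → E3) (R : ℝ → Mat3) (a b : ℝ) : Prop where
  mem_SO3 : ∀ s ∈ Icc a b, R s ∈ Matrix.specialOrthogonalGroup (Fin 3) ℝ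
  ac_pos : AbsolutelyContinuousOnInterval x a b
  ac_rot : ∀ i j, AbsolutelyContinuousOnInterval (fun s => R s i j) a b
  horizontal : ∀ᵐ s ∂(volume.restrict (Icc a b)),
    coframe x R s 0 = 0 ∧ coframe x R s 1 = 0 ∧ coframe x R s 5 = 0

/-- `G_β(γ'(s), γ'(s))` for `G_β = β² ω³ ⊗ ω³ + ω⁴ ⊗ ω⁴ + ω⁵ ⊗ ω⁵`. -/
def metricSq (β : ℝ) (x : ℝ → E3) (R : ℝ → Mat3) (s : ℝ) : ℝ :=
  β ^ 2 * coframe x R s 2 ^ 2 + coframe x R s 3 ^ 2 + coframe x R s 4 ^ 2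

/-- Sub-Riemannian length of the curve `(x, R)` between the parameters `a` and `b`. -/
def srLength (β : ℝ) (x : ℝ → E3) (R : ℝ → Mat3) (a b : ℝ) : ℝ :=
  ∫ s in a..b, √(metricSq β x R s)

/-- The curve `(x, R)` on `[0, L]` is locally length minimizing: every sufficiently short arc is no
longer than any horizontal curve that starts at the same element of `SE(3)` and ends at the same
position with the same direction `R e_z`. (The rotation at the end point is prescribed only up to a
rotation about its own third axis, as is appropriate for `ℝ³ ⋊ S² = SE(3) / ({0} ⋊ SO(2))`.) -/
def IsLocallyMinimizing (β L : ℝ) (x : ℝ → E3) (R : ℝ → Mat3) : Prop :=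
  ∀ s₀ ∈ Icc 0 L, ∃ ε > 0, ∀ a ∈ Icc 0 L, ∀ b ∈ Icc 0 L,
    |a - s₀| < ε → |b - s₀| < ε → a ≤ b →
    ∀ (T : ℝ) (y : ℝ → E3) (Q : ℝ → Mat3), 0 ≤ T → IsHorizontalOn y Q 0 T →
      y 0 = x a → Q 0 = R a → y T = x b → Q T *ᵥ ez = R b *ᵥ ez →
      srLength β x R a b ≤ srLength β y Q 0 T

/-! ### The curve problem in `ℝ³` -/

/-- The curvature `‖y' × y''‖ / ‖y'‖³` of a curve in an arbitrary regular parametrization, with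
`‖y' × y''‖² = ‖y'‖² ‖y''‖² - ⟨y', y''⟩²`. -/
def curvature (y : ℝ → E3) (r : ℝ) : ℝ :=
  √(‖deriv y r‖ ^ 2 * ‖deriv (deriv y) r‖ ^ 2 - inner ℝ (deriv y r) (deriv (deriv y) r) ^ 2) /
    ‖deriv y r‖ ^ 3

/-- The energy `∫ √(κ² + β²) ds`, where `ds = ‖y'(r)‖ dr` is the arc-length element. -/
def energy (β : ℝ) (y : ℝ → E3) (a b : ℝ) : ℝ :=
  ∫ r in a..b, √(curvature y r ^ 2 + β ^ 2) * ‖deriv y r‖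

/-- `x` is a stationary curve of the energy on `[0, L]`: the first variation vanishes along every
smooth perturbation that leaves the curve unchanged near its end points. -/
def IsStationary (β L : ℝ) (x : ℝ → E3) : Prop :=
  ∀ δ : ℝ → E3, ContDiff ℝ ∞ δ → HasCompactSupport δ → tsupport δ ⊆ Ioo 0 L →
    HasDerivAt (fun h : ℝ => energy β (fun r => x r + h • δ r) 0 L) 0 0

/-! ### Cuspless geodesics -/

/-- `(x, R)`, defined on `[0, L]`, is a cuspless sub-Riemannian geodesic starting at the unit
element `(0, I)` and parametrized by the arc length of its spatial part (so that `ω³ = 1`): a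
horizontal curve that is the lift of a stationary curve of the energy, or is locally length
minimizing. Its curvature is a real-valued integrable function, and it may blow up at the end points
of the interval. -/
structure IsCusplessGeodesic (β L : ℝ) (x : ℝ → E3) (R : ℝ → Mat3) : Prop where
  horizontal : IsHorizontalOn x R 0 L
  arclength : ∀ᵐ s ∂(volume.restrict (Icc 0 L)), coframe x R s 2 = 1
  pos_zero : x 0 = 0
  rot_zero : R 0 = 1
  geodesic : IsStationary β L x ∨ IsLocallyMinimizing β L x R

/-- The curvature vector `(κ₁, κ₂) = (ω⁵, -ω⁴)` along the curve. -/
def kappa (x : ℝ → E3) (R : ℝ → Mat3) (s : ℝ) : E2 :=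
  !₂[coframe x R s 4, -coframe x R s 3]

/-- The normalized curvature `(κ₁, κ₂) / √(κ² + β²)`. -/
def normalizedCurvature (β : ℝ) (x : ℝ → E3) (R : ℝ → Mat3) (s : ℝ) : E2 :=
  (1 / √(‖kappa x R s‖ ^ 2 + β ^ 2)) • kappa x R s

/-! ### The explicit formulas, in terms of `w` and its derivative -/

/-- `𝔠 = √(1 - ‖w(0)‖² + β⁻² ‖w'(0)‖²)`. -/
def cc (β : ℝ) (w : ℝ → E2) : ℝ :=
  √(1 - ‖w 0‖ ^ 2 + ‖deriv w 0‖ ^ 2 / β ^ 2)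

/-- The Wronskian `W = w₁(0) w₂'(0) - w₂(0) w₁'(0)`. -/
def WW (w : ℝ → E2) : ℝ :=
  w 0 0 * deriv w 0 1 - w 0 1 * deriv w 0 0

/-- `√(𝔠² β² - ‖w'(s)‖²)`. -/
def rt (β : ℝ) (w : ℝ → E2) (s : ℝ) : ℝ :=
  √(cc β w ^ 2 * β ^ 2 - ‖deriv w s‖ ^ 2)

open Classical in
/-- The matrix `R̃(0)`. -/
def tildeR0 (β : ℝ) (w : ℝ → E2) : Mat3 :=
  if deriv w 0 = 0 then
    !![0, 0, 1;
       0, 1, 0;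
       -1, 0, 0]
  else
    (1 / (cc β w * β)) •
      !![-deriv w 0 0, -deriv w 0 1, rt β w 0;
         cc β w * β * (deriv w 0 1 / ‖deriv w 0‖), -(cc β w * β * (deriv w 0 0 / ‖deriv w 0‖)), 0;
         deriv w 0 0 * rt β w 0 / ‖deriv w 0‖, deriv w 0 1 * rt β w 0 / ‖deriv w 0‖, ‖deriv w 0‖]

/-- The denominator `‖w(s)‖² - W² / (𝔠² β²)` of the matrix `A(s)`. -/
def denA (β : ℝ) (w : ℝ → E2) (s : ℝ) : ℝ :=
  ‖w s‖ ^ 2 - WW w ^ 2 / (cc β w ^ 2 * β ^ 2)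

/-- The matrix `A(s)`. -/
def matA (β : ℝ) (w : ℝ → E2) (s : ℝ) : Matrix (Fin 2) (Fin 2) ℝ :=
  (1 / denA β w s) •
    !![inner ℝ (w s) (deriv w s), -(WW w / (cc β w * β) * rt β w s);
       WW w / (cc β w * β) * rt β w s, inner ℝ (w s) (deriv w s)]

/-- The entrywise integral `∫₀ˢ A(s') ds'`. -/
def intA (β : ℝ) (w : ℝ → E2) (s : ℝ) : Matrix (Fin 2) (Fin 2) ℝ :=
  Matrix.of fun i j => ∫ t in (0 : ℝ)..s, matA β w t i j

open Classical in
/-- The pair `(ỹ(s), z̃(s))`. -/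
def tildeYZ (β : ℝ) (w : ℝ → E2) (s : ℝ) : Fin 2 → ℝ :=
  if deriv w 0 = 0 then
    (1 / (cc β w * β)) • ![w s 1, -w s 0]
  else if WW w = 0 then
    (inner ℝ (w s) (deriv w 0) / (cc β w * β * ‖deriv w 0‖)) • ![0, 1]
  else
    (1 / (cc β w ^ 2 * β ^ 2 * ‖deriv w 0‖)) •
      (NormedSpace.exp (intA β w s) *ᵥ
        ![WW w * rt β w 0, cc β w * β * inner ℝ (w 0) (deriv w 0)])

/-- `x̃(s) = (1/𝔠) ∫₀ˢ √(1 - ‖w(τ)‖²) dτ`. -/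
def tildeX (β : ℝ) (w : ℝ → E2) (s : ℝ) : ℝ :=
  1 / cc β w * ∫ τ in (0 : ℝ)..s, √(1 - ‖w τ‖ ^ 2)

/-- The curve `(x̃(s), ỹ(s), z̃(s))`. -/
def tildeCurve (β : ℝ) (w : ℝ → E2) (s : ℝ) : Fin 3 → ℝ :=
  ![tildeX β w s, tildeYZ β w s 0, tildeYZ β w s 1]

end SE3Geod

end

/-! Write R₁, R₂, T for the columns of R. A horizontal curve of unit spatial speed satisfies x' = T,
T' = N = κ₁R₁ + κ₂R₂, R₁' = −κ₁T and R₂' = −κ₂T, where a priori κ is only integrable.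

Either property in the definition of a geodesic makes the first variation ∫ ((β² − κ²)/√(κ² + β²)
T·δ' + N·δ''/√(κ² + β²)) vanish for all test fields δ. For stationary curves this is differentiation
under the integral sign. For local minimizers, a small perturbation of x with support near a given
parameter lifts to a horizontal competitor (`exists_lift`), and a partition of unity removes the
condition on the support.

Du Bois-Reymond's argument integrates this weak equation once: V = N/√(κ² + β²) has an absolutely
continuous representative with V' = (β² − κ²)/√(κ² + β²) T + P for a constant vector P, the momentum
belonging to translations (`exists_ac_representative`). In the moving frame V has components (w₁,
w₂, 0). Differentiating V·T = 0 gives P·T = −β²/√(κ² + β²) = −β√(1 − ‖w‖²), and differentiating V·Rᵢ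
and P·Rᵢ gives wᵢ' = P·Rᵢ and wᵢ'' = β²wᵢ (`exists_momentum`). Hence w is hyperbolic and ‖P‖ = 𝔠β.

The position follows from two conservation laws. Integrating P·x' = P·T gives the component of x
along P, which is x̃ up to sign and scale. With M = T × V = w₁R₂ − w₂R₁ one has M' = T × P, so that
x × P = M − M(0) (`cross_momentum`); this gives the components orthogonal to P. The rows of R̃(0)
are adapted to P when w'(0) ≠ 0: the first is −P/‖P‖.

It remains to find M. If W = 0, the direction of w is fixed, the curve is planar and M is explicit.
If W ≠ 0, then M·P = W, and the projection of M to the plane orthogonal to P solves a linear system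
with the conformal matrix A(s). Such matrices commute, so the solution is exp(∫A) applied to the
initial value. -/

noncomputable section

namespace SE3Geod

/-! ### Absolutely continuous functions -/

section AbsolutelyContinuous

variable {X Y : Type*} [PseudoMetricSpace X] [PseudoMetricSpace Y]

/-- The sum of the increments of g over a family of intervals is at most C times that of f.
Reciprocals, square roots, sines, cosines and coordinates are all treated through this comparison.
-/
theorem ac_of_dist_le {f : ℝ → X} {g : ℝ → Y} {a b C : ℝ}
    (hf : AbsolutelyContinuousOnInterval f a b)
    (h : ∀ s ∈ uIcc a b, ∀ t ∈ uIcc a b, dist (g s) (g t) ≤ C * dist (f s) (f t)) :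
    AbsolutelyContinuousOnInterval g a b := by
  unfold AbsolutelyContinuousOnInterval at *
  have h0 := hf.const_mul C
  rw [mul_zero] at h0
  refine squeeze_zero' (Filter.Eventually.of_forall fun E =>
    Finset.sum_nonneg fun i _ => dist_nonneg) ?_ h0
  refine Filter.Eventually.filter_mono inf_le_right ?_
  rw [Filter.eventually_principal]
  intro E hE
  rw [Finset.mul_sum]
  exact Finset.sum_le_sum fun i hi => h _ (hE.1 i hi).1 _ (hE.1 i hi).2

theorem ac_congr {f g : ℝ → X} {a b : ℝ} (hf : AbsolutelyContinuousOnInterval f a b)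
    (h : ∀ s ∈ uIcc a b, g s = f s) : AbsolutelyContinuousOnInterval g a b :=
  ac_of_dist_le (C := 1) hf fun s hs t ht => by rw [h s hs, h t ht, one_mul]

theorem ac_const (c : X) (a b : ℝ) : AbsolutelyContinuousOnInterval (fun _ => c) a b :=
  (LipschitzOnWith.of_dist_le_mul (K := 0) fun x _ y _ => by simp).absolutelyContinuousOnInterval

theorem ac_inv {f : ℝ → ℝ} {a b c : ℝ} (hf : AbsolutelyContinuousOnInterval f a b) (hc : 0 < c)
    (h : ∀ s ∈ uIcc a b, c ≤ f s) : AbsolutelyContinuousOnInterval (fun s => (f s)⁻¹) a b := by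
  refine ac_of_dist_le (C := (c ^ 2)⁻¹) hf fun s hs t ht => ?_
  have h1 := h s hs
  have h2 := h t ht
  have p1 : 0 < f s := hc.trans_le h1
  have p2 : 0 < f t := hc.trans_le h2
  rw [Real.dist_eq, Real.dist_eq, inv_sub_inv p1.ne' p2.ne', abs_div, abs_sub_comm,
    abs_of_pos (mul_pos p1 p2), div_eq_inv_mul]
  gcongr
  nlinarith

theorem ac_sqrt {f : ℝ → ℝ} {a b c : ℝ} (hf : AbsolutelyContinuousOnInterval f a b) (hc : 0 < c)
    (h : ∀ s ∈ uIcc a b, c ≤ f s) : AbsolutelyContinuousOnInterval (fun s => √(f s)) a b := by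
  refine ac_of_dist_le (C := (√c)⁻¹) hf fun s hs t ht => ?_
  have h1 := h s hs
  have h2 := h t ht
  have p1 : 0 < f s := hc.trans_le h1
  have p2 : 0 < f t := hc.trans_le h2
  rw [Real.dist_eq, Real.dist_eq]
  have hk : f s - f t = (√(f s) - √(f t)) * (√(f s) + √(f t)) := by
    nlinarith [Real.sq_sqrt p1.le, Real.sq_sqrt p2.le]
  have hp : √c ≤ √(f s) + √(f t) := (Real.sqrt_le_sqrt h1).trans (by simp)
  have hcp : 0 < √c := Real.sqrt_pos.2 hc
  rw [hk, abs_mul, abs_of_nonneg (by positivity : 0 ≤ √(f s) + √(f t))]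
  rw [le_inv_mul_iff₀ hcp, mul_comm]
  gcongr

theorem ac_cos {f : ℝ → ℝ} {a b : ℝ} (hf : AbsolutelyContinuousOnInterval f a b) :
    AbsolutelyContinuousOnInterval (fun s => Real.cos (f s)) a b :=
  ac_of_dist_le (C := 1) hf fun s _ t _ => by
    have := Real.lipschitzWith_cos.dist_le_mul (f s) (f t)
    simpa using this

theorem ac_sin {f : ℝ → ℝ} {a b : ℝ} (hf : AbsolutelyContinuousOnInterval f a b) :
    AbsolutelyContinuousOnInterval (fun s => Real.sin (f s)) a b :=
  ac_of_dist_le (C := 1) hf fun s _ t _ => by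
    have := Real.lipschitzWith_sin.dist_le_mul (f s) (f t)
    simpa using this

theorem ac_of_contDiff {E : Type*} [NormedAddCommGroup E] [NormedSpace ℝ E] {f : ℝ → E}
    (hf : ContDiff ℝ 1 f) (a b : ℝ) : AbsolutelyContinuousOnInterval f a b :=
  hf.contDiffOn.absolutelyContinuousOnInterval

theorem ac_apply {f : ℝ → E3} {a b : ℝ} (hf : AbsolutelyContinuousOnInterval f a b) (k : Fin 3) :
    AbsolutelyContinuousOnInterval (fun s => f s k) a b :=
  ac_of_dist_le (C := 1) hf fun s _ t _ => by
    rw [one_mul, dist_eq_norm, dist_eq_norm]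
    exact PiLp.norm_apply_le (f s - f t) k

theorem ac_of_apply {f : ℝ → E3} {a b : ℝ}
    (hf : ∀ k, AbsolutelyContinuousOnInterval (fun s => f s k) a b) :
    AbsolutelyContinuousOnInterval f a b := by
  have h : ∀ k : Fin 3, AbsolutelyContinuousOnInterval
      (fun s => f s k • (EuclideanSpace.single k (1 : ℝ) : E3)) a b := fun k =>
    (hf k).fun_smul (ac_const _ a b)
  refine ac_congr (((h 0).fun_add (h 1)).fun_add (h 2)) fun s _ => ?_
  ext i
  fin_cases i <;> simp

/-- Needed because the competitors in `IsLocallyMinimizing` are parametrized from 0. -/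
theorem ac_shift {f : ℝ → X} {a b : ℝ} (c : ℝ) (hf : AbsolutelyContinuousOnInterval f a b) :
    AbsolutelyContinuousOnInterval (fun t => f (c + t)) (a - c) (b - c) := by
  rw [absolutelyContinuousOnInterval_iff] at hf ⊢
  intro ε hε
  obtain ⟨δ, hδ, H⟩ := hf ε hε
  refine ⟨δ, hδ, fun E hE hlen => ?_⟩
  have := H (E.1, fun i => (c + (E.2 i).1, c + (E.2 i).2)) ?_ (by simpa using hlen)
  · simpa using this
  · refine ⟨fun i hi => ?_, fun i hi j hj hij => ?_⟩
    · have := hE.1 i hi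
      simp only [uIcc, mem_Icc, min_sub_sub_right, max_sub_sub_right] at this ⊢
      constructor <;> constructor <;> linarith [this.1.1, this.1.2, this.2.1, this.2.2]
    · have := hE.2 hi hj hij
      simp only [Function.onFun, Set.disjoint_left, uIoc, mem_Ioc, min_add_add_left,
        max_add_add_left] at this ⊢
      intro y hy hy'
      exact this (a := y - c) ⟨by linarith [hy.1], by linarith [hy.2]⟩
        ⟨by linarith [hy'.1], by linarith [hy'.2]⟩

end AbsolutelyContinuous

/-! ### Functions determined by their derivative almost everywhere. -/

theorem ae_mem_Ioo (a b : ℝ) : ∀ᵐ s ∂(volume.restrict (Icc a b)), s ∈ Ioo a b := by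
  rw [← restrict_Ioo_eq_restrict_Icc]
  exact ae_restrict_mem measurableSet_Ioo

theorem ac_ae_hasDerivAt {f : ℝ → ℝ} {a b : ℝ} (hab : a ≤ b)
    (hf : AbsolutelyContinuousOnInterval f a b) :
    ∀ᵐ s ∂(volume.restrict (Icc a b)), HasDerivAt f (deriv f s) s := by
  rw [ae_restrict_iff' measurableSet_Icc]
  filter_upwards [hf.ae_differentiableAt] with s hs hmem
  exact (hs (by rwa [uIcc_of_le hab])).hasDerivAt

/-- Two absolutely continuous functions with the same derivative almost everywhere differ by a
constant. -/
theorem ac_sub_eq_of_ae_hasDerivAt {f g φ : ℝ → ℝ} {a b : ℝ} (hab : a ≤ b)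
    (hf : AbsolutelyContinuousOnInterval f a b) (hg : AbsolutelyContinuousOnInterval g a b)
    (hf' : ∀ᵐ s ∂(volume.restrict (Icc a b)), HasDerivAt f (φ s) s)
    (hg' : ∀ᵐ s ∂(volume.restrict (Icc a b)), HasDerivAt g (φ s) s) :
    ∀ s ∈ Icc a b, f s - f a = g s - g a := by
  obtain ⟨C, hC⟩ := (hf.fun_sub hg).const_of_ae_hasDerivAt_zero (by
    rw [uIcc_of_le hab, ← ae_restrict_iff' measurableSet_Icc]
    filter_upwards [hf', hg'] with s h1 h2
    simpa using h1.fun_sub h2)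
  rw [uIcc_of_le hab] at hC
  intro s hs
  have h1 := hC s hs
  have h2 := hC a ⟨le_rfl, hab⟩
  linarith

theorem ac_eq_of_ae_hasDerivAt_zero {f : ℝ → ℝ} {a b : ℝ} (hab : a ≤ b)
    (hf : AbsolutelyContinuousOnInterval f a b)
    (hf' : ∀ᵐ s ∂(volume.restrict (Icc a b)), HasDerivAt f 0 s) :
    ∀ s ∈ Icc a b, f s = f a := fun s hs => by
  have := ac_sub_eq_of_ae_hasDerivAt (φ := fun _ => 0) hab hf (ac_const (0 : ℝ) a b) hf'
    (Filter.Eventually.of_forall fun s => hasDerivAt_const s 0) s hs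
  linarith

/-- An absolutely continuous function whose derivative agrees almost everywhere with a continuous
function is a primitive of that function. -/
theorem ac_hasDerivAt_of_continuousOn {f φ : ℝ → ℝ} {a b : ℝ} (hab : a ≤ b)
    (hf : AbsolutelyContinuousOnInterval f a b) (hφ : ContinuousOn φ (Icc a b))
    (hf' : ∀ᵐ s ∂(volume.restrict (Icc a b)), HasDerivAt f (φ s) s) :
    ∀ s ∈ Ioo a b, HasDerivAt f (φ s) s := by
  have hφi : IntervalIntegrable φ volume a b :=
    ContinuousOn.intervalIntegrable (by rwa [uIcc_of_le hab])
  have hder : ∀ s ∈ Ioo a b, HasDerivAt (fun s => ∫ t in a..s, φ t) (φ s) s := fun s hs => by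
    have hnhds : Icc a b ∈ nhds s := Icc_mem_nhds hs.1 hs.2
    refine intervalIntegral.integral_hasDerivAt_right
      (hφi.mono_set ?_) ?_ (hφ.continuousAt hnhds)
    · rw [uIcc_of_le hab, uIcc_of_le hs.1.le]; exact Icc_subset_Icc le_rfl hs.2.le
    · exact ContinuousOn.stronglyMeasurableAtFilter isOpen_Ioo
        (hφ.mono Ioo_subset_Icc_self) s hs
  -- The primitive of φ is differentiable at every interior point, and f differs from it by a
  -- constant.
  have hac := hφi.absolutelyContinuousOnInterval_intervalIntegral (c := a) left_mem_uIcc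
  have heq := ac_sub_eq_of_ae_hasDerivAt hab hf hac hf'
    ((ae_mem_Ioo a b).mono fun s hs => hder s hs)
  intro s hs
  refine ((hder s hs).add_const (f a)).congr_of_eventuallyEq ?_
  filter_upwards [Icc_mem_nhds hs.1 hs.2] with t ht
  have := heq t ht
  simp only [intervalIntegral.integral_same] at this
  linarith

/-! ### Test functions and the fundamental lemma of the calculus of variations -/

theorem exists_Icc_of_isCompact {K : Set ℝ} {a b : ℝ} (hab : a < b) (hK : IsCompact K)
    (h : K ⊆ Ioo a b) : ∃ c d, a < c ∧ c < d ∧ d < b ∧ K ⊆ Ioo c d := by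
  rcases K.eq_empty_or_nonempty with rfl | hne
  · exact ⟨(2 * a + b) / 3, (a + 2 * b) / 3, by linarith, by linarith, by linarith, empty_subset _⟩
  · obtain ⟨m, hm, hm'⟩ := hK.exists_isLeast hne
    obtain ⟨M, hM, hM'⟩ := hK.exists_isGreatest hne
    have h1 := h hm
    have h2 := h hM
    have h3 := hm' hM
    exact ⟨(a + m) / 2, (M + b) / 2, by linarith [h1.1], by linarith [h1.1, h2.2],
      by linarith [h2.2], fun y hy => ⟨by linarith [hm' hy, h1.1], by linarith [hM' hy, h2.2]⟩⟩

/-- Smooth functions on the real line with compact support in `(a, b)`. -/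
structure IsTest (a b : ℝ) (φ : ℝ → ℝ) : Prop where
  smooth : ContDiff ℝ ∞ φ
  compact : HasCompactSupport φ
  supp : tsupport φ ⊆ Ioo a b

namespace IsTest

variable {a b : ℝ} {φ ψ : ℝ → ℝ}

theorem eq_zero (h : IsTest a b φ) {s : ℝ} (hs : s ∉ Ioo a b) : φ s = 0 :=
  image_eq_zero_of_notMem_tsupport fun h' => hs (h.supp h')

theorem hasDerivAt (h : IsTest a b φ) (s : ℝ) : HasDerivAt φ (deriv φ s) s :=
  ((h.smooth.differentiable (by simp)) s).hasDerivAt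

theorem deriv (h : IsTest a b φ) : IsTest a b (deriv φ) where
  smooth := h.smooth.deriv'
  compact := h.compact.deriv
  supp := (tsupport_deriv_subset (𝕜 := ℝ)).trans h.supp

/-- Since φ is supported in some [c, d] inside (a, b), ψ is constant on either side of [c, d]; its
values at a and b make both constants zero. -/
theorem of_deriv_eq (h : IsTest a b φ) (hab : a < b) (hψ : ∀ s, HasDerivAt ψ (φ s) s)
    (ha : ψ a = 0) (hb : ψ b = 0) : IsTest a b ψ := by
  obtain ⟨c, d, hac, hcd, hdb, hK⟩ := exists_Icc_of_isCompact hab h.compact.isCompact h.supp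
  have hd : Differentiable ℝ ψ := fun s => (hψ s).differentiableAt
  have hder : _root_.deriv ψ = φ := funext fun s => (hψ s).deriv
  have hz : ∀ s ∉ Icc c d, ψ s = 0 := by
    have key : ∀ u v, u ≤ v → (∀ t ∈ Icc u v, t ∉ Ioo c d) → ψ u = ψ v := fun u v huv H => by
      have := intervalIntegral.integral_eq_sub_of_hasDerivAt (a := u) (b := v) (f := ψ)
        (fun t _ => hψ t) (h.smooth.continuous.intervalIntegrable _ _)
      rw [intervalIntegral.integral_congr (g := fun _ => 0)] at this
      · simp only [intervalIntegral.integral_zero] at this; linarith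
      · intro t ht
        rw [uIcc_of_le huv] at ht
        exact image_eq_zero_of_notMem_tsupport fun h' => H t ht (hK h')
    intro s hs
    rw [mem_Icc, not_and_or, not_le, not_le] at hs
    rcases hs with hs | hs
    · rcases le_total s a with h1 | h1
      · rw [key s a h1 fun t ht h' => by linarith [h'.1, ht.2], ha]
      · rw [← key a s h1 fun t ht h' => by linarith [h'.1, ht.2], ha]
    · rcases le_total s b with h1 | h1
      · rw [key s b h1 fun t ht h' => by linarith [h'.2, ht.1], hb]
      · rw [← key b s h1 fun t ht h' => by linarith [h'.2, ht.1], hb]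
  have hsub : tsupport ψ ⊆ Icc c d :=
    closure_minimal (fun s hs => by_contra fun h' => hs (hz s h')) isClosed_Icc
  refine ⟨?_, isCompact_Icc.of_isClosed_subset (isClosed_tsupport _) hsub,
    hsub.trans fun s hs => ⟨hac.trans_le hs.1, hs.2.trans_lt hdb⟩⟩
  rw [contDiff_infty_iff_deriv]
  exact ⟨hd, hder ▸ h.smooth⟩

theorem sub_const_mul (h : IsTest a b φ) (h' : IsTest a b ψ) (c : ℝ) :
    IsTest a b (fun s => φ s - c * ψ s) := by
  have hsub : tsupport (fun s => φ s - c * ψ s) ⊆ tsupport φ ∪ tsupport ψ := by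
    refine closure_minimal (fun s hs => ?_) ((isClosed_tsupport _).union (isClosed_tsupport _))
    by_contra hn
    rw [mem_union, not_or] at hn
    exact hs (by simp [image_eq_zero_of_notMem_tsupport hn.1,
      image_eq_zero_of_notMem_tsupport hn.2])
  exact ⟨h.smooth.sub (contDiff_const.mul h'.smooth),
    (h.compact.isCompact.union h'.compact.isCompact).of_isClosed_subset (isClosed_tsupport _) hsub,
    hsub.trans (union_subset h.supp h'.supp)⟩

theorem integral_eq (h : IsTest a b φ) (hab : a ≤ b) (f : ℝ → ℝ) :
    ∫ s, φ s • f s = ∫ s in a..b, f s * φ s := by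
  rw [intervalIntegral.integral_of_le hab, ← integral_Ioc_eq_integral_Ioo.symm,
    ← integral_indicator measurableSet_Ioo]
  congr 1
  ext s
  by_cases hs : s ∈ Ioo a b
  · rw [indicator_of_mem hs, smul_eq_mul, mul_comm]
  · rw [indicator_of_notMem hs, h.eq_zero hs, zero_smul]

/-- A test function with vanishing integral is the derivative of a test function. -/
theorem exists_primitive (h : IsTest a b φ) (hab : a < b) (h0 : ∫ s in a..b, φ s = 0) :
    ∃ ψ, IsTest a b ψ ∧ ∀ s, _root_.deriv ψ s = φ s := by
  have hd : ∀ s, HasDerivAt (fun s => ∫ t in a..s, φ t) (φ s) s := fun s =>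
    intervalIntegral.integral_hasDerivAt_right (h.smooth.continuous.intervalIntegrable _ _)
      (h.smooth.continuous.stronglyMeasurableAtFilter _ _) h.smooth.continuous.continuousAt
  exact ⟨_, h.of_deriv_eq hab hd (by simp) h0, fun s => (hd s).deriv⟩

theorem exists_integral_eq_one (hab : a < b) : ∃ ψ, IsTest a b ψ ∧ ∫ s in a..b, ψ s = 1 := by
  let B : ContDiffBump ((a + b) / 2) := ⟨(b - a) / 8, (b - a) / 4, by linarith, by linarith⟩
  have hsupp : tsupport (B.normed volume) ⊆ Ioo a b := by
    rw [B.tsupport_normed_eq, Real.closedBall_eq_Icc]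
    intro s hs
    have h1 : B.rOut = (b - a) / 4 := rfl
    rw [h1] at hs
    exact ⟨by linarith [hs.1], by linarith [hs.2]⟩
  have hT : IsTest a b (B.normed volume) := ⟨B.contDiff_normed, B.hasCompactSupport_normed, hsupp⟩
  refine ⟨_, hT, ?_⟩
  have := hT.integral_eq hab.le (fun _ => 1)
  simp only [smul_eq_mul, mul_one, one_mul, B.integral_normed] at this
  exact this.symm

end IsTest

/-- If ψ has integral 1, every test function η becomes the derivative of a test function after
subtraction of (∫ η) ψ. So f pairs with η as the constant C = ∫ f ψ does, and the fundamental lemma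
applies to f − C. -/
theorem ae_eq_const_of_integral_mul_deriv_eq_zero {a b : ℝ} (hab : a < b) {f : ℝ → ℝ}
    (hf : IntervalIntegrable f volume a b)
    (h : ∀ φ, IsTest a b φ → ∫ s in a..b, f s * deriv φ s = 0) :
    ∃ C, ∀ᵐ s ∂(volume.restrict (Icc a b)), f s = C := by
  obtain ⟨ψ, hψ, hψ1⟩ := IsTest.exists_integral_eq_one hab
  refine ⟨∫ s in a..b, f s * ψ s, ?_⟩
  set C := ∫ s in a..b, f s * ψ s
  have hφi : ∀ {φ}, IsTest a b φ → IntervalIntegrable (fun s => f s * φ s) volume a b :=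
    fun hφ => hf.mul_continuousOn hφ.smooth.continuous.continuousOn
  have hfC : IntervalIntegrable (fun s => f s - C) volume a b :=
    hf.sub (continuous_const.intervalIntegrable _ _)
  rw [← restrict_Ioo_eq_restrict_Icc, ae_restrict_iff' measurableSet_Ioo]
  have := isOpen_Ioo.ae_eq_zero_of_integral_contDiff_smul_eq_zero (U := Ioo a b) (μ := volume)
    (f := fun s => f s - C) ?_ ?_
  · filter_upwards [this] with s hs hmem
    linarith [hs hmem]
  · rw [intervalIntegrable_iff_integrableOn_Ioo_of_le hab.le] at hfC
    exact hfC.locallyIntegrableOn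
  · intro η h1 h2 h3
    have hη : IsTest a b η := ⟨h1, h2, h3⟩
    have hηi : IntervalIntegrable η volume a b := h1.continuous.intervalIntegrable _ _
    have hψi : IntervalIntegrable ψ volume a b := hψ.smooth.continuous.intervalIntegrable _ _
    rw [hη.integral_eq hab.le]
    obtain ⟨φ, hφ, hφ'⟩ := (hη.sub_const_mul hψ (∫ s in a..b, η s)).exists_primitive hab (by
      rw [intervalIntegral.integral_sub hηi (hψi.const_mul _),
        intervalIntegral.integral_const_mul, hψ1, mul_one, sub_self])
    have hh := h φ hφ
    simp only [hφ'] at hh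
    have e1 : ∫ s in a..b, f s * (η s - (∫ s in a..b, η s) * ψ s) =
        (∫ s in a..b, f s * η s) - (∫ s in a..b, η s) * C := by
      rw [← intervalIntegral.integral_const_mul,
        ← intervalIntegral.integral_sub (hφi hη) ((hφi hψ).const_mul _)]
      congr 1; ext s; ring
    have e2 : ∫ s in a..b, (f s - C) * η s =
        (∫ s in a..b, f s * η s) - C * ∫ s in a..b, η s := by
      rw [← intervalIntegral.integral_const_mul,
        ← intervalIntegral.integral_sub (hφi hη) (hηi.const_mul _)]
      congr 1; ext s; ring
    rw [e2]; linarith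

/-- Du Bois-Reymond's lemma: a weak solution of `f' = g` is a primitive of `g`. -/
theorem ae_eq_primitive_of_weak {a b : ℝ} (hab : a < b) {f g : ℝ → ℝ}
    (hf : IntervalIntegrable f volume a b) (hg : IntervalIntegrable g volume a b)
    (h : ∀ φ, IsTest a b φ → ∫ s in a..b, (f s * deriv φ s + g s * φ s) = 0) :
    ∃ C, ∀ᵐ s ∂(volume.restrict (Icc a b)), f s = C + ∫ t in a..s, g t := by
  have hac := hg.absolutelyContinuousOnInterval_intervalIntegral (c := a) left_mem_uIcc
  have hG : IntervalIntegrable (fun s => ∫ t in a..s, g t) volume a b :=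
    hac.continuousOn.intervalIntegrable
  obtain ⟨C, hC⟩ := ae_eq_const_of_integral_mul_deriv_eq_zero hab (hf.sub hG) fun φ hφ => by
    -- Integration by parts without boundary terms: f minus the primitive of g is orthogonal to all
    -- derivatives of test functions.
    have hparts := hac.integral_mul_deriv_eq_deriv_mul
      (ac_of_contDiff (hφ.smooth.of_le (by simp)) a b)
    rw [hφ.eq_zero (s := a) (by simp), hφ.eq_zero (s := b) (by simp)] at hparts
    have hd : ∫ s in a..b, deriv (fun s => ∫ t in a..s, g t) s * φ s = ∫ s in a..b, g s * φ s := by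
      refine intervalIntegral.integral_congr_ae ?_
      filter_upwards [hg.ae_hasDerivAt_integral] with s hs hmem
      rw [(hs (uIoc_subset_uIcc hmem) a left_mem_uIcc).deriv]
    have h0 := h φ hφ
    have i1 : IntervalIntegrable (fun s => f s * deriv φ s) volume a b :=
      hf.mul_continuousOn hφ.deriv.smooth.continuous.continuousOn
    have i2 : IntervalIntegrable (fun s => g s * φ s) volume a b :=
      hg.mul_continuousOn hφ.smooth.continuous.continuousOn
    have i3 : IntervalIntegrable (fun s => (∫ t in a..s, g t) * deriv φ s) volume a b :=
      hG.mul_continuousOn hφ.deriv.smooth.continuous.continuousOn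
    rw [intervalIntegral.integral_add i1 i2] at h0
    simp only [sub_mul]
    rw [intervalIntegral.integral_sub i1 i3, hparts, hd]
    linarith
  exact ⟨C, hC.mono fun s hs => by linarith⟩

/-- A weak solution of the second order equation `f'' = g'` satisfies `f' = g + P` for a constant
`P`. -/
theorem ae_eq_primitive_of_weak_second {a b : ℝ} (hab : a < b) {f g : ℝ → ℝ}
    (hf : IntervalIntegrable f volume a b) (hg : IntervalIntegrable g volume a b)
    (h : ∀ φ, IsTest a b φ →
      ∫ s in a..b, (f s * deriv (deriv φ) s + g s * deriv φ s) = 0) :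
    ∃ P C, ∀ᵐ s ∂(volume.restrict (Icc a b)), f s = C + ∫ t in a..s, (g t + P) := by
  obtain ⟨ψ, hψ, hψ1⟩ := IsTest.exists_integral_eq_one hab
  refine ⟨-∫ s in a..b, (f s * deriv ψ s + g s * ψ s), ?_⟩
  set Q := ∫ s in a..b, (f s * deriv ψ s + g s * ψ s) with hQ
  have hφi : ∀ {φ}, IsTest a b φ →
      IntervalIntegrable (fun s => f s * deriv φ s + g s * φ s) volume a b := fun hφ =>
    (hf.mul_continuousOn hφ.deriv.smooth.continuous.continuousOn).add
      (hg.mul_continuousOn hφ.smooth.continuous.continuousOn)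
  refine ae_eq_primitive_of_weak hab hf (hg.add (continuous_const.intervalIntegrable _ _))
    fun η hη => ?_
  have hηi : IntervalIntegrable η volume a b := hη.smooth.continuous.intervalIntegrable _ _
  have hψi : IntervalIntegrable ψ volume a b := hψ.smooth.continuous.intervalIntegrable _ _
  -- Testing with φ where φ' = η − (∫ η) ψ lowers the order of the equation by one; the correction
  -- by ψ is what produces the constant P = −Q.
  obtain ⟨φ, hφ, hφ'⟩ := (hη.sub_const_mul hψ (∫ s in a..b, η s)).exists_primitive hab (by
    rw [intervalIntegral.integral_sub hηi (hψi.const_mul _),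
      intervalIntegral.integral_const_mul, hψ1, mul_one, sub_self])
  have hh := h φ hφ
  have hφ'' : ∀ s, deriv (deriv φ) s = deriv η s - (∫ s in a..b, η s) * deriv ψ s := fun s => by
    rw [funext hφ']
    exact ((hη.hasDerivAt s).sub ((hψ.hasDerivAt s).const_mul _)).deriv
  simp only [hφ', hφ''] at hh
  have e1 : ∫ s in a..b, (f s * (deriv η s - (∫ s in a..b, η s) * deriv ψ s) +
      g s * (η s - (∫ s in a..b, η s) * ψ s)) =
      (∫ s in a..b, (f s * deriv η s + g s * η s)) - (∫ s in a..b, η s) * Q := by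
    rw [hQ, ← intervalIntegral.integral_const_mul,
      ← intervalIntegral.integral_sub (hφi hη) ((hφi hψ).const_mul _)]
    congr 1; ext s; ring
  have e2 : ∫ s in a..b, (f s * deriv η s + (g s + -Q) * η s) =
      (∫ s in a..b, (f s * deriv η s + g s * η s)) - Q * ∫ s in a..b, η s := by
    rw [← intervalIntegral.integral_const_mul,
      ← intervalIntegral.integral_sub (hφi hη) (hηi.const_mul _)]
    congr 1; ext s; ring
  rw [e2]; linarith

/-! ### The moving frame along a horizontal curve -/

/-- The third column of `R`, the spatial tangent direction. -/
def tangent (R : ℝ → Mat3) (s : ℝ) : E3 := WithLp.toLp 2 fun k => R s k 2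

/-- The derivative of the third column of `R`, the curvature vector in space. -/
def normalVec (R : ℝ → Mat3) (s : ℝ) : E3 := WithLp.toLp 2 fun k => deriv (fun t => R t k 2) s

theorem SO3_transpose_mul {A : Mat3} (h : A ∈ Matrix.specialOrthogonalGroup (Fin 3) ℝ) :
    Aᵀ * A = 1 :=
  (Matrix.mem_orthogonalGroup_iff' (Fin 3) ℝ).1 (Matrix.mem_specialOrthogonalGroup_iff.1 h).1

theorem SO3_mul_transpose {A : Mat3} (h : A ∈ Matrix.specialOrthogonalGroup (Fin 3) ℝ) :
    A * Aᵀ = 1 :=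
  (Matrix.mem_orthogonalGroup_iff (Fin 3) ℝ).1 (Matrix.mem_specialOrthogonalGroup_iff.1 h).1

theorem SO3_col {A : Mat3} (h : A ∈ Matrix.specialOrthogonalGroup (Fin 3) ℝ) (i j : Fin 3) :
    A 0 i * A 0 j + A 1 i * A 1 j + A 2 i * A 2 j = if i = j then 1 else 0 := by
  have := congrFun (congrFun (SO3_transpose_mul h) i) j
  simpa [Matrix.mul_apply, Fin.sum_univ_three, Matrix.one_apply] using this

theorem SO3_row {A : Mat3} (h : A ∈ Matrix.specialOrthogonalGroup (Fin 3) ℝ) (i j : Fin 3) :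
    A i 0 * A j 0 + A i 1 * A j 1 + A i 2 * A j 2 = if i = j then 1 else 0 := by
  have := congrFun (congrFun (SO3_mul_transpose h) i) j
  simpa [Matrix.mul_apply, Fin.sum_univ_three, Matrix.one_apply] using this

theorem E3_inner (u v : E3) : inner ℝ u v = u 0 * v 0 + u 1 * v 1 + u 2 * v 2 := by
  simp [PiLp.inner_apply, Fin.sum_univ_three, mul_comm]

theorem E3_norm_sq (u : E3) : ‖u‖ ^ 2 = u 0 ^ 2 + u 1 ^ 2 + u 2 ^ 2 := by
  rw [EuclideanSpace.norm_sq_eq]; simp [Fin.sum_univ_three]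

theorem E2_norm_sq (u : E2) : ‖u‖ ^ 2 = u 0 ^ 2 + u 1 ^ 2 := by
  rw [EuclideanSpace.norm_sq_eq]; simp [Fin.sum_univ_two]

theorem E3_hasDerivAt {f : ℝ → E3} {f' : E3} {s : ℝ}
    (h : ∀ k, HasDerivAt (fun t => f t k) (f' k) s) : HasDerivAt f f' s := by
  have h1 : HasDerivAt (fun t => (f t).ofLp) f'.ofLp s := hasDerivAt_pi.2 h
  exact (PiLp.continuousLinearEquiv 2 ℝ (fun _ : Fin 3 => ℝ)).symm.hasFDerivAt.comp_hasDerivAt s h1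

theorem E3_hasDerivAt_apply {f : ℝ → E3} {f' : E3} {s : ℝ} (h : HasDerivAt f f' s) (k : Fin 3) :
    HasDerivAt (fun t => f t k) (f' k) s :=
  (EuclideanSpace.proj k : E3 →L[ℝ] ℝ).hasFDerivAt.comp_hasDerivAt s h

theorem coframe_rot (R : ℝ → Mat3) (s : ℝ) (i j : Fin 3) :
    ((R s)ᵀ * matDeriv R s) i j = R s 0 i * deriv (fun t => R t 0 j) s +
      R s 1 i * deriv (fun t => R t 1 j) s + R s 2 i * deriv (fun t => R t 2 j) s := by
  simp [Matrix.mul_apply, Fin.sum_univ_three, matDeriv]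

section Frame

variable {x : ℝ → E3} {R : ℝ → Mat3} {a b : ℝ}

/-- The equations of motion of the frame of a horizontal curve. -/
theorem IsHorizontalOn.frame_hasDerivAt (h : IsHorizontalOn x R a b) (hab : a ≤ b) :
    ∀ᵐ s ∂(volume.restrict (Icc a b)), ∀ k,
      HasDerivAt (fun t => R t k 0) (-(kappa x R s 0 * R s k 2)) s ∧
      HasDerivAt (fun t => R t k 1) (-(kappa x R s 1 * R s k 2)) s ∧
      HasDerivAt (fun t => R t k 2) (kappa x R s 0 * R s k 0 + kappa x R s 1 * R s k 1) s := by
  have hd : ∀ᵐ s ∂(volume.restrict (Icc a b)), ∀ i j,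
      HasDerivAt (fun t => R t i j) (deriv (fun t => R t i j) s) s := by
    rw [ae_all_iff]; intro i; rw [ae_all_iff]; intro j
    exact ac_ae_hasDerivAt hab (h.ac_rot i j)
  filter_upwards [hd, h.horizontal, ae_mem_Ioo a b] with s hs hH hmem
  have hR := h.mem_SO3 s (Ioo_subset_Icc_self hmem)
  -- Differentiation of RᵀR = 1, which holds near the interior point s.
  have hanti : ∀ i j, ((R s)ᵀ * matDeriv R s) i j + ((R s)ᵀ * matDeriv R s) j i = 0 := by
    intro i j
    have h1 := (((hs 0 i).fun_mul (hs 0 j)).fun_add ((hs 1 i).fun_mul (hs 1 j))).fun_add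
      ((hs 2 i).fun_mul (hs 2 j))
    have h2 : HasDerivAt (fun t => R t 0 i * R t 0 j + R t 1 i * R t 1 j + R t 2 i * R t 2 j)
        0 s := by
      refine (hasDerivAt_const s (if i = j then (1 : ℝ) else 0)).congr_of_eventuallyEq ?_
      filter_upwards [Icc_mem_nhds hmem.1 hmem.2] with t ht
      exact SO3_col (h.mem_SO3 t ht) i j
    have := h1.unique h2
    rw [coframe_rot, coframe_rot]
    linarith
  -- Thus R' = RΩ with Ω antisymmetric; ω⁶ = 0 leaves only its entries κ₁, κ₂ and their negatives.
  have hD : matDeriv R s = R s * ((R s)ᵀ * matDeriv R s) := by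
    rw [← Matrix.mul_assoc, SO3_mul_transpose hR, Matrix.one_mul]
  set Ω := (R s)ᵀ * matDeriv R s with hΩ
  have k0 : kappa x R s 0 = Ω 0 2 := by simp [kappa, coframe, hΩ]
  have k1 : kappa x R s 1 = -Ω 2 1 := by simp [kappa, coframe, hΩ]
  have h10 : Ω 1 0 = 0 := by simpa [coframe, hΩ] using hH.2.2
  have hent : ∀ k j, deriv (fun t => R t k j) s =
      R s k 0 * Ω 0 j + R s k 1 * Ω 1 j + R s k 2 * Ω 2 j := fun k j => by
    have := congrFun (congrFun hD k) j
    simpa [Matrix.mul_apply, Fin.sum_univ_three, matDeriv] using this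
  intro k
  refine ⟨?_, ?_, ?_⟩
  · convert! hs k 0 using 1
    rw [hent, k0]; linear_combination -(R s k 1) * h10 - R s k 0 / 2 * hanti 0 0
      - R s k 2 * hanti 0 2
  · convert! hs k 1 using 1
    rw [hent, k1]; linear_combination -(R s k 1) / 2 * hanti 1 1 - R s k 0 * hanti 0 1
      + R s k 0 * h10
  · convert! hs k 2 using 1
    rw [hent, k0, k1]; linear_combination -(R s k 2) / 2 * hanti 2 2 - R s k 1 * hanti 1 2

theorem norm_tangent {s : ℝ} (h : R s ∈ Matrix.specialOrthogonalGroup (Fin 3) ℝ) :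
    ‖tangent R s‖ = 1 := by
  have h1 : ‖tangent R s‖ ^ 2 = 1 := by
    rw [E3_norm_sq]
    have := SO3_col h 2 2
    simp only [tangent, if_true] at this ⊢
    linarith
  nlinarith [norm_nonneg (tangent R s)]

theorem ac_tangent (h : IsHorizontalOn x R a b) : AbsolutelyContinuousOnInterval (tangent R) a b :=
  ac_of_apply fun k => h.ac_rot k 2

theorem IsHorizontalOn.tangent_hasDerivAt (h : IsHorizontalOn x R a b) (hab : a ≤ b) :
    ∀ᵐ s ∂(volume.restrict (Icc a b)), HasDerivAt (tangent R) (normalVec R s) s ∧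
      (∀ k, normalVec R s k = kappa x R s 0 * R s k 0 + kappa x R s 1 * R s k 1) ∧
      inner ℝ (tangent R s) (normalVec R s) = 0 ∧ ‖normalVec R s‖ = ‖kappa x R s‖ := by
  filter_upwards [h.frame_hasDerivAt hab, ae_mem_Ioo a b] with s hs hmem
  have hR := h.mem_SO3 s (Ioo_subset_Icc_self hmem)
  have hN : ∀ k, normalVec R s k = kappa x R s 0 * R s k 0 + kappa x R s 1 * R s k 1 :=
    fun k => (hs k).2.2.deriv
  have c00 := SO3_col hR 0 0
  have c01 := SO3_col hR 0 1
  have c11 := SO3_col hR 1 1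
  have c02 := SO3_col hR 0 2
  have c12 := SO3_col hR 1 2
  simp only [if_true, Fin.reduceEq, if_false] at c00 c01 c11 c02 c12
  refine ⟨E3_hasDerivAt fun k => ?_, hN, ?_, ?_⟩
  · rw [hN]; exact (hs k).2.2
  · rw [E3_inner, hN, hN, hN]
    simp only [tangent]
    linear_combination kappa x R s 0 * c02 + kappa x R s 1 * c12
  · refine (sq_eq_sq₀ (norm_nonneg _) (norm_nonneg _)).1 ?_
    rw [E3_norm_sq, E2_norm_sq, hN, hN, hN]
    linear_combination kappa x R s 0 ^ 2 * c00 + kappa x R s 1 ^ 2 * c11 +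
      2 * kappa x R s 0 * kappa x R s 1 * c01

/-- The coframe conditions say Rᵀx' = e_z almost everywhere, so x' is the third column of R there.
That column is continuous, which upgrades the statement to every interior point. -/
theorem IsHorizontalOn.pos_hasDerivAt (h : IsHorizontalOn x R a b) (hab : a ≤ b)
    (harc : ∀ᵐ s ∂(volume.restrict (Icc a b)), coframe x R s 2 = 1) :
    ∀ s ∈ Ioo a b, HasDerivAt x (tangent R s) s := by
  have hd : ∀ᵐ s ∂(volume.restrict (Icc a b)), ∀ k,
      HasDerivAt (fun t => x t k) (deriv (fun t => x t k) s) s := by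
    rw [ae_all_iff]; intro k
    exact ac_ae_hasDerivAt hab (ac_apply h.ac_pos k)
  have hk : ∀ᵐ s ∂(volume.restrict (Icc a b)), ∀ k, HasDerivAt (fun t => x t k) (R s k 2) s := by
    filter_upwards [hd, h.horizontal, harc, ae_mem_Ioo a b] with s hs hH h2 hmem k
    have hR := h.mem_SO3 s (Ioo_subset_Icc_self hmem)
    have hx : HasDerivAt x (WithLp.toLp 2 fun k => deriv (fun t => x t k) s) s :=
      E3_hasDerivAt fun k => hs k
    have hv : (R s)ᵀ *ᵥ (deriv x s).ofLp = ez := by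
      ext i
      fin_cases i
      · simpa [coframe, ez] using hH.1
      · simpa [coframe, ez] using hH.2.1
      · simpa [coframe, ez] using h2
    have hv' : (deriv x s).ofLp = R s *ᵥ ez := by
      rw [← hv, Matrix.mulVec_mulVec, SO3_mul_transpose hR, Matrix.one_mulVec]
    have := congrFun hv' k
    convert! hs k using 1
    rw [hx.deriv] at this
    simp only at this
    rw [this]
    simp [ez, Matrix.mulVec, dotProduct, Fin.sum_univ_three]
  intro s hs
  refine E3_hasDerivAt fun k => ?_
  refine ac_hasDerivAt_of_continuousOn hab (ac_apply h.ac_pos k) (φ := fun s => R s k 2) ?_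
    (hk.mono fun s h => h k) s hs
  have := (h.ac_rot k 2).continuousOn
  rwa [uIcc_of_le hab] at this

theorem aestronglyMeasurable_normalVec (μ : Measure ℝ) :
    AEStronglyMeasurable (normalVec R) μ := by
  have h1 : Measurable fun s => (fun k : Fin 3 => deriv (fun t => R t k 2) s) :=
    measurable_pi_lambda _ fun k => measurable_deriv _
  exact ((WithLp.measurable_toLp 2 (Fin 3 → ℝ)).comp h1).aestronglyMeasurable

/-- The norm is bounded by the sum of the absolute coordinates, each the derivative of an absolutely
continuous function. This integrability is all the regularity of the curvature available before the
Euler-Lagrange equation is used. -/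
theorem intervalIntegrable_normalVec (h : IsHorizontalOn x R a b) :
    IntervalIntegrable (fun s => ‖normalVec R s‖) volume a b := by
  have hk : ∀ k, IntervalIntegrable (fun s => ‖deriv (fun t => R t k 2) s‖) volume a b := fun k =>
    (h.ac_rot k 2).intervalIntegrable_deriv.norm
  refine (((hk 0).add (hk 1)).add (hk 2)).mono_fun'
    (aestronglyMeasurable_normalVec _).norm (Filter.Eventually.of_forall fun s => ?_)
  have h1 : ‖normalVec R s‖ ^ 2 = _ := E3_norm_sq _
  have h2 : ∀ k, normalVec R s k = deriv (fun t => R t k 2) s := fun k => rfl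
  rw [h2, h2, h2] at h1
  simp only [Real.norm_eq_abs] at *
  refine abs_le_of_sq_le_sq' ?_ (by positivity) |>.2
  rw [sq_abs, h1, ← sq_abs (deriv (fun t => R t 0 2) s), ← sq_abs (deriv (fun t => R t 1 2) s),
    ← sq_abs (deriv (fun t => R t 2 2) s)]
  have a0 := abs_nonneg (deriv (fun t => R t 0 2) s)
  have a1 := abs_nonneg (deriv (fun t => R t 1 2) s)
  have a2 := abs_nonneg (deriv (fun t => R t 2 2) s)
  nlinarith [mul_nonneg a0 a1, mul_nonneg a0 a2, mul_nonneg a1 a2]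

end Frame

/-! ### The Lagrangian and its first variation -/

/-- The derivative of `y' / ‖y'‖`, as a function of `p = y'` and `q = y''`. -/
def dirDeriv (p q : E3) : E3 := ‖p‖⁻¹ • q - (inner ℝ p q * ‖p‖⁻¹ ^ 3) • p

/-- The integrand `√(κ² + β²) ‖y'‖` of the energy, as a function of `p = y'` and `q = y''`. -/
def lagrangian (β : ℝ) (p q : E3) : ℝ := √(β ^ 2 * ‖p‖ ^ 2 + ‖dirDeriv p q‖ ^ 2)

/-- The numerator is ‖p × q‖², so `dirDeriv p q` has length κ‖p‖. This is what turns the energy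
integrand into `lagrangian`. -/
theorem norm_sq_dirDeriv {p q : E3} (hp : p ≠ 0) :
    ‖dirDeriv p q‖ ^ 2 = (‖p‖ ^ 2 * ‖q‖ ^ 2 - inner ℝ p q ^ 2) / ‖p‖ ^ 4 := by
  have hn : ‖p‖ ≠ 0 := norm_ne_zero_iff.2 hp
  rw [dirDeriv, norm_sub_sq_real, norm_smul, norm_smul, inner_smul_left, inner_smul_right,
    real_inner_comm p q]
  simp only [norm_inv, Real.norm_eq_abs, abs_norm, mul_pow, sq_abs, RCLike.conj_to_real]
  field_simp
  ring

theorem energy_integrand_eq {β : ℝ} {p q : E3} (hp : p ≠ 0) :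
    √((√(‖p‖ ^ 2 * ‖q‖ ^ 2 - inner ℝ p q ^ 2) / ‖p‖ ^ 3) ^ 2 + β ^ 2) * ‖p‖ =
      lagrangian β p q := by
  have hn : ‖p‖ ≠ 0 := norm_ne_zero_iff.2 hp
  have h0 : 0 ≤ ‖p‖ ^ 2 * ‖q‖ ^ 2 - inner ℝ p q ^ 2 := by
    have := abs_real_inner_le_norm p q
    have h2 := sq_le_sq' (by linarith [neg_abs_le (inner ℝ p q), norm_nonneg p, norm_nonneg q])
      ((le_abs_self _).trans this)
    nlinarith
  rw [lagrangian, norm_sq_dirDeriv hp, div_pow, Real.sq_sqrt h0]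
  conv_lhs => rhs; rw [← Real.sqrt_sq (norm_nonneg p)]
  rw [← Real.sqrt_mul (add_nonneg (div_nonneg h0 (by positivity)) (sq_nonneg β))]
  congr 1
  field_simp
  ring

/-- The derivative of `dirDeriv` at `(p, q)` in the direction `(u, v)`. -/
def dirDerivVar (p q u v : E3) : E3 :=
  (-(inner ℝ p u * ‖p‖⁻¹ ^ 3)) • q + ‖p‖⁻¹ • v -
    ((inner ℝ u q + inner ℝ p v) * ‖p‖⁻¹ ^ 3 -
      inner ℝ p q * (3 * ‖p‖⁻¹ ^ 5 * inner ℝ p u)) • p - (inner ℝ p q * ‖p‖⁻¹ ^ 3) • u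

/-- The derivative of the Lagrangian at `(p, q)` in the direction `(u, v)`. -/
def lagrangianVar (β : ℝ) (p q u v : E3) : ℝ :=
  (β ^ 2 * inner ℝ p u + inner ℝ (dirDeriv p q) (dirDerivVar p q u v)) / lagrangian β p q

section Line

variable {T N u v : E3} {h : ℝ}

theorem hasDerivAt_line (T u : E3) (h : ℝ) : HasDerivAt (fun h : ℝ => T + h • u) u h := by
  simpa using ((hasDerivAt_id h).smul_const u).const_add T

theorem hasDerivAt_inv_norm_line (hp : T + h • u ≠ 0) :
    HasDerivAt (fun h : ℝ => ‖T + h • u‖⁻¹)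
      (-(inner ℝ (T + h • u) u * ‖T + h • u‖⁻¹ ^ 3)) h := by
  have hn : ‖T + h • u‖ ≠ 0 := norm_ne_zero_iff.2 hp
  -- The norm is differentiated as the root of its square, which is nonzero here.
  have h1 : HasDerivAt (fun h : ℝ => √(‖T + h • u‖ ^ 2)) _ h :=
    (hasDerivAt_line T u h).norm_sq.sqrt (pow_ne_zero 2 hn)
  simp only [Real.sqrt_sq (norm_nonneg _)] at h1
  convert! h1.fun_inv hn using 1
  field_simp

theorem hasDerivAt_dirDeriv_line (hp : T + h • u ≠ 0) :
    HasDerivAt (fun h : ℝ => dirDeriv (T + h • u) (N + h • v))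
      (dirDerivVar (T + h • u) (N + h • v) u v) h := by
  have h1 := hasDerivAt_inv_norm_line hp
  have h2 := (hasDerivAt_line T u h).inner ℝ (hasDerivAt_line N v h)
  have h3 := (h1.fun_smul (hasDerivAt_line N v h)).fun_sub
    ((h2.fun_mul (h1.fun_pow 3)).fun_smul (hasDerivAt_line T u h))
  convert! h3 using 1
  simp only [dirDerivVar]
  module

theorem lagrangian_pos {β : ℝ} (hβ : 0 < β) {p q : E3} (hp : p ≠ 0) : 0 < lagrangian β p q := by
  have hn : 0 < ‖p‖ := norm_pos_iff.2 hp
  exact Real.sqrt_pos.2 (by positivity)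

theorem hasDerivAt_lagrangian_line {β : ℝ} (hβ : 0 < β) (hp : T + h • u ≠ 0) :
    HasDerivAt (fun h : ℝ => lagrangian β (T + h • u) (N + h • v))
      (lagrangianVar β (T + h • u) (N + h • v) u v) h := by
  have hpos := lagrangian_pos hβ hp (q := N + h • v)
  have h1 := (((hasDerivAt_line T u h).norm_sq.const_mul (β ^ 2)).fun_add
    (hasDerivAt_dirDeriv_line (N := N) (v := v) hp).norm_sq).sqrt (Real.sqrt_pos.1 hpos).ne'
  convert! h1 using 1
  rw [lagrangianVar, lagrangian] at *
  field_simp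

/-- Both β‖p‖ and ‖`dirDeriv p q`‖ are at most the Lagrangian, so after Cauchy-Schwarz the
denominator cancels them. -/
theorem abs_lagrangianVar_le {β : ℝ} (hβ : 0 < β) {p q : E3} (hp : p ≠ 0) :
    |lagrangianVar β p q u v| ≤ β * ‖u‖ + ‖dirDerivVar p q u v‖ := by
  have hpos := lagrangian_pos hβ hp (q := q)
  have e1 : β * ‖p‖ ≤ lagrangian β p q := Real.le_sqrt_of_sq_le (by
    rw [mul_pow]; linarith [sq_nonneg ‖dirDeriv p q‖])
  have e2 : ‖dirDeriv p q‖ ≤ lagrangian β p q := Real.le_sqrt_of_sq_le (by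
    linarith [sq_nonneg (β * ‖p‖), mul_pow β ‖p‖ 2])
  rw [lagrangianVar, abs_div, abs_of_pos hpos, div_le_iff₀ hpos]
  calc |β ^ 2 * inner ℝ p u + inner ℝ (dirDeriv p q) (dirDerivVar p q u v)|
      ≤ β ^ 2 * (‖p‖ * ‖u‖) + ‖dirDeriv p q‖ * ‖dirDerivVar p q u v‖ := by
        refine (abs_add_le _ _).trans (add_le_add ?_ (abs_real_inner_le_norm _ _))
        rw [abs_mul, abs_of_nonneg (sq_nonneg β)]
        gcongr; exact abs_real_inner_le_norm _ _
    _ = β * ‖u‖ * (β * ‖p‖) + ‖dirDerivVar p q u v‖ * ‖dirDeriv p q‖ := by ring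
    _ ≤ β * ‖u‖ * lagrangian β p q + ‖dirDerivVar p q u v‖ * lagrangian β p q := by gcongr
    _ = _ := by ring

/-- Since `dirDerivVar` is affine in q, it grows at most linearly with ‖q‖, which makes the
dominating function integrable. The constants add up the bounds `t1` to `t4`, obtained from ‖p‖⁻¹ ≤
2. -/
theorem norm_dirDerivVar_le {M : ℝ} {p q : E3} (hp : 1 / 2 ≤ ‖p‖) (hp' : ‖p‖ ≤ 3 / 2)
    (hu : ‖u‖ ≤ M) (hv : ‖v‖ ≤ M) :
    ‖dirDerivVar p q u v‖ ≤ 360 * M * ‖q‖ + 20 * M := by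
  have hM : 0 ≤ M := (norm_nonneg u).trans hu
  have hr0 : 0 ≤ ‖p‖⁻¹ := by positivity
  have hr : ‖p‖⁻¹ ≤ 2 := by
    rw [inv_le_comm₀ (by linarith) (by norm_num)]; linarith
  have hr3 : ‖p‖⁻¹ ^ 3 ≤ 8 := (pow_le_pow_left₀ hr0 hr 3).trans (by norm_num)
  have hr5 : ‖p‖⁻¹ ^ 5 ≤ 32 := (pow_le_pow_left₀ hr0 hr 5).trans (by norm_num)
  have ipu : |inner ℝ p u| ≤ 3 / 2 * M := (abs_real_inner_le_norm _ _).trans (by gcongr)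
  have ipv : |inner ℝ p v| ≤ 3 / 2 * M := (abs_real_inner_le_norm _ _).trans (by gcongr)
  have iuq : |inner ℝ u q| ≤ M * ‖q‖ := (abs_real_inner_le_norm _ _).trans (by gcongr)
  have ipq : |inner ℝ p q| ≤ 3 / 2 * ‖q‖ := (abs_real_inner_le_norm _ _).trans (by gcongr)
  have t1 : ‖(-(inner ℝ p u * ‖p‖⁻¹ ^ 3)) • q‖ ≤ 3 / 2 * M * 8 * ‖q‖ := by
    rw [norm_smul, norm_neg, norm_mul, Real.norm_eq_abs, Real.norm_eq_abs,
      abs_of_nonneg (pow_nonneg hr0 3)]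
    gcongr
  have t2 : ‖‖p‖⁻¹ • v‖ ≤ 2 * M := by
    rw [norm_smul, norm_inv, norm_norm]; gcongr
  have t3 : ‖((inner ℝ u q + inner ℝ p v) * ‖p‖⁻¹ ^ 3 -
      inner ℝ p q * (3 * ‖p‖⁻¹ ^ 5 * inner ℝ p u)) • p‖ ≤
      ((M * ‖q‖ + 3 / 2 * M) * 8 + 3 / 2 * ‖q‖ * (3 * 32 * (3 / 2 * M))) * (3 / 2) := by
    rw [norm_smul]
    refine mul_le_mul ?_ hp' (norm_nonneg _) (by positivity)
    refine (norm_sub_le _ _).trans (add_le_add ?_ ?_)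
    · rw [norm_mul, Real.norm_eq_abs, Real.norm_eq_abs, abs_of_nonneg (pow_nonneg hr0 3)]
      gcongr
      exact (abs_add_le _ _).trans (add_le_add iuq ipv)
    · rw [norm_mul, norm_mul, norm_mul, Real.norm_eq_abs, Real.norm_eq_abs, Real.norm_eq_abs,
        Real.norm_eq_abs, abs_of_nonneg (pow_nonneg hr0 5), abs_of_pos (by norm_num : (0 : ℝ) < 3)]
      gcongr
  have t4 : ‖(inner ℝ p q * ‖p‖⁻¹ ^ 3) • u‖ ≤ 3 / 2 * ‖q‖ * 8 * M := by
    rw [norm_smul, norm_mul, Real.norm_eq_abs, Real.norm_eq_abs, abs_of_nonneg (pow_nonneg hr0 3)]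
    gcongr
  have := norm_sub_le ((-(inner ℝ p u * ‖p‖⁻¹ ^ 3)) • q + ‖p‖⁻¹ • v -
    ((inner ℝ u q + inner ℝ p v) * ‖p‖⁻¹ ^ 3 -
      inner ℝ p q * (3 * ‖p‖⁻¹ ^ 5 * inner ℝ p u)) • p) ((inner ℝ p q * ‖p‖⁻¹ ^ 3) • u)
  have h2 := norm_sub_le ((-(inner ℝ p u * ‖p‖⁻¹ ^ 3)) • q + ‖p‖⁻¹ • v)
    (((inner ℝ u q + inner ℝ p v) * ‖p‖⁻¹ ^ 3 -
      inner ℝ p q * (3 * ‖p‖⁻¹ ^ 5 * inner ℝ p u)) • p)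
  have h3 := norm_add_le ((-(inner ℝ p u * ‖p‖⁻¹ ^ 3)) • q) (‖p‖⁻¹ • v)
  rw [dirDerivVar]
  nlinarith [mul_nonneg hM (norm_nonneg q)]

/-- For unit T orthogonal to N, `dirDeriv T N` is N itself. The term −‖N‖² comes from
differentiating the factor ‖p‖⁻¹ in `dirDeriv`. -/
theorem lagrangianVar_unit {β : ℝ} (hT : ‖T‖ = 1) (hTN : inner ℝ T N = 0) :
    lagrangianVar β T N u v = (β ^ 2 - ‖N‖ ^ 2) / √(‖N‖ ^ 2 + β ^ 2) * inner ℝ T u +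
      1 / √(‖N‖ ^ 2 + β ^ 2) * inner ℝ N v := by
  have hD : dirDeriv T N = N := by simp [dirDeriv, hT, hTN]
  rw [lagrangianVar, lagrangian, hD, hT, dirDerivVar, hT, hTN]
  simp only [inner_sub_right, inner_add_right, inner_smul_right, real_inner_comm T N, hTN,
    real_inner_self_eq_norm_sq]
  rw [add_comm (β ^ 2 * 1 ^ 2)]
  simp only [one_pow, mul_one, inv_one, one_mul, mul_zero, zero_mul, sub_zero]
  ring

end Line

/-- Differentiation of the energy under the integral sign. -/
theorem hasDerivAt_integral_lagrangian {β a b M : ℝ} (hβ : 0 < β) {T N u v : ℝ → E3} (hab : a ≤ b)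
    (mT : AEStronglyMeasurable T (volume.restrict (Icc a b)))
    (mN : AEStronglyMeasurable N (volume.restrict (Icc a b)))
    (mu : AEStronglyMeasurable u (volume.restrict (Icc a b)))
    (mv : AEStronglyMeasurable v (volume.restrict (Icc a b)))
    (hT : ∀ᵐ s ∂(volume.restrict (Icc a b)), ‖T s‖ = 1)
    (hTN : ∀ᵐ s ∂(volume.restrict (Icc a b)), inner ℝ (T s) (N s) = 0)
    (hN : IntervalIntegrable (fun s => ‖N s‖) volume a b)
    (hu : ∀ s, ‖u s‖ ≤ M) (hv : ∀ s, ‖v s‖ ≤ M) :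
    HasDerivAt (fun h : ℝ => ∫ s in a..b, lagrangian β (T s + h • u s) (N s + h • v s))
      (∫ s in a..b, ((β ^ 2 - ‖N s‖ ^ 2) / √(‖N s‖ ^ 2 + β ^ 2) * inner ℝ (T s) (u s) +
        1 / √(‖N s‖ ^ 2 + β ^ 2) * inner ℝ (N s) (v s))) 0 := by
  have hM : 0 ≤ M := (norm_nonneg _).trans (hu 0)
  have hI : uIoc a b = Ioc a b := uIoc_of_le hab
  have hμ : volume.restrict (uIoc a b) = volume.restrict (Icc a b) := by
    rw [hI, restrict_Ioc_eq_restrict_Icc]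
  -- The radius 1 / (2(M + 1)) forces ‖h u‖ ≤ 1/2 and ‖h v‖ ≤ 1/2, so T + h u keeps its norm between
  -- 1/2 and 3/2 and the bounds above apply uniformly in h.
  have key := intervalIntegral.hasDerivAt_integral_of_dominated_loc_of_deriv_le (μ := volume)
    (a := a) (b := b) (𝕜 := ℝ) (x₀ := 0) (s := Metric.ball 0 (1 / (2 * (M + 1))))
    (F := fun h s => lagrangian β (T s + h • u s) (N s + h • v s))
    (F' := fun h s => lagrangianVar β (T s + h • u s) (N s + h • v s) (u s) (v s))
    (bound := fun s => β * M + (360 * M * (‖N s‖ + 1) + 20 * M))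
    (Metric.ball_mem_nhds _ (by positivity)) ?_ ?_ ?_ ?_ ?_ ?_
  · convert! key.2 using 1
    refine intervalIntegral.integral_congr_ae ?_
    rw [← ae_restrict_iff' measurableSet_uIoc, hμ]
    filter_upwards [hT, hTN] with s h1 h2
    simp only [zero_smul, add_zero]
    rw [lagrangianVar_unit h1 h2]
  · refine Filter.Eventually.of_forall fun h => ?_
    rw [hμ]
    have m1 := mT.aemeasurable
    have m2 := mN.aemeasurable
    have m3 := mu.aemeasurable
    have m4 := mv.aemeasurable
    refine AEMeasurable.aestronglyMeasurable ?_
    unfold lagrangian dirDeriv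
    fun_prop
  · simp only [zero_smul, add_zero]
    refine ((hN.add (continuous_const.intervalIntegrable (μ := volume) a b
      (u := fun _ : ℝ => β)))).mono_fun' ?_ ?_
    · rw [hμ]
      have m1 := mT.aemeasurable
      have m2 := mN.aemeasurable
      refine AEMeasurable.aestronglyMeasurable ?_
      unfold lagrangian dirDeriv
      fun_prop
    · rw [hμ]
      filter_upwards [hT, hTN] with s h1 h2
      have hD : dirDeriv (T s) (N s) = N s := by simp [dirDeriv, h1, h2]
      rw [lagrangian, hD, h1, Real.norm_eq_abs, abs_of_nonneg (Real.sqrt_nonneg _)]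
      refine Real.sqrt_le_iff.2 ⟨by positivity, ?_⟩
      have := mul_nonneg (norm_nonneg (N s)) hβ.le
      nlinarith
  · rw [hμ]
    have m1 := mT.aemeasurable
    have m2 := mN.aemeasurable
    have m3 := mu.aemeasurable
    have m4 := mv.aemeasurable
    refine AEMeasurable.aestronglyMeasurable ?_
    unfold lagrangianVar dirDerivVar lagrangian dirDeriv
    fun_prop
  all_goals first | rw [← ae_restrict_iff' measurableSet_uIoc, hμ] | skip
  · filter_upwards [hT] with s h1 h hh
    rw [mem_ball_zero_iff, Real.norm_eq_abs, lt_div_iff₀ (by positivity)] at hh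
    have hs : ∀ z : E3, ‖z‖ ≤ M → ‖h • z‖ ≤ 1 / 2 := fun z hz => by
      rw [norm_smul, Real.norm_eq_abs]
      nlinarith [abs_nonneg h, mul_le_mul_of_nonneg_left hz (abs_nonneg h)]
    have hp : 1 / 2 ≤ ‖T s + h • u s‖ := by
      have := norm_sub_le (T s + h • u s) (h • u s)
      rw [add_sub_cancel_right, h1] at this
      linarith [hs _ (hu s)]
    have hp' : ‖T s + h • u s‖ ≤ 3 / 2 :=
      (norm_add_le _ _).trans (by linarith [hs _ (hu s)])
    have hq : ‖N s + h • v s‖ ≤ ‖N s‖ + 1 :=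
      (norm_add_le _ _).trans (by linarith [hs _ (hv s)])
    have hne : T s + h • u s ≠ 0 := norm_pos_iff.1 (by linarith)
    rw [Real.norm_eq_abs]
    refine (abs_lagrangianVar_le hβ hne).trans ?_
    have := norm_dirDerivVar_le (q := N s + h • v s) hp hp' (hu s) (hv s)
    have h2 := mul_le_mul_of_nonneg_left hq (by positivity : 0 ≤ 360 * M)
    have h3 := mul_le_mul_of_nonneg_left (hu s) hβ.le
    linarith
  · exact (continuous_const.intervalIntegrable _ _).add
      (((hN.add (continuous_const.intervalIntegrable _ _)).const_mul _).add
        (continuous_const.intervalIntegrable _ _))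
  · filter_upwards [hT] with s h1 h hh
    rw [mem_ball_zero_iff, Real.norm_eq_abs, lt_div_iff₀ (by positivity)] at hh
    refine hasDerivAt_lagrangian_line hβ fun h0 => ?_
    have h2 : ‖T s‖ = ‖h • u s‖ := by rw [eq_neg_of_add_eq_zero_left h0, norm_neg]
    rw [h1, norm_smul, Real.norm_eq_abs] at h2
    nlinarith [abs_nonneg h, mul_le_mul_of_nonneg_left (hu s) (abs_nonneg h)]

/-! ### Horizontal lifts -/

/-- The rotation about the third axis. -/
def rotZ (θ : ℝ) : Mat3 := !![Real.cos θ, -Real.sin θ, 0; Real.sin θ, Real.cos θ, 0; 0, 0, 1]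

theorem mem_SO3_of {A : Mat3} (h : Aᵀ * A = 1) (hd : A.det = 1) :
    A ∈ Matrix.specialOrthogonalGroup (Fin 3) ℝ :=
  Matrix.mem_specialOrthogonalGroup_iff.2 ⟨(Matrix.mem_orthogonalGroup_iff' (Fin 3) ℝ).2 h, hd⟩

theorem rotZ_mem (θ : ℝ) : rotZ θ ∈ Matrix.specialOrthogonalGroup (Fin 3) ℝ := by
  have hcs := Real.sin_sq_add_cos_sq θ
  refine mem_SO3_of ?_ ?_
  · ext i j
    fin_cases i <;> fin_cases j <;>
      simp [rotZ, Matrix.mul_apply, Fin.sum_univ_three] <;> linarith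
  · rw [Matrix.det_fin_three]
    simp [rotZ]
    linarith

/-- The positively oriented orthonormal frame with first vector `e` and third vector `U`. -/
def frameOf (e U : E3) : Mat3 :=
  !![e 0, U 1 * e 2 - U 2 * e 1, U 0;
     e 1, U 2 * e 0 - U 0 * e 2, U 1;
     e 2, U 0 * e 1 - U 1 * e 0, U 2]

theorem frameOf_mem {e U : E3} (he : ‖e‖ = 1) (hU : ‖U‖ = 1) (heU : inner ℝ e U = 0) :
    frameOf e U ∈ Matrix.specialOrthogonalGroup (Fin 3) ℝ := by
  have h1 : e 0 ^ 2 + e 1 ^ 2 + e 2 ^ 2 = 1 := by rw [← E3_norm_sq, he, one_pow]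
  have h2 : U 0 ^ 2 + U 1 ^ 2 + U 2 ^ 2 = 1 := by rw [← E3_norm_sq, hU, one_pow]
  have h3 : e 0 * U 0 + e 1 * U 1 + e 2 * U 2 = 0 := by rw [← E3_inner, heU]
  refine mem_SO3_of ?_ ?_
  · ext i j
    fin_cases i <;> fin_cases j <;> simp [frameOf, Matrix.mul_apply, Fin.sum_univ_three]
    · linear_combination h1
    · ring
    · linear_combination h3
    · ring
    · linear_combination h1 * (U 0 ^ 2 + U 1 ^ 2 + U 2 ^ 2) + h2 -
        (e 0 * U 0 + e 1 * U 1 + e 2 * U 2) * h3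
    · ring
    · linear_combination h3
    · ring
    · linear_combination h2
  · rw [Matrix.det_fin_three]
    simp [frameOf]
    linear_combination h1 * (U 0 ^ 2 + U 1 ^ 2 + U 2 ^ 2) + h2 -
        (e 0 * U 0 + e 1 * U 1 + e 2 * U 2) * h3

/-- The transpose and, since the determinant is 1, the adjugate both equal the inverse. Comparing
entries shows that each column is the cross product of the other two. -/
theorem SO3_adjugate {A : Mat3} (h : A ∈ Matrix.specialOrthogonalGroup (Fin 3) ℝ) :
    A.adjugate = Aᵀ := by
  have hd : A.det = 1 := (Matrix.mem_specialOrthogonalGroup_iff.1 h).2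
  calc A.adjugate = (Aᵀ * A) * A.adjugate := by rw [SO3_transpose_mul h, Matrix.one_mul]
    _ = Aᵀ := by rw [Matrix.mul_assoc, Matrix.mul_adjugate, hd, one_smul, Matrix.mul_one]

theorem frameOf_eq {A : Mat3} (h : A ∈ Matrix.specialOrthogonalGroup (Fin 3) ℝ) :
    frameOf (WithLp.toLp 2 fun k => A k 0) (WithLp.toLp 2 fun k => A k 2) = A := by
  have hadj := SO3_adjugate h
  rw [Matrix.adjugate_fin_three] at hadj
  have h0 := congrFun (congrFun hadj 1) 0
  have h1 := congrFun (congrFun hadj 1) 1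
  have h2 := congrFun (congrFun hadj 1) 2
  simp at h0 h1 h2
  ext i j
  fin_cases i <;> fin_cases j <;> simp [frameOf] <;> linarith

/-- Rotating a frame about its third axis so that `ω⁶` vanishes. -/
theorem exists_horizontal_frame {P : ℝ → Mat3} {a b : ℝ} (hab : a ≤ b)
    (hP : ∀ s ∈ Icc a b, P s ∈ Matrix.specialOrthogonalGroup (Fin 3) ℝ)
    (hac : ∀ i j, AbsolutelyContinuousOnInterval (fun s => P s i j) a b) :
    ∃ Q : ℝ → Mat3, (∀ s ∈ Icc a b, Q s ∈ Matrix.specialOrthogonalGroup (Fin 3) ℝ) ∧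
      (∀ i j, AbsolutelyContinuousOnInterval (fun s => Q s i j) a b) ∧ Q a = P a ∧
      (∀ s k, Q s k 2 = P s k 2) ∧
      ∀ᵐ s ∂(volume.restrict (Icc a b)), ((Q s)ᵀ * matDeriv Q s) 1 0 = 0 := by
  have hPi : ∀ k, IntervalIntegrable (fun s => P s k 1 * deriv (fun t => P t k 0) s)
      volume a b := fun k =>
    (hac k 0).intervalIntegrable_deriv.continuousOn_mul (hac k 1).continuousOn
  -- Right multiplication by `rotZ θ` adds θ' to ω⁶, so θ has to be a primitive of −ω⁶ of the given
  -- frame. It starts from 0, so that Q and P agree at a.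
  set g : ℝ → ℝ := fun s => -(P s 0 1 * deriv (fun t => P t 0 0) s +
    P s 1 1 * deriv (fun t => P t 1 0) s + P s 2 1 * deriv (fun t => P t 2 0) s) with hg
  have hgi : IntervalIntegrable g volume a b := (((hPi 0).add (hPi 1)).add (hPi 2)).neg
  set θ : ℝ → ℝ := fun s => ∫ t in a..s, g t with hθ
  have hθac : AbsolutelyContinuousOnInterval θ a b :=
    hgi.absolutelyContinuousOnInterval_intervalIntegral left_mem_uIcc
  have hθ' : ∀ᵐ s ∂(volume.restrict (Icc a b)), HasDerivAt θ (g s) s := by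
    rw [ae_restrict_iff' measurableSet_Icc]
    filter_upwards [hgi.ae_hasDerivAt_integral] with s hs hmem
    exact hs (by rwa [uIcc_of_le hab]) a left_mem_uIcc
  have e0 : ∀ s k, (P s * rotZ (θ s)) k 0 =
      P s k 0 * Real.cos (θ s) + P s k 1 * Real.sin (θ s) := fun s k => by
    simp [Matrix.mul_apply, Fin.sum_univ_three, rotZ]
  have e1 : ∀ s k, (P s * rotZ (θ s)) k 1 =
      P s k 1 * Real.cos (θ s) - P s k 0 * Real.sin (θ s) := fun s k => by
    simp [Matrix.mul_apply, Fin.sum_univ_three, rotZ]; ring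
  have e2 : ∀ s k, (P s * rotZ (θ s)) k 2 = P s k 2 := fun s k => by
    simp [Matrix.mul_apply, Fin.sum_univ_three, rotZ]
  have hrot0 : rotZ 0 = 1 := by
    ext i j
    fin_cases i <;> fin_cases j <;> simp [rotZ]
  refine ⟨fun s => P s * rotZ (θ s), fun s hs => mul_mem (hP s hs) (rotZ_mem _), ?_, ?_, e2, ?_⟩
  · intro i j
    fin_cases j
    · simp only [Fin.zero_eta, e0]
      exact ((hac i 0).fun_mul (ac_cos hθac)).fun_add ((hac i 1).fun_mul (ac_sin hθac))
    · simp only [Fin.mk_one, e1]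
      exact ((hac i 1).fun_mul (ac_cos hθac)).fun_sub ((hac i 0).fun_mul (ac_sin hθac))
    · simp only [Fin.reduceFinMk, e2]
      exact hac i 2
  · simp [hθ, hrot0]
  · have hd : ∀ᵐ s ∂(volume.restrict (Icc a b)), ∀ i j,
        HasDerivAt (fun t => P t i j) (deriv (fun t => P t i j) s) s := by
      rw [ae_all_iff]; intro i; rw [ae_all_iff]; intro j
      exact ac_ae_hasDerivAt hab (hac i j)
    filter_upwards [hd, hθ', ae_mem_Ioo a b] with s hs hθs hmem
    have hanti : ∀ i j, (P s 0 i * deriv (fun t => P t 0 j) s +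
        P s 1 i * deriv (fun t => P t 1 j) s + P s 2 i * deriv (fun t => P t 2 j) s) +
        (P s 0 j * deriv (fun t => P t 0 i) s +
        P s 1 j * deriv (fun t => P t 1 i) s + P s 2 j * deriv (fun t => P t 2 i) s) = 0 := by
      intro i j
      have h1 := (((hs 0 i).fun_mul (hs 0 j)).fun_add ((hs 1 i).fun_mul (hs 1 j))).fun_add
        ((hs 2 i).fun_mul (hs 2 j))
      have h2 : HasDerivAt (fun t => P t 0 i * P t 0 j + P t 1 i * P t 1 j + P t 2 i * P t 2 j)
          0 s := by
        refine (hasDerivAt_const s (if i = j then (1 : ℝ) else 0)).congr_of_eventuallyEq ?_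
        filter_upwards [Icc_mem_nhds hmem.1 hmem.2] with t ht
        exact SO3_col (hP t ht) i j
      have := h1.unique h2
      linarith
    have hQ0 : ∀ k, deriv (fun t => (P t * rotZ (θ t)) k 0) s =
        deriv (fun t => P t k 0) s * Real.cos (θ s) + P s k 0 * (-Real.sin (θ s) * g s) +
        (deriv (fun t => P t k 1) s * Real.sin (θ s) + P s k 1 * (Real.cos (θ s) * g s)) := by
      intro k
      simp only [e0]
      exact (((hs k 0).fun_mul hθs.cos).fun_add ((hs k 1).fun_mul hθs.sin)).deriv
    refine (coframe_rot (fun s => P s * rotZ (θ s)) s 1 0).trans ?_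
    simp only [hQ0, e1]
    have c00 := SO3_col (hP s (Ioo_subset_Icc_self hmem)) 0 0
    have c01 := SO3_col (hP s (Ioo_subset_Icc_self hmem)) 0 1
    have c11 := SO3_col (hP s (Ioo_subset_Icc_self hmem)) 1 1
    simp only [if_true, Fin.reduceEq, if_false] at c00 c01 c11
    have a00 := hanti 0 0
    have a01 := hanti 0 1
    have a11 := hanti 1 1
    have hgs : g s = -(P s 0 1 * deriv (fun t => P t 0 0) s +
      P s 1 1 * deriv (fun t => P t 1 0) s + P s 2 1 * deriv (fun t => P t 2 0) s) := rfl
    generalize Real.sin (θ s) = S at *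
    generalize Real.cos (θ s) = C at *
    generalize g s = G at *
    linear_combination G * C ^ 2 * c11 + G * S ^ 2 * c00 - 2 * G * S * C * c01
      - S * C / 2 * a00 + S * C / 2 * a11 - S ^ 2 * a01 + (C ^ 2 + S ^ 2) * hgs

theorem ac_inner {f g : ℝ → E3} {a b : ℝ} (hf : AbsolutelyContinuousOnInterval f a b)
    (hg : AbsolutelyContinuousOnInterval g a b) :
    AbsolutelyContinuousOnInterval (fun s => inner ℝ (f s) (g s)) a b := by
  simp only [E3_inner]
  exact (((ac_apply hf 0).fun_mul (ac_apply hg 0)).fun_add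
    ((ac_apply hf 1).fun_mul (ac_apply hg 1))).fun_add ((ac_apply hf 2).fun_mul (ac_apply hg 2))

theorem hasDerivAt_direction {p : ℝ → E3} {q : E3} {s : ℝ} (hp : HasDerivAt p q s)
    (h0 : p s ≠ 0) : HasDerivAt (fun t => ‖p t‖⁻¹ • p t) (dirDeriv (p s) q) s := by
  have hn : ‖p s‖ ≠ 0 := norm_ne_zero_iff.2 h0
  have h1 : HasDerivAt (fun t => √(‖p t‖ ^ 2)) _ s := hp.norm_sq.sqrt (pow_ne_zero 2 hn)
  simp only [Real.sqrt_sq (norm_nonneg _)] at h1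
  convert! (h1.fun_inv hn).fun_smul hp using 1
  rw [dirDeriv, sub_eq_add_neg, ← neg_smul]
  congr 2
  field_simp

theorem ac_direction {p : ℝ → E3} {a b : ℝ} (hp : AbsolutelyContinuousOnInterval p a b)
    (h : ∀ s ∈ uIcc a b, 1 / 2 ≤ ‖p s‖) :
    AbsolutelyContinuousOnInterval (fun s => ‖p s‖⁻¹ • p s) a b := by
  have h1 : AbsolutelyContinuousOnInterval (fun s => ‖p s‖) a b :=
    ac_of_dist_le (C := 1) hp fun s _ t _ => by
      rw [one_mul, Real.dist_eq, dist_eq_norm]; exact abs_norm_sub_norm_le _ _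
  exact (ac_inv h1 (by norm_num) h).fun_smul hp

/-- Absolutely continuous unit tangents close to that of a given frame extend to a horizontal
frame. -/
theorem exists_frame_of_direction {R : ℝ → Mat3} {U : ℝ → E3} {a b : ℝ} (hab : a ≤ b)
    (hR : ∀ s ∈ Icc a b, R s ∈ Matrix.specialOrthogonalGroup (Fin 3) ℝ)
    (hRac : ∀ i j, AbsolutelyContinuousOnInterval (fun s => R s i j) a b)
    (hU : AbsolutelyContinuousOnInterval U a b) (hU1 : ∀ s ∈ Icc a b, ‖U s‖ = 1)
    (hUR : ∀ s ∈ Icc a b, |inner ℝ (WithLp.toLp 2 fun k => R s k 0 : E3) (U s)| ≤ 1 / 2)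
    (hUa : U a = tangent R a) :
    ∃ Q : ℝ → Mat3, (∀ s ∈ Icc a b, Q s ∈ Matrix.specialOrthogonalGroup (Fin 3) ℝ) ∧
      (∀ i j, AbsolutelyContinuousOnInterval (fun s => Q s i j) a b) ∧ Q a = R a ∧
      (∀ s k, Q s k 2 = U s k) ∧
      ∀ᵐ s ∂(volume.restrict (Icc a b)), ((Q s)ᵀ * matDeriv Q s) 1 0 = 0 := by
  set f : ℝ → E3 := fun s => WithLp.toLp 2 fun k => R s k 0 with hf
  set c : ℝ → ℝ := fun s => inner ℝ (f s) (U s) with hc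
  -- Gram-Schmidt applied to the first column of R against U. The bound |c| ≤ 1/2 keeps the root
  -- away from zero, which preserves absolute continuity.
  set e : ℝ → E3 := fun s => (√(1 - c s * c s))⁻¹ • (f s - c s • U s) with he
  have fac : AbsolutelyContinuousOnInterval f a b := ac_of_apply fun k => hRac k 0
  have cac : AbsolutelyContinuousOnInterval c a b := ac_inner fac hU
  have hc2 : ∀ s ∈ Icc a b, 1 / 2 ≤ 1 - c s * c s := fun s hs => by
    have h1 : |c s| ≤ 1 / 2 := hUR s hs
    nlinarith [abs_nonneg (c s), abs_mul_abs_self (c s)]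
  have eac : AbsolutelyContinuousOnInterval e a b := by
    refine (ac_inv (ac_sqrt (c := 1 / 2) ((ac_const 1 a b).fun_sub (cac.fun_mul cac))
      (by norm_num) ?_) (Real.sqrt_pos.2 (by norm_num : (0 : ℝ) < 1 / 2)) ?_).fun_smul
      (fac.fun_sub (cac.fun_smul hU))
    · rw [uIcc_of_le hab]; exact hc2
    · rw [uIcc_of_le hab]; exact fun s hs => Real.sqrt_le_sqrt (hc2 s hs)
  have hf1 : ∀ s ∈ Icc a b, ‖f s‖ ^ 2 = 1 := fun s hs => by
    rw [E3_norm_sq]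
    have := SO3_col (hR s hs) 0 0
    simp only [if_true] at this
    simp only [hf]; linarith
  have he1 : ∀ s ∈ Icc a b, ‖e s‖ = 1 := fun s hs => by
    have h1 : ‖f s - c s • U s‖ ^ 2 = 1 - c s * c s := by
      rw [norm_sub_sq_real, norm_smul, inner_smul_right, hU1 s hs, hf1 s hs, mul_one,
        Real.norm_eq_abs, sq_abs]
      simp only [hc]; ring
    have h2 : ‖f s - c s • U s‖ = √(1 - c s * c s) := by
      rw [← h1, Real.sqrt_sq (norm_nonneg _)]
    have h3 : 0 < √(1 - c s * c s) := Real.sqrt_pos.2 (by linarith [hc2 s hs])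
    simp only [he]
    rw [norm_smul, norm_inv, Real.norm_eq_abs, abs_of_pos h3, h2, inv_mul_cancel₀ h3.ne']
  have heU : ∀ s ∈ Icc a b, inner ℝ (e s) (U s) = 0 := fun s hs => by
    simp only [he]
    rw [inner_smul_left, inner_sub_left, inner_smul_left, real_inner_self_eq_norm_sq, hU1 s hs]
    simp [hc]
  obtain ⟨Q, hQ, hQac, hQa, hQ2, hQ6⟩ := exists_horizontal_frame (P := fun s => frameOf (e s) (U s))
    hab (fun s hs => frameOf_mem (he1 s hs) (hU1 s hs) (heU s hs)) (by
      have cross : ∀ i j k l, AbsolutelyContinuousOnInterval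
          (fun s => U s i * e s j - U s k * e s l) a b := fun i j k l =>
        ((ac_apply hU i).fun_mul (ac_apply eac j)).fun_sub
          ((ac_apply hU k).fun_mul (ac_apply eac l))
      intro i j
      fin_cases i <;> fin_cases j
      · exact ac_apply eac 0
      · exact cross 1 2 2 1
      · exact ac_apply hU 0
      · exact ac_apply eac 1
      · exact cross 2 0 0 2
      · exact ac_apply hU 1
      · exact ac_apply eac 2
      · exact cross 0 1 1 0
      · exact ac_apply hU 2)
  refine ⟨Q, hQ, hQac, ?_, fun s k => ?_, hQ6⟩
  -- At a, U is the third column of R, so c = 0 and Gram-Schmidt leaves the frame unchanged.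
  · have ha : a ∈ Icc a b := ⟨le_rfl, hab⟩
    have hca : c a = 0 := by
      simp only [hc, hUa, E3_inner, hf, tangent]
      simpa using SO3_col (hR a ha) 0 2
    have hea : e a = f a := by simp [he, hca]
    rw [hQa, hea, hUa]
    exact frameOf_eq (hR a ha)
  · rw [hQ2]
    fin_cases k <;> rfl

section Lift

variable {x : ℝ → E3} {R : ℝ → Mat3} {a b β : ℝ}

theorem metricSq_eq (β : ℝ) (x : ℝ → E3) (R : ℝ → Mat3) (s : ℝ) :
    metricSq β x R s = β ^ 2 * coframe x R s 2 ^ 2 + ‖kappa x R s‖ ^ 2 := by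
  rw [metricSq, E2_norm_sq]
  simp [kappa]
  ring

theorem srLength_eq (h : IsHorizontalOn x R a b) (hab : a ≤ b)
    (harc : ∀ᵐ s ∂(volume.restrict (Icc a b)), coframe x R s 2 = 1) :
    srLength β x R a b = ∫ s in a..b, lagrangian β (tangent R s) (normalVec R s) := by
  refine intervalIntegral.integral_congr_ae ?_
  rw [← ae_restrict_iff' measurableSet_uIoc, uIoc_of_le hab, restrict_Ioc_eq_restrict_Icc]
  filter_upwards [harc, h.tangent_hasDerivAt hab, ae_restrict_mem measurableSet_Icc]
    with s h1 h2 hs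
  have hT := norm_tangent (h.mem_SO3 s hs)
  have hD : dirDeriv (tangent R s) (normalVec R s) = normalVec R s := by
    simp [dirDeriv, hT, h2.2.2.1]
  rw [metricSq_eq, h1, lagrangian, hD, hT, h2.2.2.2]

theorem le_norm_perturbed {T u : E3} {η M : ℝ} (hT : ‖T‖ = 1) (hu : ‖u‖ ≤ M)
    (hη : |η| * M ≤ 1 / 4) : 1 / 2 ≤ ‖T + η • u‖ := by
  have := norm_sub_le (T + η • u) (η • u)
  rw [add_sub_cancel_right, hT, norm_smul, Real.norm_eq_abs] at this
  nlinarith [mul_le_mul_of_nonneg_left hu (abs_nonneg η)]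

/-- Small variations of the spatial part of a horizontal curve, fixed near the end points, lift to
horizontal curves. -/
theorem exists_lift (h : IsHorizontalOn x R a b) (hab : a < b)
    (harc : ∀ᵐ s ∂(volume.restrict (Icc a b)), coframe x R s 2 = 1) {δ : ℝ → E3}
    (hδ : ContDiff ℝ ∞ δ) (hsupp : tsupport δ ⊆ Ioo a b) {M : ℝ} (hM : ∀ s, ‖deriv δ s‖ ≤ M)
    {η : ℝ} (hη : |η| * M ≤ 1 / 4) :
    ∃ y Q, IsHorizontalOn y Q a b ∧ y a = x a ∧ Q a = R a ∧ y b = x b ∧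
      Q b *ᵥ ez = R b *ᵥ ez ∧ srLength β y Q a b = ∫ s in a..b,
        lagrangian β (tangent R s + η • deriv δ s) (normalVec R s + η • deriv (deriv δ) s) := by
  have hδ' : ContDiff ℝ ∞ (deriv δ) := hδ.deriv'
  have hzero : ∀ s, s ∉ Ioo a b → δ s = 0 ∧ deriv δ s = 0 := fun s hs =>
    ⟨image_eq_zero_of_notMem_tsupport fun h' => hs (hsupp h'),
      image_eq_zero_of_notMem_tsupport fun h' =>
        hs (hsupp (tsupport_deriv_subset (𝕜 := ℝ) h'))⟩
  -- p is the velocity of x + ηδ, and its direction U becomes the third column of the lift.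
  set p : ℝ → E3 := fun s => tangent R s + η • deriv δ s with hp
  set U : ℝ → E3 := fun s => ‖p s‖⁻¹ • p s with hU
  have hT1 : ∀ s ∈ Icc a b, ‖tangent R s‖ = 1 := fun s hs => norm_tangent (h.mem_SO3 s hs)
  have hpn : ∀ s ∈ Icc a b, 1 / 2 ≤ ‖p s‖ := fun s hs => le_norm_perturbed (hT1 s hs) (hM s) hη
  have hp0 : ∀ s ∈ Icc a b, ‖p s‖ ≠ 0 := fun s hs => by linarith [hpn s hs]
  have pac : AbsolutelyContinuousOnInterval p a b :=
    (ac_tangent h).fun_add ((ac_of_contDiff (hδ'.of_le (by simp)) a b).const_smul η)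
  have Uac : AbsolutelyContinuousOnInterval U a b :=
    ac_direction pac (by rwa [uIcc_of_le hab.le])
  have hU1 : ∀ s ∈ Icc a b, ‖U s‖ = 1 := fun s hs => by
    simp only [hU]
    rw [norm_smul, norm_inv, norm_norm, inv_mul_cancel₀ (hp0 s hs)]
  have hpend : ∀ s, s ∉ Ioo a b → p s = tangent R s := fun s hs => by
    simp only [hp, (hzero s hs).2, smul_zero, add_zero]
  have hUend : ∀ s ∈ Icc a b, s ∉ Ioo a b → U s = tangent R s := fun s hs hs' => by
    simp only [hU, hpend s hs', hT1 s hs, inv_one, one_smul]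
  have ha : a ∈ Icc a b := ⟨le_rfl, hab.le⟩
  have hb : b ∈ Icc a b := ⟨hab.le, le_rfl⟩
  -- The first column of R is orthogonal to T, so its product with U involves only ηδ'. With ‖p‖⁻¹ ≤
  -- 2 and |η| M ≤ 1/4 it is at most 1/2, as the construction of the frame requires.
  obtain ⟨Q, hQ, hQac, hQa, hQ2, hQ6⟩ := exists_frame_of_direction hab.le h.mem_SO3 h.ac_rot Uac
    hU1 (fun s hs => by
      have c02 := SO3_col (h.mem_SO3 s hs) 0 2
      have c00 := SO3_col (h.mem_SO3 s hs) 0 0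
      simp only [Fin.reduceEq, if_false, if_true] at c02 c00
      have hf1 : ‖(WithLp.toLp 2 fun k => R s k 0 : E3)‖ = 1 := by
        have : ‖(WithLp.toLp 2 fun k => R s k 0 : E3)‖ ^ 2 = 1 := by
          rw [E3_norm_sq]; simp only; linarith
        nlinarith [norm_nonneg (WithLp.toLp 2 fun k => R s k 0 : E3)]
      have hfT : inner ℝ (WithLp.toLp 2 fun k => R s k 0 : E3) (tangent R s) = 0 := by
        rw [E3_inner]; simp only [tangent]; linarith
      simp only [hU, hp]
      rw [inner_smul_right, inner_add_right, hfT, zero_add, inner_smul_right, abs_mul, abs_mul]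
      have h1 : |‖tangent R s + η • deriv δ s‖⁻¹| ≤ 2 := by
        rw [abs_of_nonneg (by positivity), inv_le_comm₀ (by linarith [hpn s hs]) (by norm_num)]
        have := hpn s hs
        simp only [hp] at this
        linarith
      have h2 : |inner ℝ (WithLp.toLp 2 fun k => R s k 0 : E3) (deriv δ s)| ≤ M :=
        (abs_real_inner_le_norm _ _).trans (by rw [hf1, one_mul]; exact hM s)
      calc _ ≤ 2 * (|η| * M) := by gcongr
        _ ≤ 1 / 2 := by linarith) (hUend a ha (by simp))
  have hy : ∀ s ∈ Ioo a b, HasDerivAt (fun r => x r + η • δ r) (p s) s := fun s hs =>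
    (h.pos_hasDerivAt hab.le harc s hs).fun_add
      (((hδ.differentiable (by simp)) s).hasDerivAt.const_smul η)
  have hframe : ∀ s ∈ Ioo a b, ∀ i, ((Q s)ᵀ *ᵥ (deriv (fun r => x r + η • δ r) s).ofLp) i =
      if i = 2 then ‖p s‖ else 0 := fun s hs i => by
    have hs' := Ioo_subset_Icc_self hs
    have hpU : ∀ k, p s k = ‖p s‖ * Q s k 2 := fun k => by
      rw [hQ2]
      simp only [hU, PiLp.smul_apply, smul_eq_mul]
      rw [mul_inv_cancel_left₀ (hp0 s hs')]
    rw [(hy s hs).deriv]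
    have := SO3_col (hQ s hs') i 2
    simp only [Matrix.mulVec, dotProduct, Matrix.transpose_apply, Fin.sum_univ_three, hpU]
    calc _ = ‖p s‖ * (Q s 0 i * Q s 0 2 + Q s 1 i * Q s 1 2 + Q s 2 i * Q s 2 2) := by ring
      _ = _ := by rw [this]; split_ifs <;> simp
  have hor : IsHorizontalOn (fun r => x r + η • δ r) Q a b := by
    refine ⟨hQ, h.ac_pos.fun_add ((ac_of_contDiff (hδ.of_le (by simp)) a b).const_smul η), hQac, ?_⟩
    filter_upwards [hQ6, ae_mem_Ioo a b] with s h6 hs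
    refine ⟨?_, ?_, ?_⟩
    · simpa [coframe] using hframe s hs 0
    · simpa [coframe] using hframe s hs 1
    · simpa [coframe] using h6
  refine ⟨_, Q, hor, ?_, hQa, ?_, ?_, ?_⟩
  · simp [(hzero a (by simp)).1]
  · simp [(hzero b (by simp)).1]
  -- Only the third columns of Q b and R b are compared: the condition ω⁶ = 0 may leave a rotation
  -- about that axis between the frames, and the end condition allows it.
  · ext k
    have : Q b k 2 = R b k 2 := by rw [hQ2, hUend b hb (by simp)]; rfl
    simp [ez, Matrix.mulVec, dotProduct, Fin.sum_univ_three, this]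
  · refine intervalIntegral.integral_congr_ae ?_
    rw [← ae_restrict_iff' measurableSet_uIoc, uIoc_of_le hab.le, restrict_Ioc_eq_restrict_Icc]
    filter_upwards [hor.tangent_hasDerivAt hab.le, h.tangent_hasDerivAt hab.le, ae_mem_Ioo a b]
      with s h1 h2 hs
    have hs' := Ioo_subset_Icc_self hs
    have hc2 : coframe (fun r => x r + η • δ r) Q s 2 = ‖p s‖ := by
      simpa [coframe] using hframe s hs 2
    have hp' : HasDerivAt p (normalVec R s + η • deriv (deriv δ) s) s :=
      h2.1.fun_add (((hδ'.differentiable (by simp)) s).hasDerivAt.const_smul η)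
    have hN : normalVec Q s = dirDeriv (p s) (normalVec R s + η • deriv (deriv δ) s) := by
      have hd := hasDerivAt_direction hp' (norm_ne_zero_iff.1 (hp0 s hs'))
      ext k
      have := (E3_hasDerivAt_apply hd k).deriv
      rw [← this]
      simp only [normalVec, hQ2, hU]
    rw [metricSq_eq, hc2, ← h1.2.2.2, hN, lagrangian]

theorem coframe_shift (x : ℝ → E3) (R : ℝ → Mat3) (c t : ℝ) :
    coframe (fun t => x (c + t)) (fun t => R (c + t)) t = coframe x R (c + t) := by
  have h1 : deriv (fun t => x (c + t)) t = deriv x (c + t) := deriv_comp_const_add _ _ _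
  have h2 : matDeriv (fun t => R (c + t)) t = matDeriv R (c + t) := by
    ext i j
    exact deriv_comp_const_add (fun t => R t i j) c t
  simp only [coframe, h1, h2]

theorem IsHorizontalOn.shift (h : IsHorizontalOn x R a b) :
    IsHorizontalOn (fun t => x (a + t)) (fun t => R (a + t)) 0 (b - a) := by
  refine ⟨fun s hs => h.mem_SO3 _ ⟨by linarith [hs.1], by linarith [hs.2]⟩, ?_, fun i j => ?_, ?_⟩
  · simpa using ac_shift a h.ac_pos
  · simpa using ac_shift a (h.ac_rot i j)
  · have := h.horizontal
    rw [ae_restrict_iff' measurableSet_Icc] at this ⊢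
    filter_upwards [(measurePreserving_add_left volume a).quasiMeasurePreserving.ae this]
      with s hs hmem
    rw [coframe_shift]
    exact hs ⟨by linarith [hmem.1], by linarith [hmem.2]⟩

theorem srLength_shift (β : ℝ) (x : ℝ → E3) (R : ℝ → Mat3) (a b : ℝ) :
    srLength β (fun t => x (a + t)) (fun t => R (a + t)) 0 (b - a) = srLength β x R a b := by
  simp only [srLength, metricSq, coframe_shift]
  rw [intervalIntegral.integral_comp_add_left (fun s => √(β ^ 2 * coframe x R s 2 ^ 2 +
    coframe x R s 3 ^ 2 + coframe x R s 4 ^ 2))]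
  simp

end Lift

/-! ### The weak Euler-Lagrange equation -/

/-- The integrand of the first variation of the energy in the direction `δ`. -/
def variationIntegrand (β : ℝ) (R : ℝ → Mat3) (δ : ℝ → E3) (s : ℝ) : ℝ :=
  (β ^ 2 - ‖normalVec R s‖ ^ 2) / √(‖normalVec R s‖ ^ 2 + β ^ 2) *
      inner ℝ (tangent R s) (deriv δ s) +
    1 / √(‖normalVec R s‖ ^ 2 + β ^ 2) * inner ℝ (normalVec R s) (deriv (deriv δ) s)

section

variable {x : ℝ → E3} {R : ℝ → Mat3} {a b β : ℝ}

theorem exists_deriv_bound {δ : ℝ → E3} (hδ : ContDiff ℝ ∞ δ) (hc : HasCompactSupport δ) :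
    ∃ M, (∀ s, ‖deriv δ s‖ ≤ M) ∧ ∀ s, ‖deriv (deriv δ) s‖ ≤ M := by
  have hδ' : ContDiff ℝ ∞ (deriv δ) := hδ.deriv'
  have hδ'' : ContDiff ℝ ∞ (deriv (deriv δ)) := hδ'.deriv'
  obtain ⟨M₁, h₁⟩ := hδ'.continuous.bounded_above_of_compact_support hc.deriv
  obtain ⟨M₂, h₂⟩ := hδ''.continuous.bounded_above_of_compact_support hc.deriv.deriv
  exact ⟨max M₁ M₂, fun s => (h₁ s).trans (le_max_left _ _),
    fun s => (h₂ s).trans (le_max_right _ _)⟩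

theorem hasDerivAt_variation (hβ : 0 < β) (h : IsHorizontalOn x R a b) (hab : a ≤ b)
    {δ : ℝ → E3} (hδ : ContDiff ℝ ∞ δ) (hc : HasCompactSupport δ) :
    HasDerivAt (fun η : ℝ => ∫ s in a..b,
        lagrangian β (tangent R s + η • deriv δ s) (normalVec R s + η • deriv (deriv δ) s))
      (∫ s in a..b, variationIntegrand β R δ s) 0 := by
  have hδ' : ContDiff ℝ ∞ (deriv δ) := hδ.deriv'
  have hδ'' : ContDiff ℝ ∞ (deriv (deriv δ)) := hδ'.deriv'
  obtain ⟨M, h₁, h₂⟩ := exists_deriv_bound hδ hc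
  have hcont : ContinuousOn (tangent R) (Icc a b) := by
    have := (ac_tangent h).continuousOn
    rwa [uIcc_of_le hab] at this
  refine hasDerivAt_integral_lagrangian hβ hab (hcont.aestronglyMeasurable measurableSet_Icc)
    (aestronglyMeasurable_normalVec _) hδ'.continuous.aestronglyMeasurable
    hδ''.continuous.aestronglyMeasurable ?_
    ((h.tangent_hasDerivAt hab).mono fun s hs => hs.2.2.1) (intervalIntegrable_normalVec h) h₁ h₂
  filter_upwards [ae_restrict_mem measurableSet_Icc] with s hs
  exact norm_tangent (h.mem_SO3 s hs)

theorem eventually_abs_mul_le (M : ℝ) : ∀ᶠ η : ℝ in nhds 0, |η| * M ≤ 1 / 4 := by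
  have hcont : Continuous fun η : ℝ => |η| * M := by fun_prop
  have := hcont.tendsto 0
  simp only [abs_zero, zero_mul] at this
  exact (this.eventually (gt_mem_nhds (by norm_num : (0 : ℝ) < 1 / 4))).mono fun η h => h.le

/-- For small η the energy integrand of x + ηδ equals almost everywhere the Lagrangian at (T + ηδ',
N + ηδ''), so uniqueness of the derivative at η = 0 identifies the first variation with 0. -/
theorem integral_variation_eq_zero_of_isStationary (hβ : 0 < β) {L : ℝ} (hL : 0 < L)
    (h : IsHorizontalOn x R 0 L)
    (harc : ∀ᵐ s ∂(volume.restrict (Icc 0 L)), coframe x R s 2 = 1) (hst : IsStationary β L x)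
    {δ : ℝ → E3} (hδ : ContDiff ℝ ∞ δ) (hc : HasCompactSupport δ) (hsupp : tsupport δ ⊆ Ioo 0 L) :
    ∫ s in (0 : ℝ)..L, variationIntegrand β R δ s = 0 := by
  have hδ' : ContDiff ℝ ∞ (deriv δ) := hδ.deriv'
  obtain ⟨M, h₁, h₂⟩ := exists_deriv_bound hδ hc
  refine ((hasDerivAt_variation hβ h hL.le hδ hc).congr_of_eventuallyEq ?_).unique
    (hst δ hδ hc hsupp)
  filter_upwards [eventually_abs_mul_le M] with η hη
  refine intervalIntegral.integral_congr_ae ?_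
  rw [← ae_restrict_iff' measurableSet_uIoc, uIoc_of_le hL.le, restrict_Ioc_eq_restrict_Icc]
  filter_upwards [h.tangent_hasDerivAt hL.le, ae_mem_Ioo 0 L] with s hs hmem
  have hy : ∀ t ∈ Ioo 0 L, deriv (fun r => x r + η • δ r) t = tangent R t + η • deriv δ t :=
    fun t ht => ((h.pos_hasDerivAt hL.le harc t ht).fun_add
      (((hδ.differentiable (by simp)) t).hasDerivAt.const_smul η)).deriv
  have hy' : deriv (deriv fun r => x r + η • δ r) s =
      normalVec R s + η • deriv (deriv δ) s := by
    refine HasDerivAt.deriv ((hs.1.fun_add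
      (((hδ'.differentiable (by simp)) s).hasDerivAt.const_smul η)).congr_of_eventuallyEq ?_)
    filter_upwards [isOpen_Ioo.mem_nhds hmem] with t ht using hy t ht
  have hp := le_norm_perturbed (norm_tangent (h.mem_SO3 s (Ioo_subset_Icc_self hmem))) (h₁ s) hη
  rw [curvature, hy s hmem, hy']
  exact energy_integrand_eq (norm_pos_iff.1 (by linarith))

theorem IsHorizontalOn.mono {c d : ℝ} (h : IsHorizontalOn x R a b) (hac : a ≤ c) (hcd : c ≤ d)
    (hdb : d ≤ b) : IsHorizontalOn x R c d := by
  have hsub : Icc c d ⊆ Icc a b := Icc_subset_Icc hac hdb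
  have hsub' : uIcc c d ⊆ uIcc a b := by
    rwa [uIcc_of_le hcd, uIcc_of_le (hac.trans (hcd.trans hdb))]
  exact ⟨fun s hs => h.mem_SO3 s (hsub hs), h.ac_pos.mono hsub', fun i j => (h.ac_rot i j).mono hsub',
    ae_restrict_of_ae_restrict_of_subset hsub h.horizontal⟩

/-- For δ supported near s₀ every small η gives a competitor through `exists_lift`, so the length as
a function of η has a local minimum at 0. -/
theorem integral_variation_eq_zero_of_local (hβ : 0 < β) {L : ℝ}
    (h : IsHorizontalOn x R 0 L)
    (harc : ∀ᵐ s ∂(volume.restrict (Icc 0 L)), coframe x R s 2 = 1)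
    (hmin : IsLocallyMinimizing β L x R) {s₀ : ℝ} (hs₀ : s₀ ∈ Ioo 0 L) :
    ∃ ε > 0, ∀ δ : ℝ → E3, ContDiff ℝ ∞ δ → HasCompactSupport δ → tsupport δ ⊆ Ioo 0 L →
      tsupport δ ⊆ Ioo (s₀ - ε) (s₀ + ε) →
      ∫ s in (0 : ℝ)..L, variationIntegrand β R δ s = 0 := by
  obtain ⟨ε, hε, H⟩ := hmin s₀ (Ioo_subset_Icc_self hs₀)
  refine ⟨ε, hε, fun δ hδ hc hsupp hsupp' => ?_⟩
  -- The arc [c, d] lies inside the neighbourhood of minimality and contains the support of δ in its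
  -- interior, so the lifts keep the end data of this arc.
  obtain ⟨c, d, hc1, hcd, hd1, hK⟩ := exists_Icc_of_isCompact (K := tsupport δ)
    (a := max 0 (s₀ - ε)) (b := min L (s₀ + ε))
    (by rw [max_lt_iff, lt_min_iff, lt_min_iff]
        exact ⟨⟨hs₀.1.trans hs₀.2, by linarith [hs₀.1]⟩, ⟨by linarith [hs₀.2], by linarith⟩⟩)
    hc.isCompact fun s hs => ⟨max_lt (hsupp hs).1 (hsupp' hs).1,
      lt_min (hsupp hs).2 (hsupp' hs).2⟩
  rw [max_lt_iff] at hc1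
  rw [lt_min_iff] at hd1
  have hcL : c ∈ Icc 0 L := ⟨hc1.1.le, (hcd.trans hd1.1).le⟩
  have hdL : d ∈ Icc 0 L := ⟨(hc1.1.trans hcd).le, hd1.1.le⟩
  have hor : IsHorizontalOn x R c d := h.mono hc1.1.le hcd.le hd1.1.le
  have harc' : ∀ᵐ s ∂(volume.restrict (Icc c d)), coframe x R s 2 = 1 :=
    ae_restrict_of_ae_restrict_of_subset (Icc_subset_Icc hcL.1 hdL.2) harc
  obtain ⟨M, h₁, h₂⟩ := exists_deriv_bound hδ hc
  have hder := hasDerivAt_variation hβ hor hcd.le hδ hc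
  have hloc : IsLocalMin (fun η : ℝ => ∫ s in c..d,
      lagrangian β (tangent R s + η • deriv δ s) (normalVec R s + η • deriv (deriv δ) s)) 0 := by
    filter_upwards [eventually_abs_mul_le M] with η hη
    simp only [zero_smul, add_zero]
    rw [← srLength_eq hor hcd.le harc']
    obtain ⟨y, Q, hyQ, h1, h2, h3, h4, h5⟩ := exists_lift (β := β) hor hcd harc' hδ hK h₁ hη
    rw [← h5, ← srLength_shift β y Q]
    refine H c hcL d hdL ?_ ?_ hcd.le (d - c) _ _ (by linarith) hyQ.shift ?_ ?_ ?_ ?_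
    · rw [abs_lt]; exact ⟨by linarith, by linarith⟩
    · rw [abs_lt]; exact ⟨by linarith, by linarith⟩
    · simpa using h1
    · simpa using h2
    · simpa using h3
    · simpa using h4
  have hzero := hloc.hasDerivAt_eq_zero hder
  rw [intervalIntegral.integral_of_le hcd.le] at hzero
  rw [intervalIntegral.integral_of_le (hcL.1.trans hcL.2)]
  refine Eq.trans (setIntegral_eq_of_subset_of_forall_sdiff_eq_zero measurableSet_Ioc
    (Ioc_subset_Ioc hcL.1 hdL.2) fun s hs => ?_) hzero
  have hns : s ∉ tsupport δ := fun h' => hs.2 (Ioo_subset_Ioc_self (hK h'))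
  have z1 : deriv δ s = 0 := image_eq_zero_of_notMem_tsupport fun h' =>
    hns (tsupport_deriv_subset (𝕜 := ℝ) h')
  have z2 : deriv (deriv δ) s = 0 := image_eq_zero_of_notMem_tsupport fun h' =>
    hns (tsupport_deriv_subset (𝕜 := ℝ) (tsupport_deriv_subset (𝕜 := ℝ) h'))
  simp [variationIntegrand, z1, z2]

/-- The coefficients of the first variation are integrable. -/
theorem intervalIntegrable_coeff (hβ : 0 < β) (h : IsHorizontalOn x R a b) :
    IntervalIntegrable (fun s => (β ^ 2 - ‖normalVec R s‖ ^ 2) / √(‖normalVec R s‖ ^ 2 + β ^ 2))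
      volume a b := by
  refine ((intervalIntegrable_normalVec h).add (continuous_const.intervalIntegrable (μ := volume)
    a b (u := fun _ : ℝ => β))).mono_fun' ?_ (Filter.Eventually.of_forall fun s => ?_)
  · have := (aestronglyMeasurable_normalVec (R := R) (volume.restrict (uIoc a b))).aemeasurable
    exact AEMeasurable.aestronglyMeasurable (by fun_prop)
  · set n := ‖normalVec R s‖
    have hn : 0 ≤ n := norm_nonneg _
    have hpos : 0 < √(n ^ 2 + β ^ 2) := Real.sqrt_pos.2 (by positivity)
    simp only []
    rw [Real.norm_eq_abs, abs_div, abs_of_pos hpos, div_le_iff₀ hpos]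
    have h1 : n ≤ √(n ^ 2 + β ^ 2) := Real.le_sqrt_of_sq_le (by nlinarith)
    have h2 : β ≤ √(n ^ 2 + β ^ 2) := Real.le_sqrt_of_sq_le (by nlinarith)
    rw [abs_le]
    constructor <;> nlinarith

theorem intervalIntegrable_inv (hβ : 0 < β) :
    IntervalIntegrable (fun s => 1 / √(‖normalVec R s‖ ^ 2 + β ^ 2) * ‖normalVec R s‖)
      volume a b := by
  refine (continuous_const.intervalIntegrable (μ := volume)
    a b (u := fun _ : ℝ => (1 : ℝ))).mono_fun' ?_ (Filter.Eventually.of_forall fun s => ?_)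
  · have := (aestronglyMeasurable_normalVec (R := R) (volume.restrict (uIoc a b))).aemeasurable
    exact AEMeasurable.aestronglyMeasurable (by fun_prop)
  · set n := ‖normalVec R s‖
    have hn : 0 ≤ n := norm_nonneg _
    have hpos : 0 < √(n ^ 2 + β ^ 2) := Real.sqrt_pos.2 (by positivity)
    have h1 : n ≤ √(n ^ 2 + β ^ 2) := Real.le_sqrt_of_sq_le (by nlinarith)
    simp only []
    rw [Real.norm_eq_abs, abs_of_nonneg (by positivity), one_div, inv_mul_le_iff₀ hpos, mul_one]
    exact h1

theorem intervalIntegrable_unit_coord (hβ : 0 < β) (k : Fin 3) :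
    IntervalIntegrable (fun s => 1 / √(‖normalVec R s‖ ^ 2 + β ^ 2) * normalVec R s k)
      volume a b := by
  refine (intervalIntegrable_inv (R := R) hβ).mono_fun ?_ (Filter.Eventually.of_forall fun s => ?_)
  · have := (aestronglyMeasurable_normalVec (R := R) (volume.restrict (uIoc a b))).aemeasurable
    have h2 : AEMeasurable (fun s => normalVec R s k) (volume.restrict (uIoc a b)) :=
      (measurable_deriv _).aemeasurable
    exact AEMeasurable.aestronglyMeasurable (by fun_prop)
  · simp only [norm_mul, norm_norm]
    gcongr
    exact PiLp.norm_apply_le (normalVec R s) k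

theorem intervalIntegrable_variation (hβ : 0 < β) (h : IsHorizontalOn x R a b) {δ : ℝ → E3}
    (hδ : ContDiff ℝ ∞ δ) : IntervalIntegrable (variationIntegrand β R δ) volume a b := by
  have hδ' : ContDiff ℝ ∞ (deriv δ) := hδ.deriv'
  have hδ'' : ContDiff ℝ ∞ (deriv (deriv δ)) := hδ'.deriv'
  refine ((intervalIntegrable_coeff hβ h).mul_continuousOn
    ((ac_tangent h).continuousOn.inner hδ'.continuous.continuousOn)).add ?_
  have hk : ∀ k, IntervalIntegrable (fun s => (1 / √(‖normalVec R s‖ ^ 2 + β ^ 2) *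
      normalVec R s k) * deriv (deriv δ) s k) volume a b := fun k =>
    (intervalIntegrable_unit_coord hβ k).mul_continuousOn (by
      have := hδ''.continuous
      fun_prop)
  refine (((hk 0).add (hk 1)).add (hk 2)).congr fun s _ => ?_
  simp only [E3_inner]
  ring

/-- The first variation is linear in δ. A partition of unity splits δ into finitely many fields,
each supported in a neighbourhood where the local result applies. -/
theorem integral_variation_eq_zero_of_isLocallyMinimizing (hβ : 0 < β) {L : ℝ}
    (h : IsHorizontalOn x R 0 L)
    (harc : ∀ᵐ s ∂(volume.restrict (Icc 0 L)), coframe x R s 2 = 1)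
    (hmin : IsLocallyMinimizing β L x R)
    {δ : ℝ → E3} (hδ : ContDiff ℝ ∞ δ) (hc : HasCompactSupport δ) (hsupp : tsupport δ ⊆ Ioo 0 L) :
    ∫ s in (0 : ℝ)..L, variationIntegrand β R δ s = 0 := by
  choose! ε hε H using fun s₀ (hs₀ : s₀ ∈ Ioo 0 L) =>
    integral_variation_eq_zero_of_local hβ h harc hmin hs₀
  obtain ⟨t, ht, hcov⟩ := hc.isCompact.elim_nhds_subcover
    (fun s => Ioo (s - ε s) (s + ε s)) fun s hs =>
      Ioo_mem_nhds (by linarith [hε s (hsupp hs)]) (by linarith [hε s (hsupp hs)])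
  obtain ⟨f, hf⟩ := SmoothPartitionOfUnity.exists_isSubordinate (modelWithCornersSelf ℝ ℝ)
    (isClosed_tsupport δ) (fun s : t => Ioo ((s : ℝ) - ε s) ((s : ℝ) + ε s))
    (fun s => isOpen_Ioo) (fun s hs => by
      obtain ⟨i, hi, hi'⟩ := mem_iUnion₂.1 (hcov hs)
      exact mem_iUnion.2 ⟨⟨i, hi⟩, hi'⟩)
  have hfs : ∀ i, ContDiff ℝ ∞ (f i) := fun i => (f i).contMDiff.contDiff
  have hgs : ∀ i, ContDiff ℝ ∞ fun s => f i s • δ s := fun i => (hfs i).smul hδ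
  have hsub : ∀ i, tsupport (fun s => f i s • δ s) ⊆ tsupport δ := fun i =>
    tsupport_smul_subset_right _ _
  have hsum : δ = fun s => ∑ i, f i s • δ s := by
    ext1 s
    rw [← Finset.sum_smul]
    by_cases hs : s ∈ tsupport δ
    · have := f.sum_eq_one hs
      rw [finsum_eq_sum_of_fintype] at this
      rw [this, one_smul]
    · rw [image_eq_zero_of_notMem_tsupport hs, smul_zero]
  have hd1 : ∀ s, deriv δ s = ∑ i, deriv (fun s => f i s • δ s) s := fun s => by
    conv_lhs => rw [hsum]
    exact deriv_fun_sum fun i _ => (hgs i).differentiable (by simp) s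
  have hd2 : ∀ s, deriv (deriv δ) s = ∑ i, deriv (deriv fun s => f i s • δ s) s := fun s => by
    have hgs' : ∀ i, ContDiff ℝ ∞ (deriv fun s => f i s • δ s) := fun i => (hgs i).deriv'
    rw [funext hd1]
    exact deriv_fun_sum fun i _ => (hgs' i).differentiable (by simp) s
  have hvar : ∀ s, variationIntegrand β R δ s =
      ∑ i, variationIntegrand β R (fun s => f i s • δ s) s := fun s => by
    simp only [variationIntegrand]
    rw [hd1, hd2, inner_sum, inner_sum, Finset.mul_sum, Finset.mul_sum, Finset.sum_add_distrib]
  simp only [hvar]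
  rw [intervalIntegral.integral_finsetSum fun i _ => intervalIntegrable_variation hβ h (hgs i)]
  refine Finset.sum_eq_zero fun i _ => ?_
  exact H i (hsupp (ht i i.2)) _ (hgs i)
    (hc.isCompact.of_isClosed_subset (isClosed_tsupport _) (hsub i)) ((hsub i).trans hsupp)
    ((tsupport_smul_subset_left _ _).trans (hf i))

theorem IsCusplessGeodesic.integral_variation_eq_zero (hβ : 0 < β) {L : ℝ} (hL : 0 < L)
    (h : IsCusplessGeodesic β L x R) {δ : ℝ → E3} (hδ : ContDiff ℝ ∞ δ)
    (hc : HasCompactSupport δ) (hsupp : tsupport δ ⊆ Ioo 0 L) :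
    ∫ s in (0 : ℝ)..L, variationIntegrand β R δ s = 0 := by
  rcases h.geodesic with hg | hg
  · exact integral_variation_eq_zero_of_isStationary hβ hL h.horizontal h.arclength hg hδ hc hsupp
  · exact integral_variation_eq_zero_of_isLocallyMinimizing hβ h.horizontal h.arclength hg hδ hc
      hsupp

end

/-! ### Integration of the Euler-Lagrange equation -/

section

variable {x : ℝ → E3} {R : ℝ → Mat3} {a b β L : ℝ}

theorem deriv_single (k : Fin 3) {φ : ℝ → ℝ} {a b : ℝ} (h : IsTest a b φ) :
    deriv (fun s => (EuclideanSpace.single k (φ s) : E3)) =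
      fun s => EuclideanSpace.single k (deriv φ s) := by
  ext1 s
  refine (E3_hasDerivAt fun j => ?_).deriv
  by_cases hj : j = k
  · subst hj; simpa using h.hasDerivAt s
  · simpa [hj] using hasDerivAt_const s (0 : ℝ)

/-- Testing with φ e_k involves only φ' and φ'', because the energy is invariant under translations.
The equation therefore integrates once, and P, the constant of integration, is a component of the
conserved momentum. The representative V can be differentiated although κ itself is merely
integrable. -/
theorem IsCusplessGeodesic.exists_ac_representative (hβ : 0 < β) (hL : 0 < L)
    (h : IsCusplessGeodesic β L x R) (k : Fin 3) :
    ∃ (P : ℝ) (V : ℝ → ℝ), AbsolutelyContinuousOnInterval V 0 L ∧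
      ∀ᵐ s ∂(volume.restrict (Icc 0 L)),
        V s = 1 / √(‖normalVec R s‖ ^ 2 + β ^ 2) * normalVec R s k ∧
        HasDerivAt V ((β ^ 2 - ‖normalVec R s‖ ^ 2) / √(‖normalVec R s‖ ^ 2 + β ^ 2) * R s k 2 + P)
          s := by
  have hg : IntervalIntegrable (fun s => (β ^ 2 - ‖normalVec R s‖ ^ 2) /
      √(‖normalVec R s‖ ^ 2 + β ^ 2) * R s k 2) volume 0 L :=
    (intervalIntegrable_coeff hβ h.horizontal).mul_continuousOn (h.horizontal.ac_rot k 2).continuousOn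
  obtain ⟨P, C, hC⟩ := ae_eq_primitive_of_weak_second hL
    (intervalIntegrable_unit_coord (R := R) hβ k) hg fun φ hφ => by
      have hs : ContDiff ℝ ∞ fun s => (EuclideanSpace.single k (φ s) : E3) := by
        have : (fun s => (EuclideanSpace.single k (φ s) : E3)) =
            fun s => φ s • (EuclideanSpace.single k (1 : ℝ) : E3) := by
          ext s j; simp
        rw [this]
        exact hφ.smooth.smul contDiff_const
      have hsub : tsupport (fun s => (EuclideanSpace.single k (φ s) : E3)) ⊆ tsupport φ :=
        closure_mono fun s hs h0 => hs (by simp [h0])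
      have := h.integral_variation_eq_zero hβ hL hs
        (hφ.compact.isCompact.of_isClosed_subset (isClosed_tsupport _) hsub) (hsub.trans hφ.supp)
      refine Eq.trans (intervalIntegral.integral_congr fun s _ => ?_) this
      simp only [variationIntegrand]
      rw [deriv_single k hφ, deriv_single k hφ.deriv]
      simp only [EuclideanSpace.inner_single_right, RCLike.conj_to_real, tangent]
      ring
  have hgP := hg.add (continuous_const.intervalIntegrable (μ := volume) 0 L (u := fun _ : ℝ => P))
  refine ⟨P, _, (ac_const C 0 L).fun_add
    (hgP.absolutelyContinuousOnInterval_intervalIntegral (c := 0) left_mem_uIcc), ?_⟩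
  have hder := hgP.ae_hasDerivAt_integral
  rw [uIcc_of_le hL.le, ← ae_restrict_iff' measurableSet_Icc] at hder
  filter_upwards [hC, hder] with s h1 h2
  exact ⟨h1.symm, by simpa using h2 0 ⟨le_rfl, hL.le⟩⟩

/-- The linear system `w' = v`, `v' = β² w` with absolutely continuous solutions. -/
theorem cosh_solution (hβ : 0 < β) (hL : 0 ≤ L) {w v : ℝ → ℝ}
    (hw : AbsolutelyContinuousOnInterval w 0 L) (hv : AbsolutelyContinuousOnInterval v 0 L)
    (hw' : ∀ᵐ s ∂(volume.restrict (Icc 0 L)), HasDerivAt w (v s) s)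
    (hv' : ∀ᵐ s ∂(volume.restrict (Icc 0 L)), HasDerivAt v (β ^ 2 * w s) s) :
    ∀ s ∈ Icc 0 L, w s = Real.cosh (β * s) * w 0 + Real.sinh (β * s) / β * v 0 ∧
      v s = β * Real.sinh (β * s) * w 0 + Real.cosh (β * s) * v 0 := by
  have hexp : ∀ c s : ℝ, HasDerivAt (fun t => Real.exp (c * t)) (Real.exp (c * s) * c) s :=
    fun c s => by simpa using ((hasDerivAt_id s).const_mul c).exp
  have hexpac : ∀ c : ℝ, AbsolutelyContinuousOnInterval (fun t => Real.exp (c * t)) 0 L := fun c =>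
    ac_of_contDiff (by fun_prop) 0 L
  -- The combinations βw ± v are eigenvectors of the system, growing like exp(±βs); multiplied by
  -- exp(∓βs) they are constant.
  have key1 := ac_eq_of_ae_hasDerivAt_zero hL
    (((hw.const_mul β).fun_add hv).fun_mul (hexpac (-β))) (by
      filter_upwards [hw', hv'] with s h1 h2
      refine (((h1.const_mul β).fun_add h2).fun_mul (hexp (-β) s)).congr_deriv ?_
      ring)
  have key2 := ac_eq_of_ae_hasDerivAt_zero hL
    (((hw.const_mul β).fun_sub hv).fun_mul (hexpac β)) (by
      filter_upwards [hw', hv'] with s h1 h2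
      refine (((h1.const_mul β).fun_sub h2).fun_mul (hexp β s)).congr_deriv ?_
      ring)
  intro s hs
  have k1 := key1 s hs
  have k2 := key2 s hs
  simp only [mul_zero, Real.exp_zero, mul_one, neg_mul, Real.exp_neg] at k1 k2
  rw [Real.cosh_eq, Real.sinh_eq, Real.exp_neg]
  have hE := Real.exp_pos (β * s)
  generalize Real.exp (β * s) = E at *
  have k1' : β * w s + v s = (β * w 0 + v 0) * E := by
    rw [← k1]; field_simp
  have k2' : β * w s - v s = (β * w 0 - v 0) * E⁻¹ := by
    rw [← k2]; field_simp
  constructor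
  · field_simp at k2' ⊢
    linear_combination E * k1' + k2'
  · field_simp at k2' ⊢
    linear_combination E * k1' - k2'

/-- The solution of `w'' = β² w` with initial values `w₀` and `v₀`. -/
def hypSol (β : ℝ) (w₀ v₀ : E2) (s : ℝ) : E2 :=
  Real.cosh (β * s) • w₀ + (Real.sinh (β * s) / β) • v₀

/-- The derivative of `hypSol`. -/
def hypSolDeriv (β : ℝ) (w₀ v₀ : E2) (s : ℝ) : E2 :=
  (β * Real.sinh (β * s)) • w₀ + Real.cosh (β * s) • v₀

theorem hasDerivAt_hypSol (hβ : 0 < β) (w₀ v₀ : E2) (s : ℝ) :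
    HasDerivAt (hypSol β w₀ v₀) (hypSolDeriv β w₀ v₀ s) s := by
  have h0 : HasDerivAt (fun t => β * t) β s := by simpa using (hasDerivAt_id s).const_mul β
  refine ((h0.cosh.smul_const w₀).fun_add ((h0.sinh.div_const β).smul_const v₀)).congr_deriv ?_
  rw [hypSolDeriv, mul_div_cancel_right₀ _ hβ.ne', mul_comm (Real.sinh _)]

theorem hasDerivAt_hypSolDeriv (w₀ v₀ : E2) (s : ℝ) (hβ : 0 < β) :
    HasDerivAt (hypSolDeriv β w₀ v₀) (β ^ 2 • hypSol β w₀ v₀ s) s := by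
  have h0 : HasDerivAt (fun t => β * t) β s := by simpa using (hasDerivAt_id s).const_mul β
  refine (((h0.sinh.const_mul β).smul_const w₀).fun_add (h0.cosh.smul_const v₀)).congr_deriv ?_
  rw [hypSol, smul_add, smul_smul, smul_smul]
  congr 2
  · ring
  · field_simp

@[simp] theorem hypSol_zero (w₀ v₀ : E2) : hypSol β w₀ v₀ 0 = w₀ := by simp [hypSol]

@[simp] theorem hypSolDeriv_zero (w₀ v₀ : E2) : hypSolDeriv β w₀ v₀ 0 = v₀ := by
  simp [hypSolDeriv]

theorem continuous_hypSol (hβ : 0 < β) (w₀ v₀ : E2) : Continuous (hypSol β w₀ v₀) :=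
  continuous_iff_continuousAt.2 fun s => (hasDerivAt_hypSol hβ w₀ v₀ s).continuousAt

theorem eqOn_Icc_of_ae {f g : ℝ → ℝ} (hL : 0 < L) (hf : ContinuousOn f (Icc 0 L))
    (hg : ContinuousOn g (Icc 0 L)) (h : ∀ᵐ s ∂(volume.restrict (Icc 0 L)), f s = g s) :
    ∀ s ∈ Icc 0 L, f s = g s :=
  Measure.eqOn_Icc_of_ae_eq volume hL.ne h hf hg

/-- The first integrals of a cuspless geodesic: there is a constant vector `P` whose components in
the moving frame are `w₁'`, `w₂'` and `-β √(1 - ‖w‖²)`, where `w` is the normalized curvature. -/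
theorem IsCusplessGeodesic.exists_momentum (hβ : 0 < β) (hL : 0 < L)
    (h : IsCusplessGeodesic β L x R) :
    ∃ (P : Fin 3 → ℝ) (w₀ v₀ : E2),
      (∀ᵐ s ∂(volume.restrict (Icc 0 L)), hypSol β w₀ v₀ s = normalizedCurvature β x R s) ∧
      ∀ s ∈ Icc 0 L,
        P 0 * R s 0 0 + P 1 * R s 1 0 + P 2 * R s 2 0 = hypSolDeriv β w₀ v₀ s 0 ∧
        P 0 * R s 0 1 + P 1 * R s 1 1 + P 2 * R s 2 1 = hypSolDeriv β w₀ v₀ s 1 ∧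
        P 0 * R s 0 2 + P 1 * R s 1 2 + P 2 * R s 2 2 = -(β * √(1 - ‖hypSol β w₀ v₀ s‖ ^ 2)) := by
  have hH := h.horizontal
  choose P V hVac hV using h.exists_ac_representative hβ hL
  have hVall : ∀ᵐ s ∂(volume.restrict (Icc 0 L)), ∀ k, _ := ae_all_iff.2 hV
  have dotac : ∀ j, AbsolutelyContinuousOnInterval
      (fun s => V 0 s * R s 0 j + V 1 s * R s 1 j + V 2 s * R s 2 j) 0 L := fun j =>
    (((hVac 0).fun_mul (hH.ac_rot 0 j)).fun_add ((hVac 1).fun_mul (hH.ac_rot 1 j))).fun_add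
      ((hVac 2).fun_mul (hH.ac_rot 2 j))
  have Pac : ∀ j, AbsolutelyContinuousOnInterval
      (fun s => P 0 * R s 0 j + P 1 * R s 1 j + P 2 * R s 2 j) 0 L := fun j =>
    (((hH.ac_rot 0 j).const_mul _).fun_add ((hH.ac_rot 1 j).const_mul _)).fun_add
      ((hH.ac_rot 2 j).const_mul _)
  have cont : ∀ {f : ℝ → ℝ}, AbsolutelyContinuousOnInterval f 0 L → ContinuousOn f (Icc 0 L) :=
    fun hf => by have := hf.continuousOn; rwa [uIcc_of_le hL.le] at this
  have hae : ∀ᵐ s ∂(volume.restrict (Icc 0 L)), ∃ r > 0, r ^ 2 = ‖kappa x R s‖ ^ 2 + β ^ 2 ∧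
      √(‖kappa x R s‖ ^ 2 + β ^ 2) = r ∧
      (∀ k, V k s = r⁻¹ * (kappa x R s 0 * R s k 0 + kappa x R s 1 * R s k 1)) ∧
      (∀ k, HasDerivAt (V k) ((β ^ 2 - ‖kappa x R s‖ ^ 2) / r * R s k 2 + P k) s) := by
    filter_upwards [hVall, hH.tangent_hasDerivAt hL.le] with s h1 h2
    have hpos : 0 < ‖kappa x R s‖ ^ 2 + β ^ 2 := by positivity
    refine ⟨_, Real.sqrt_pos.2 hpos, Real.sq_sqrt hpos.le, rfl, fun k => ?_, fun k => ?_⟩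
    · rw [(h1 k).1, h2.2.2.2, h2.2.1, one_div]
    · have := (h1 k).2
      rwa [h2.2.2.2] at this
  -- V·T = 0 holds almost everywhere, hence everywhere by continuity, and can then be differentiated
  -- to find P·T.
  have hWT : ∀ s ∈ Icc 0 L, V 0 s * R s 0 2 + V 1 s * R s 1 2 + V 2 s * R s 2 2 = 0 := by
    refine eqOn_Icc_of_ae hL (cont (dotac 2)) continuousOn_const ?_
    filter_upwards [hae, ae_restrict_mem measurableSet_Icc] with s ⟨r, hr, hr2, _, h1, _⟩ hs
    have c02 := SO3_col (hH.mem_SO3 s hs) 0 2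
    have c12 := SO3_col (hH.mem_SO3 s hs) 1 2
    simp only [Fin.reduceEq, if_false] at c02 c12
    rw [h1, h1, h1]
    linear_combination r⁻¹ * kappa x R s 0 * c02 + r⁻¹ * kappa x R s 1 * c12
  have hPT : ∀ᵐ s ∂(volume.restrict (Icc 0 L)),
      P 0 * R s 0 2 + P 1 * R s 1 2 + P 2 * R s 2 2 =
        -(β ^ 2 / √(‖kappa x R s‖ ^ 2 + β ^ 2)) := by
    filter_upwards [hae, hH.frame_hasDerivAt hL.le, ae_mem_Ioo 0 L]
      with s ⟨r, hr, hr2, hsq, h1, h2⟩ h3 hmem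
    have hs := Ioo_subset_Icc_self hmem
    have hd := ((((h2 0).fun_mul (h3 0).2.2).fun_add ((h2 1).fun_mul (h3 1).2.2)).fun_add
      ((h2 2).fun_mul (h3 2).2.2)).unique ((hasDerivAt_const s (0 : ℝ)).congr_of_eventuallyEq (by
        filter_upwards [Icc_mem_nhds hmem.1 hmem.2] with t ht using hWT t ht))
    have c00 := SO3_col (hH.mem_SO3 s hs) 0 0
    have c01 := SO3_col (hH.mem_SO3 s hs) 0 1
    have c11 := SO3_col (hH.mem_SO3 s hs) 1 1
    have c22 := SO3_col (hH.mem_SO3 s hs) 2 2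
    simp only [Fin.reduceEq, if_false, if_true] at c00 c01 c11 c22
    rw [h1, h1, h1] at hd
    rw [hsq]
    have hk := E2_norm_sq (kappa x R s)
    rw [hk] at hd hr2
    generalize kappa x R s 0 = k0 at *
    generalize kappa x R s 1 = k1 at *
    rw [div_eq_mul_inv] at hd ⊢
    linear_combination hd - (β ^ 2 - (k0 ^ 2 + k1 ^ 2)) * r⁻¹ * c22 - r⁻¹ * k0 ^ 2 * c00
      - r⁻¹ * k1 ^ 2 * c11 - 2 * r⁻¹ * k0 * k1 * c01
  have hnc : ∀ᵐ s ∂(volume.restrict (Icc 0 L)),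
      V 0 s * R s 0 0 + V 1 s * R s 1 0 + V 2 s * R s 2 0 = normalizedCurvature β x R s 0 ∧
      V 0 s * R s 0 1 + V 1 s * R s 1 1 + V 2 s * R s 2 1 = normalizedCurvature β x R s 1 := by
    filter_upwards [hae, ae_restrict_mem measurableSet_Icc] with s ⟨r, hr, hr2, hsq, h1, _⟩ hs
    have c00 := SO3_col (hH.mem_SO3 s hs) 0 0
    have c01 := SO3_col (hH.mem_SO3 s hs) 0 1
    have c11 := SO3_col (hH.mem_SO3 s hs) 1 1
    simp only [Fin.reduceEq, if_false, if_true] at c00 c01 c11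
    simp only [normalizedCurvature, hsq, PiLp.smul_apply, smul_eq_mul, one_div]
    rw [h1, h1, h1]
    constructor
    · linear_combination r⁻¹ * kappa x R s 0 * c00 + r⁻¹ * kappa x R s 1 * c01
    · linear_combination r⁻¹ * kappa x R s 0 * c01 + r⁻¹ * kappa x R s 1 * c11
  -- The pair (V·R₁, P·R₁) solves w' = v, v' = β²w: the first equation uses V·T = 0, the second the
  -- value of P·T. The next step treats R₂ in the same way.
  have hsol0 := cosh_solution hβ hL.le (dotac 0) (Pac 0) (by
      filter_upwards [hae, hH.frame_hasDerivAt hL.le, ae_restrict_mem measurableSet_Icc]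
        with s ⟨r, hr, hr2, hsq, h1, h2⟩ h3 hs
      have c02 := SO3_col (hH.mem_SO3 s hs) 0 2
      simp only [Fin.reduceEq, if_false] at c02
      refine ((((h2 0).fun_mul (h3 0).1).fun_add ((h2 1).fun_mul (h3 1).1)).fun_add
        ((h2 2).fun_mul (h3 2).1)).congr_deriv ?_
      linear_combination (β ^ 2 - ‖kappa x R s‖ ^ 2) / r * c02 - kappa x R s 0 * hWT s hs) (by
      filter_upwards [hnc, hH.frame_hasDerivAt hL.le, hPT] with s h1 h3 h4
      refine ((((h3 0).1.const_mul (P 0)).fun_add ((h3 1).1.const_mul (P 1))).fun_add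
        ((h3 2).1.const_mul (P 2))).congr_deriv ?_
      rw [h1.1]
      simp only [normalizedCurvature, PiLp.smul_apply, smul_eq_mul, one_div]
      rw [div_eq_mul_inv] at h4
      linear_combination -kappa x R s 0 * h4)
  have hsol1 := cosh_solution hβ hL.le (dotac 1) (Pac 1) (by
      filter_upwards [hae, hH.frame_hasDerivAt hL.le, ae_restrict_mem measurableSet_Icc]
        with s ⟨r, hr, hr2, hsq, h1, h2⟩ h3 hs
      have c12 := SO3_col (hH.mem_SO3 s hs) 1 2
      simp only [Fin.reduceEq, if_false] at c12
      refine ((((h2 0).fun_mul (h3 0).2.1).fun_add ((h2 1).fun_mul (h3 1).2.1)).fun_add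
        ((h2 2).fun_mul (h3 2).2.1)).congr_deriv ?_
      linear_combination (β ^ 2 - ‖kappa x R s‖ ^ 2) / r * c12 - kappa x R s 1 * hWT s hs) (by
      filter_upwards [hnc, hH.frame_hasDerivAt hL.le, hPT] with s h1 h3 h4
      refine ((((h3 0).2.1.const_mul (P 0)).fun_add ((h3 1).2.1.const_mul (P 1))).fun_add
        ((h3 2).2.1.const_mul (P 2))).congr_deriv ?_
      rw [h1.2]
      simp only [normalizedCurvature, PiLp.smul_apply, smul_eq_mul, one_div]
      rw [div_eq_mul_inv] at h4
      linear_combination -kappa x R s 1 * h4)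
  set w₀ : E2 := !₂[V 0 0 * R 0 0 0 + V 1 0 * R 0 1 0 + V 2 0 * R 0 2 0,
    V 0 0 * R 0 0 1 + V 1 0 * R 0 1 1 + V 2 0 * R 0 2 1] with hw₀
  set v₀ : E2 := !₂[P 0 * R 0 0 0 + P 1 * R 0 1 0 + P 2 * R 0 2 0,
    P 0 * R 0 0 1 + P 1 * R 0 1 1 + P 2 * R 0 2 1] with hv₀
  have hw : ∀ᵐ s ∂(volume.restrict (Icc 0 L)),
      hypSol β w₀ v₀ s = normalizedCurvature β x R s := by
    filter_upwards [hnc, ae_restrict_mem measurableSet_Icc] with s h1 hs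
    ext i
    fin_cases i
    · refine Eq.trans ?_ h1.1
      rw [(hsol0 s hs).1]
      simp [hypSol, hw₀, hv₀]
    · refine Eq.trans ?_ h1.2
      rw [(hsol1 s hs).1]
      simp [hypSol, hw₀, hv₀]
  refine ⟨P, w₀, v₀, hw, fun s hs => ⟨?_, ?_, ?_⟩⟩
  · rw [(hsol0 s hs).2]
    simp [hypSolDeriv, hw₀, hv₀]
  · rw [(hsol1 s hs).2]
    simp [hypSolDeriv, hw₀, hv₀]
  · revert s
    refine eqOn_Icc_of_ae hL (cont (Pac 2)) ?_ ?_
    · have := continuous_hypSol hβ w₀ v₀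
      exact Continuous.continuousOn (by fun_prop)
    · filter_upwards [hPT, hw] with s h1 h2
      have hpos : 0 < ‖kappa x R s‖ ^ 2 + β ^ 2 := by positivity
      have hr : 0 < √(‖kappa x R s‖ ^ 2 + β ^ 2) := Real.sqrt_pos.2 hpos
      rw [h1, h2]
      congr 1
      have : 1 - ‖normalizedCurvature β x R s‖ ^ 2 =
          (β / √(‖kappa x R s‖ ^ 2 + β ^ 2)) ^ 2 := by
        rw [normalizedCurvature, norm_smul, mul_pow, Real.norm_eq_abs, sq_abs, div_pow, div_pow,
          Real.sq_sqrt hpos.le]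
        field_simp
        ring
      rw [this, Real.sqrt_sq (by positivity)]
      ring

end

/-! ### The normalized curvature and the constants of motion -/

/-- A curve in `SE(3)` starting at the unit element, with normalized curvature `hypSol β w₀ v₀` and
constant momentum `P`. -/
structure HasMomentum (β L : ℝ) (x : ℝ → E3) (R : ℝ → Mat3) (P : Fin 3 → ℝ) (w₀ v₀ : E2) :
    Prop where
  horizontal : IsHorizontalOn x R 0 L
  arclength : ∀ᵐ s ∂(volume.restrict (Icc 0 L)), coframe x R s 2 = 1
  pos_zero : x 0 = 0
  rot_zero : R 0 = 1
  ae_eq : ∀ᵐ s ∂(volume.restrict (Icc 0 L)), hypSol β w₀ v₀ s = normalizedCurvature β x R s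
  comp_zero : ∀ s ∈ Icc 0 L,
    P 0 * R s 0 0 + P 1 * R s 1 0 + P 2 * R s 2 0 = hypSolDeriv β w₀ v₀ s 0
  comp_one : ∀ s ∈ Icc 0 L,
    P 0 * R s 0 1 + P 1 * R s 1 1 + P 2 * R s 2 1 = hypSolDeriv β w₀ v₀ s 1
  comp_two : ∀ s ∈ Icc 0 L,
    P 0 * R s 0 2 + P 1 * R s 1 2 + P 2 * R s 2 2 = -(β * √(1 - ‖hypSol β w₀ v₀ s‖ ^ 2))

theorem IsCusplessGeodesic.exists_hasMomentum {β L : ℝ} {x : ℝ → E3} {R : ℝ → Mat3} (hβ : 0 < β)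
    (hL : 0 < L) (h : IsCusplessGeodesic β L x R) :
    ∃ P w₀ v₀, HasMomentum β L x R P w₀ v₀ := by
  obtain ⟨P, w₀, v₀, h1, h2⟩ := h.exists_momentum hβ hL
  exact ⟨P, w₀, v₀, h.horizontal, h.arclength, h.pos_zero, h.rot_zero, h1, fun s hs => (h2 s hs).1,
    fun s hs => (h2 s hs).2.1, fun s hs => (h2 s hs).2.2⟩

section

variable {β L : ℝ} {x : ℝ → E3} {R : ℝ → Mat3} {P : Fin 3 → ℝ} {w₀ v₀ : E2}

theorem deriv_hypSol (hβ : 0 < β) (w₀ v₀ : E2) (s : ℝ) :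
    deriv (hypSol β w₀ v₀) s = hypSolDeriv β w₀ v₀ s := (hasDerivAt_hypSol hβ w₀ v₀ s).deriv

theorem continuous_hypSolDeriv (hβ : 0 < β) (w₀ v₀ : E2) : Continuous (hypSolDeriv β w₀ v₀) :=
  continuous_iff_continuousAt.2 fun s => (hasDerivAt_hypSolDeriv w₀ v₀ s hβ).continuousAt

theorem norm_normalizedCurvature_lt (hβ : 0 < β) (s : ℝ) :
    ‖normalizedCurvature β x R s‖ < 1 := by
  have hpos : 0 < ‖kappa x R s‖ ^ 2 + β ^ 2 := by positivity
  have hr : 0 < √(‖kappa x R s‖ ^ 2 + β ^ 2) := Real.sqrt_pos.2 hpos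
  rw [normalizedCurvature, norm_smul, Real.norm_eq_abs, abs_of_pos (by positivity), one_div,
    inv_mul_lt_iff₀ hr, mul_one]
  exact Real.lt_sqrt_of_sq_lt (by nlinarith)

/-- The Wronskian is conserved. -/
theorem wronskian_hypSol (hβ : 0 < β) (w₀ v₀ : E2) (s : ℝ) :
    hypSol β w₀ v₀ s 0 * hypSolDeriv β w₀ v₀ s 1 - hypSol β w₀ v₀ s 1 * hypSolDeriv β w₀ v₀ s 0 =
      w₀ 0 * v₀ 1 - w₀ 1 * v₀ 0 := by
  have h := Real.cosh_sq (β * s)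
  simp only [hypSol, hypSolDeriv, PiLp.add_apply, PiLp.smul_apply, smul_eq_mul]
  field_simp
  linear_combination β * (w₀ 0 * v₀ 1 - w₀ 1 * v₀ 0) * h

theorem WW_hypSol (hβ : 0 < β) (w₀ v₀ : E2) :
    WW (hypSol β w₀ v₀) = w₀ 0 * v₀ 1 - w₀ 1 * v₀ 0 := by
  rw [WW, deriv_hypSol hβ, wronskian_hypSol hβ]

/-- An everywhere bounded solution is strictly smaller in the interior. -/
theorem norm_hypSol_lt_one (hβ : 0 < β) (h : ∀ s ∈ Icc 0 L, ‖hypSol β w₀ v₀ s‖ ≤ 1) :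
    ∀ s ∈ Ioo 0 L, ‖hypSol β w₀ v₀ s‖ < 1 := by
  intro s hs
  -- The largest t for which s − t and s + t both lie in [0, L]. There w(s + t) + w(s − t) = 2
  -- cosh(βt) w(s) has norm at most 2, while cosh(βt) > 1.
  set t := min s (L - s) with ht
  have ht0 : 0 < t := lt_min hs.1 (by linarith [hs.2])
  have h1 := h (s + t) ⟨by linarith [hs.1], by linarith [min_le_right s (L - s)]⟩
  have h2 := h (s - t) ⟨by linarith [min_le_left s (L - s)], by linarith [hs.2]⟩
  have hsum : hypSol β w₀ v₀ (s + t) + hypSol β w₀ v₀ (s - t) =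
      (2 * Real.cosh (β * t)) • hypSol β w₀ v₀ s := by
    simp only [hypSol, mul_add, mul_sub, Real.cosh_add, Real.cosh_sub, Real.sinh_add,
      Real.sinh_sub]
    module
  have hcosh : 1 < Real.cosh (β * t) := Real.one_lt_cosh.2 (by positivity)
  have hn := norm_add_le (hypSol β w₀ v₀ (s + t)) (hypSol β w₀ v₀ (s - t))
  rw [hsum, norm_smul, Real.norm_eq_abs, abs_of_pos (by positivity)] at hn
  by_contra hge
  push Not at hge
  nlinarith

namespace HasMomentum

theorem norm_le_one (h : HasMomentum β L x R P w₀ v₀) (hβ : 0 < β)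
    (hL : 0 < L) : ∀ s ∈ Icc 0 L, ‖hypSol β w₀ v₀ s‖ ≤ 1 := by
  have hc := continuous_hypSol hβ w₀ v₀
  -- The inequality ‖w‖ ≤ 1 is phrased as the equality max(‖w‖, 1) = 1 of continuous functions, so
  -- that it passes from almost every s to every s.
  have := eqOn_Icc_of_ae (f := fun s => max ‖hypSol β w₀ v₀ s‖ 1) (g := fun _ => 1) hL
    (Continuous.continuousOn (by fun_prop)) continuousOn_const (by
      filter_upwards [h.ae_eq] with s hs
      rw [hs, max_eq_right (norm_normalizedCurvature_lt hβ s).le])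
  intro s hs
  exact max_eq_right_iff.1 (this s hs)

theorem norm_lt_one (h : HasMomentum β L x R P w₀ v₀) (hβ : 0 < β)
    (hL : 0 < L) : ∀ s ∈ Ioo 0 L, ‖hypSol β w₀ v₀ s‖ < 1 :=
  norm_hypSol_lt_one hβ (h.norm_le_one hβ hL)

/-- The squared length of P, computed in the orthonormal frame R(s). At s = 0 it identifies 𝔠β with
‖P‖. -/
theorem sq_momentum (h : HasMomentum β L x R P w₀ v₀) (hβ : 0 < β)
    (hL : 0 < L) {s : ℝ} (hs : s ∈ Icc 0 L) :
    P 0 ^ 2 + P 1 ^ 2 + P 2 ^ 2 =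
      ‖hypSolDeriv β w₀ v₀ s‖ ^ 2 + β ^ 2 * (1 - ‖hypSol β w₀ v₀ s‖ ^ 2) := by
  have hR := h.horizontal.mem_SO3 s hs
  have hle := h.norm_le_one hβ hL s hs
  have hq : √(1 - ‖hypSol β w₀ v₀ s‖ ^ 2) ^ 2 = 1 - ‖hypSol β w₀ v₀ s‖ ^ 2 :=
    Real.sq_sqrt (by nlinarith [norm_nonneg (hypSol β w₀ v₀ s)])
  have r00 := SO3_row hR 0 0
  have r01 := SO3_row hR 0 1
  have r02 := SO3_row hR 0 2
  have r11 := SO3_row hR 1 1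
  have r12 := SO3_row hR 1 2
  have r22 := SO3_row hR 2 2
  simp only [Fin.reduceEq, if_false, if_true] at r00 r01 r02 r11 r12 r22
  have e : ‖hypSolDeriv β w₀ v₀ s‖ ^ 2 + β ^ 2 * (1 - ‖hypSol β w₀ v₀ s‖ ^ 2) =
      hypSolDeriv β w₀ v₀ s 0 ^ 2 + hypSolDeriv β w₀ v₀ s 1 ^ 2 +
      (-(β * √(1 - ‖hypSol β w₀ v₀ s‖ ^ 2))) ^ 2 := by
    rw [E2_norm_sq (hypSolDeriv β w₀ v₀ s)]
    linear_combination -β ^ 2 * hq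
  rw [e, ← h.comp_zero s hs, ← h.comp_one s hs, ← h.comp_two s hs]
  linear_combination -P 0 ^ 2 * r00 - P 1 ^ 2 * r11 - P 2 ^ 2 * r22 - 2 * P 0 * P 1 * r01 -
    2 * P 0 * P 2 * r02 - 2 * P 1 * P 2 * r12

theorem sq_cc (h : HasMomentum β L x R P w₀ v₀) (hβ : 0 < β) (hL : 0 < L) :
    cc β (hypSol β w₀ v₀) ^ 2 * β ^ 2 = P 0 ^ 2 + P 1 ^ 2 + P 2 ^ 2 := by
  have h0 : (0 : ℝ) ∈ Icc 0 L := ⟨le_rfl, hL.le⟩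
  have hle := h.norm_le_one hβ hL 0 h0
  have hsq := h.sq_momentum hβ hL h0
  rw [cc, deriv_hypSol hβ, Real.sq_sqrt, hsq]
  · field_simp
    ring
  · have := norm_nonneg (hypSol β w₀ v₀ 0)
    have : 0 ≤ 1 - ‖hypSol β w₀ v₀ 0‖ ^ 2 := by nlinarith
    positivity

/-- At the midpoint ‖w‖ < 1, so P has a nonzero tangential component there. -/
theorem cc_pos (h : HasMomentum β L x R P w₀ v₀) (hβ : 0 < β)
    (hL : 0 < L) : 0 < cc β (hypSol β w₀ v₀) := by
  have hm : L / 2 ∈ Ioo 0 L := ⟨by linarith, by linarith⟩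
  have hlt := h.norm_lt_one hβ hL _ hm
  have hsq := h.sq_momentum hβ hL (Ioo_subset_Icc_self hm)
  rw [← h.sq_cc hβ hL] at hsq
  have h1 : 0 < 1 - ‖hypSol β w₀ v₀ (L / 2)‖ ^ 2 := by
    nlinarith [norm_nonneg (hypSol β w₀ v₀ (L / 2))]
  have h2 : 0 < cc β (hypSol β w₀ v₀) ^ 2 * β ^ 2 := by rw [hsq]; positivity
  refine (Real.sqrt_nonneg _).lt_of_ne' fun h0 => ?_
  change cc β (hypSol β w₀ v₀) = 0 at h0
  rw [h0] at h2
  simp at h2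

theorem rt_eq (h : HasMomentum β L x R P w₀ v₀) (hβ : 0 < β)
    (hL : 0 < L) {s : ℝ} (hs : s ∈ Icc 0 L) :
    rt β (hypSol β w₀ v₀) s = β * √(1 - ‖hypSol β w₀ v₀ s‖ ^ 2) := by
  rw [rt, h.sq_cc hβ hL, h.sq_momentum hβ hL hs, deriv_hypSol hβ, add_sub_cancel_left,
    Real.sqrt_mul (sq_nonneg β), Real.sqrt_sq hβ.le]

theorem denA_mul (h : HasMomentum β L x R P w₀ v₀) (hβ : 0 < β) (hL : 0 < L) (s : ℝ) :
    denA β (hypSol β w₀ v₀) s * (P 0 ^ 2 + P 1 ^ 2 + P 2 ^ 2) =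
      ‖hypSol β w₀ v₀ s‖ ^ 2 * (P 0 ^ 2 + P 1 ^ 2 + P 2 ^ 2) -
        (w₀ 0 * v₀ 1 - w₀ 1 * v₀ 0) ^ 2 := by
  have hc := h.cc_pos hβ hL
  rw [denA, ← h.sq_cc hβ hL, WW_hypSol hβ]
  field_simp

/-- Multiplied by ‖P‖², the denominator is β²‖w‖²(1 − ‖w‖²) + (w·w')². As w ≠ 0, this could vanish
only where ‖w‖ = 1 and w·w' = 0; starting from such a point the solution would never have norm below
1, against ‖w(L/2)‖ < 1. -/
theorem denA_pos (h : HasMomentum β L x R P w₀ v₀) (hβ : 0 < β)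
    (hL : 0 < L) (hW : WW (hypSol β w₀ v₀) ≠ 0) {s : ℝ}
    (hs : s ∈ Icc 0 L) : 0 < denA β (hypSol β w₀ v₀) s := by
  have hc := h.cc_pos hβ hL
  rw [WW_hypSol hβ] at hW
  have hP : 0 < P 0 ^ 2 + P 1 ^ 2 + P 2 ^ 2 := by rw [← h.sq_cc hβ hL]; positivity
  refine pos_of_mul_pos_left ?_ hP.le
  rw [h.denA_mul hβ hL, h.sq_momentum hβ hL hs, ← wronskian_hypSol hβ w₀ v₀ s]
  have hle := h.norm_le_one hβ hL s hs
  set w := hypSol β w₀ v₀ s with hw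
  set v := hypSolDeriv β w₀ v₀ s with hv
  have hW' : w 0 * v 1 - w 1 * v 0 ≠ 0 := by rwa [wronskian_hypSol hβ]
  have hwpos : 0 < ‖w‖ ^ 2 := by
    rw [E2_norm_sq]
    rcases eq_or_ne (w 0) 0 with h0 | h0
    · have h1 : w 1 ≠ 0 := fun h1 => hW' (by rw [h0, h1]; ring)
      positivity
    · positivity
  have hid : ‖w‖ ^ 2 * (‖v‖ ^ 2 + β ^ 2 * (1 - ‖w‖ ^ 2)) - (w 0 * v 1 - w 1 * v 0) ^ 2 =
      β ^ 2 * ‖w‖ ^ 2 * (1 - ‖w‖ ^ 2) + (w 0 * v 0 + w 1 * v 1) ^ 2 := by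
    have e1 := E2_norm_sq w
    have e2 := E2_norm_sq v
    rw [e2]
    linear_combination (v 0 ^ 2 + v 1 ^ 2) * e1
  rw [hid]
  rcases hle.lt_or_eq with hlt | heq
  · have : 0 < 1 - ‖w‖ ^ 2 := by nlinarith [norm_nonneg w]
    positivity
  · have hne : w 0 * v 0 + w 1 * v 1 ≠ 0 := by
      intro h0
      have hin : inner ℝ w v = 0 := by
        rw [PiLp.inner_apply, Fin.sum_univ_two]
        simp only [RCLike.inner_apply, conj_trivial]
        linarith
      -- The solution restarted at s, by the addition formulas.
      have hshift : hypSol β w₀ v₀ (L / 2) =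
          Real.cosh (β * (L / 2 - s)) • w + (Real.sinh (β * (L / 2 - s)) / β) • v := by
        have hch := Real.cosh_sq (β * s)
        have e : β * (L / 2) = β * (L / 2 - s) + β * s := by ring
        simp only [hw, hv, hypSol, hypSolDeriv]
        rw [e, Real.cosh_add, Real.sinh_add]
        ext i
        simp only [PiLp.add_apply, PiLp.smul_apply, smul_eq_mul]
        field_simp
        ring
      have hlt := h.norm_lt_one hβ hL (L / 2) ⟨by linarith, by linarith⟩
      have hsq : ‖hypSol β w₀ v₀ (L / 2)‖ ^ 2 = Real.cosh (β * (L / 2 - s)) ^ 2 +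
          (Real.sinh (β * (L / 2 - s)) / β) ^ 2 * ‖v‖ ^ 2 := by
        rw [hshift, norm_add_sq_real, inner_smul_left, inner_smul_right, hin, norm_smul, norm_smul,
          heq, mul_pow, mul_pow, Real.norm_eq_abs, Real.norm_eq_abs, sq_abs, sq_abs]
        ring
      have h1 := Real.one_le_cosh (β * (L / 2 - s))
      have h2 : 0 ≤ (Real.sinh (β * (L / 2 - s)) / β) ^ 2 * ‖v‖ ^ 2 := by positivity
      nlinarith [norm_nonneg (hypSol β w₀ v₀ (L / 2))]
    have : 0 < (w 0 * v 0 + w 1 * v 1) ^ 2 := by positivity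
    rw [heq]
    nlinarith

/-- The frame at 0 is the identity. For w'(0) ≠ 0 this makes −P/(𝔠β) the first row of `tildeR0`. -/
theorem momentum_eq (h : HasMomentum β L x R P w₀ v₀) (hβ : 0 < β) (hL : 0 < L) :
    P 0 = v₀ 0 ∧ P 1 = v₀ 1 ∧ P 2 = -rt β (hypSol β w₀ v₀) 0 := by
  have h0 : (0 : ℝ) ∈ Icc 0 L := ⟨le_rfl, hL.le⟩
  refine ⟨?_, ?_, ?_⟩
  · simpa [h.rot_zero] using h.comp_zero 0 h0
  · simpa [h.rot_zero] using h.comp_one 0 h0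
  · rw [h.rt_eq hβ hL h0]
    simpa [h.rot_zero] using h.comp_two 0 h0

end HasMomentum

end

/-! ### The angular momentum and the spatial part of the geodesic -/

theorem SO3_cross {A : Mat3} (h : A ∈ Matrix.specialOrthogonalGroup (Fin 3) ℝ) :
    (A 1 1 * A 2 2 - A 2 1 * A 1 2 = A 0 0 ∧ A 2 1 * A 0 2 - A 0 1 * A 2 2 = A 1 0 ∧
      A 0 1 * A 1 2 - A 1 1 * A 0 2 = A 2 0) ∧
    (A 1 2 * A 2 0 - A 2 2 * A 1 0 = A 0 1 ∧ A 2 2 * A 0 0 - A 0 2 * A 2 0 = A 1 1 ∧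
      A 0 2 * A 1 0 - A 1 2 * A 0 0 = A 2 1) ∧
    (A 1 0 * A 2 1 - A 2 0 * A 1 1 = A 0 2 ∧ A 2 0 * A 0 1 - A 0 0 * A 2 1 = A 1 2 ∧
      A 0 0 * A 1 1 - A 1 0 * A 0 1 = A 2 2) := by
  have hadj := SO3_adjugate h
  rw [Matrix.adjugate_fin_three] at hadj
  have e : ∀ i j, _ := fun i j => congrFun (congrFun hadj i) j
  have e00 := e 0 0
  have e01 := e 0 1
  have e02 := e 0 2
  have e10 := e 1 0
  have e11 := e 1 1
  have e12 := e 1 2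
  have e20 := e 2 0
  have e21 := e 2 1
  have e22 := e 2 2
  simp at e00 e01 e02 e10 e11 e12 e20 e21 e22
  refine ⟨⟨?_, ?_, ?_⟩, ⟨?_, ?_, ?_⟩, ?_, ?_, ?_⟩ <;> linarith

/-- The cross product of the tangent with the normalized curvature vector in space. -/
def angVec (β : ℝ) (R : ℝ → Mat3) (w₀ v₀ : E2) (k : Fin 3) (s : ℝ) : ℝ :=
  hypSol β w₀ v₀ s 0 * R s k 1 - hypSol β w₀ v₀ s 1 * R s k 0

theorem E2_hasDerivAt_apply {f : ℝ → E2} {f' : E2} {s : ℝ} (h : HasDerivAt f f' s) (k : Fin 2) :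
    HasDerivAt (fun t => f t k) (f' k) s :=
  (EuclideanSpace.proj k : E2 →L[ℝ] ℝ).hasFDerivAt.comp_hasDerivAt s h

section

variable {β L : ℝ} {x : ℝ → E3} {R : ℝ → Mat3} {P : Fin 3 → ℝ} {w₀ v₀ : E2}

theorem ac_hypSol (w₀ v₀ : E2) (k : Fin 2) (a b : ℝ) :
    AbsolutelyContinuousOnInterval (fun s => hypSol β w₀ v₀ s k) a b := by
  refine ac_of_contDiff ?_ a b
  simp only [hypSol, PiLp.add_apply, PiLp.smul_apply, smul_eq_mul]
  fun_prop

namespace HasMomentum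

theorem momentum_coord (h : HasMomentum β L x R P w₀ v₀) {s : ℝ} (hs : s ∈ Icc 0 L) (k : Fin 3) :
    P k = hypSolDeriv β w₀ v₀ s 0 * R s k 0 + hypSolDeriv β w₀ v₀ s 1 * R s k 1 -
      β * √(1 - ‖hypSol β w₀ v₀ s‖ ^ 2) * R s k 2 := by
  have hR := h.horizontal.mem_SO3 s hs
  have e0 := h.comp_zero s hs
  have e1 := h.comp_one s hs
  have e2 := h.comp_two s hs
  have r0 := SO3_row hR 0 k
  have r1 := SO3_row hR 1 k
  have r2 := SO3_row hR 2 k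
  have hsum : P k = P 0 * (R s 0 0 * R s k 0 + R s 0 1 * R s k 1 + R s 0 2 * R s k 2) +
      P 1 * (R s 1 0 * R s k 0 + R s 1 1 * R s k 1 + R s 1 2 * R s k 2) +
      P 2 * (R s 2 0 * R s k 0 + R s 2 1 * R s k 1 + R s 2 2 * R s k 2) := by
    rw [r0, r1, r2]
    fin_cases k <;> simp
  rw [hsum]
  linear_combination R s k 0 * e0 + R s k 1 * e1 + R s k 2 * e2

theorem ac_angVec (h : HasMomentum β L x R P w₀ v₀) (k : Fin 3) :
    AbsolutelyContinuousOnInterval (angVec β R w₀ v₀ k) 0 L :=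
  ((ac_hypSol w₀ v₀ 0 0 L).fun_mul (h.horizontal.ac_rot k 1)).fun_sub
    ((ac_hypSol w₀ v₀ 1 0 L).fun_mul (h.horizontal.ac_rot k 0))

/-- Since κ is parallel to w, the tangential terms κ₁w₂ − κ₂w₁ disappear when combinations of R₁ and
R₂ are differentiated. -/
theorem ae_kappa_parallel (hβ : 0 < β) (h : HasMomentum β L x R P w₀ v₀) :
    ∀ᵐ s ∂(volume.restrict (Icc 0 L)), ∃ r,
      ∀ i, kappa x R s i = r * hypSol β w₀ v₀ s i := by
  filter_upwards [h.ae_eq] with s hs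
  have hpos : 0 < ‖kappa x R s‖ ^ 2 + β ^ 2 := by positivity
  have hr : √(‖kappa x R s‖ ^ 2 + β ^ 2) ≠ 0 := (Real.sqrt_pos.2 hpos).ne'
  refine ⟨√(‖kappa x R s‖ ^ 2 + β ^ 2), fun i => ?_⟩
  rw [hs]
  simp only [normalizedCurvature, PiLp.smul_apply, smul_eq_mul]
  field_simp

theorem angVec_hasDerivAt (hβ : 0 < β) (hL : 0 < L) (h : HasMomentum β L x R P w₀ v₀) :
    ∀ s ∈ Ioo 0 L, ∀ k, HasDerivAt (angVec β R w₀ v₀ k)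
      (hypSolDeriv β w₀ v₀ s 0 * R s k 1 - hypSolDeriv β w₀ v₀ s 1 * R s k 0) s := by
  intro s hs k
  refine ac_hasDerivAt_of_continuousOn hL.le (h.ac_angVec k) (φ := fun s =>
    hypSolDeriv β w₀ v₀ s 0 * R s k 1 - hypSolDeriv β w₀ v₀ s 1 * R s k 0) ?_ ?_ s hs
  · have hc := continuous_hypSolDeriv hβ w₀ v₀
    have c0 := (h.horizontal.ac_rot k 0).continuousOn
    have c1 := (h.horizontal.ac_rot k 1).continuousOn
    rw [uIcc_of_le hL.le] at c0 c1
    have d0 : Continuous fun s => hypSolDeriv β w₀ v₀ s 0 := by fun_prop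
    have d1 : Continuous fun s => hypSolDeriv β w₀ v₀ s 1 := by fun_prop
    exact (d0.continuousOn.mul c1).sub (d1.continuousOn.mul c0)
  · filter_upwards [h.horizontal.frame_hasDerivAt hL.le, h.ae_kappa_parallel hβ]
      with t h1 ⟨r, h2⟩
    have hw := hasDerivAt_hypSol hβ w₀ v₀ t
    refine (((E2_hasDerivAt_apply hw 0).fun_mul (h1 k).2.1).fun_sub
      ((E2_hasDerivAt_apply hw 1).fun_mul (h1 k).1)).congr_deriv ?_
    rw [h2, h2]
    ring

theorem angVec_zero (h : HasMomentum β L x R P w₀ v₀) :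
    angVec β R w₀ v₀ 0 0 = -w₀ 1 ∧ angVec β R w₀ v₀ 1 0 = w₀ 0 ∧ angVec β R w₀ v₀ 2 0 = 0 := by
  simp [angVec, h.rot_zero]

theorem ae_hasDerivAt_coord (hL : 0 < L) (h : HasMomentum β L x R P w₀ v₀) :
    ∀ᵐ s ∂(volume.restrict (Icc 0 L)), ∀ k, HasDerivAt (fun t => x t k) (R s k 2) s := by
  filter_upwards [ae_mem_Ioo 0 L] with s hs k
  exact E3_hasDerivAt_apply (h.horizontal.pos_hasDerivAt hL.le h.arclength s hs) k

/-- The component of the position along the momentum. -/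
theorem inner_momentum (hβ : 0 < β) (hL : 0 < L) (h : HasMomentum β L x R P w₀ v₀) :
    ∀ s ∈ Icc 0 L, P 0 * x s 0 + P 1 * x s 1 + P 2 * x s 2 =
      -(β * ∫ τ in (0 : ℝ)..s, √(1 - ‖hypSol β w₀ v₀ τ‖ ^ 2)) := by
  have hx := ac_apply h.horizontal.ac_pos
  have hc := continuous_hypSol hβ w₀ v₀
  have hq : Continuous fun τ => √(1 - ‖hypSol β w₀ v₀ τ‖ ^ 2) := by fun_prop
  have hi : IntervalIntegrable (fun τ => √(1 - ‖hypSol β w₀ v₀ τ‖ ^ 2)) volume 0 L :=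
    hq.intervalIntegrable _ _
  have key := ac_sub_eq_of_ae_hasDerivAt (φ := fun s => -(β * √(1 - ‖hypSol β w₀ v₀ s‖ ^ 2))) hL.le
    ((((hx 0).const_mul (P 0)).fun_add ((hx 1).const_mul (P 1))).fun_add ((hx 2).const_mul (P 2)))
    ((hi.absolutelyContinuousOnInterval_intervalIntegral (c := 0) left_mem_uIcc).const_mul β).fun_neg
    (by
      filter_upwards [h.ae_hasDerivAt_coord hL, ae_restrict_mem measurableSet_Icc] with s h1 hs
      refine ((((h1 0).const_mul (P 0)).fun_add ((h1 1).const_mul (P 1))).fun_add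
        ((h1 2).const_mul (P 2))).congr_deriv (h.comp_two s hs))
    (Filter.Eventually.of_forall fun s => by
      have := (intervalIntegral.integral_hasDerivAt_right (hq.intervalIntegrable 0 s)
        (hq.stronglyMeasurableAtFilter _ _) hq.continuousAt)
      exact (this.const_mul β).fun_neg)
  intro s hs
  have := key s hs
  simpa [h.pos_zero] using this

/-- Conservation of angular momentum. -/
theorem cross_momentum (hβ : 0 < β) (hL : 0 < L) (h : HasMomentum β L x R P w₀ v₀) :
    ∀ s ∈ Icc 0 L,
      x s 1 * P 2 - x s 2 * P 1 = angVec β R w₀ v₀ 0 s + w₀ 1 ∧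
      x s 2 * P 0 - x s 0 * P 2 = angVec β R w₀ v₀ 1 s - w₀ 0 ∧
      x s 0 * P 1 - x s 1 * P 0 = angVec β R w₀ v₀ 2 s := by
  have hx := ac_apply h.horizontal.ac_pos
  -- The hypothesis on (i, j, k) says that T × P and the derivative of `angVec` have the same k-th
  -- component; then x × P and `angVec` differ by a constant.
  have key : ∀ i j k, (∀ s ∈ Icc 0 L, R s i 2 * P j - R s j 2 * P i =
      hypSolDeriv β w₀ v₀ s 0 * R s k 1 - hypSolDeriv β w₀ v₀ s 1 * R s k 0) →
      ∀ s ∈ Icc 0 L, x s i * P j - x s j * P i =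
        angVec β R w₀ v₀ k s - angVec β R w₀ v₀ k 0 := by
    intro i j k hk s hs
    have := ac_sub_eq_of_ae_hasDerivAt (φ := fun s => hypSolDeriv β w₀ v₀ s 0 * R s k 1 -
      hypSolDeriv β w₀ v₀ s 1 * R s k 0) hL.le
      (((hx i).fun_mul (ac_const (P j) 0 L)).fun_sub ((hx j).fun_mul (ac_const (P i) 0 L)))
      (h.ac_angVec k) (by
        filter_upwards [h.ae_hasDerivAt_coord hL, ae_restrict_mem measurableSet_Icc] with t h1 ht
        exact (((h1 i).mul_const (P j)).fun_sub ((h1 j).mul_const (P i))).congr_deriv (hk t ht))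
      ((ae_mem_Ioo 0 L).mono fun t ht => h.angVec_hasDerivAt hβ hL t ht k) s hs
    simpa [h.pos_zero] using this
  obtain ⟨z0, z1, z2⟩ := h.angVec_zero
  intro s hs
  refine ⟨?_, ?_, ?_⟩
  · rw [key 1 2 0 (fun t ht => ?_) s hs, z0, sub_neg_eq_add]
    obtain ⟨c0, c1, c2⟩ := SO3_cross (h.horizontal.mem_SO3 t ht)
    rw [h.momentum_coord ht 1, h.momentum_coord ht 2]
    linear_combination hypSolDeriv β w₀ v₀ t 0 * c1.1 - hypSolDeriv β w₀ v₀ t 1 * c0.1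
  · rw [key 2 0 1 (fun t ht => ?_) s hs, z1]
    obtain ⟨c0, c1, c2⟩ := SO3_cross (h.horizontal.mem_SO3 t ht)
    rw [h.momentum_coord ht 2, h.momentum_coord ht 0]
    linear_combination hypSolDeriv β w₀ v₀ t 0 * c1.2.1 - hypSolDeriv β w₀ v₀ t 1 * c0.2.1
  · rw [key 0 1 2 (fun t ht => ?_) s hs, z2, sub_zero]
    obtain ⟨c0, c1, c2⟩ := SO3_cross (h.horizontal.mem_SO3 t ht)
    rw [h.momentum_coord ht 0, h.momentum_coord ht 1]
    linear_combination hypSolDeriv β w₀ v₀ t 0 * c1.2.2 - hypSolDeriv β w₀ v₀ t 1 * c0.2.2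

theorem exists_direction (hW : w₀ 0 * v₀ 1 - w₀ 1 * v₀ 0 = 0) :
    ∃ (d : E2) (a b : ℝ), w₀ = a • d ∧ v₀ = b • d := by
  by_cases hv : v₀ = 0
  · exact ⟨w₀, 1, 0, by simp, by simp [hv]⟩
  · have hn : ‖v₀‖ ^ 2 ≠ 0 := by positivity
    rw [E2_norm_sq] at hn
    -- The coefficient of the orthogonal projection of w₀ to v₀.
    refine ⟨v₀, (w₀ 0 * v₀ 0 + w₀ 1 * v₀ 1) / (v₀ 0 ^ 2 + v₀ 1 ^ 2), 1, ?_, by simp⟩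
    ext i
    fin_cases i
    · simp only [Fin.zero_eta, PiLp.smul_apply, smul_eq_mul]
      field_simp
      linear_combination v₀ 1 * hW
    · simp only [Fin.mk_one, PiLp.smul_apply, smul_eq_mul]
      field_simp
      linear_combination -v₀ 0 * hW

/-- If the Wronskian vanishes, the geodesic is planar. -/
theorem angVec_of_wronskian_eq_zero (hβ : 0 < β) (hL : 0 < L) (h : HasMomentum β L x R P w₀ v₀)
    (hW : w₀ 0 * v₀ 1 - w₀ 1 * v₀ 0 = 0) : ∀ s ∈ Icc 0 L,
      angVec β R w₀ v₀ 0 s = -hypSol β w₀ v₀ s 1 ∧ angVec β R w₀ v₀ 1 s = hypSol β w₀ v₀ s 0 ∧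
      angVec β R w₀ v₀ 2 s = 0 := by
  obtain ⟨d, a, b, hw₀, hv₀⟩ := exists_direction hW
  have hw : ∀ s i, hypSol β w₀ v₀ s i =
      (Real.cosh (β * s) * a + Real.sinh (β * s) / β * b) * d i := fun s i => by
    simp only [hypSol, hw₀, hv₀, PiLp.add_apply, PiLp.smul_apply, smul_eq_mul]
    ring
  -- w, and with it κ, stays parallel to d, so d₁R₂ − d₂R₁ is a constant vector: a normal of the
  -- plane of the curve if d ≠ 0.
  have hn : ∀ k, ∀ s ∈ Icc 0 L, d 0 * R s k 1 - d 1 * R s k 0 = d 0 * R 0 k 1 - d 1 * R 0 k 0 :=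
    fun k => ac_eq_of_ae_hasDerivAt_zero hL.le
      (((h.horizontal.ac_rot k 1).const_mul (d 0)).fun_sub
        ((h.horizontal.ac_rot k 0).const_mul (d 1))) (by
      filter_upwards [h.horizontal.frame_hasDerivAt hL.le, h.ae_kappa_parallel hβ]
        with t h1 ⟨r, h2⟩
      refine (((h1 k).2.1.const_mul (d 0)).fun_sub ((h1 k).1.const_mul (d 1))).congr_deriv ?_
      rw [h2, h2, hw, hw]
      ring)
  intro s hs
  have n0 := hn 0 s hs
  have n1 := hn 1 s hs
  have n2 := hn 2 s hs
  simp [h.rot_zero] at n0 n1 n2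
  simp only [angVec, hw]
  refine ⟨?_, ?_, ?_⟩
  · linear_combination (Real.cosh (β * s) * a + Real.sinh (β * s) / β * b) * n0
  · linear_combination (Real.cosh (β * s) * a + Real.sinh (β * s) / β * b) * n1
  · linear_combination (Real.cosh (β * s) * a + Real.sinh (β * s) / β * b) * n2

/-- The component of the angular momentum along the momentum is the Wronskian. -/
theorem angVec_inner_momentum (hβ : 0 < β) (h : HasMomentum β L x R P w₀ v₀) {s : ℝ}
    (hs : s ∈ Icc 0 L) :
    P 0 * angVec β R w₀ v₀ 0 s + P 1 * angVec β R w₀ v₀ 1 s + P 2 * angVec β R w₀ v₀ 2 s =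
      w₀ 0 * v₀ 1 - w₀ 1 * v₀ 0 := by
  rw [← wronskian_hypSol hβ w₀ v₀ s, ← h.comp_zero s hs, ← h.comp_one s hs]
  simp only [angVec]
  ring

/-- The derivative of `angVec`, decomposed along `angVec`, its cross product with the momentum, and
the momentum. -/
theorem angVec_deriv_identity (hβ : 0 < β) (hL : 0 < L) (h : HasMomentum β L x R P w₀ v₀) {s : ℝ}
    (hs : s ∈ Icc 0 L) :
    let W := w₀ 0 * v₀ 1 - w₀ 1 * v₀ 0
    let w := hypSol β w₀ v₀ s
    let v := hypSolDeriv β w₀ v₀ s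
    let q := β * √(1 - ‖w‖ ^ 2)
    let m := fun k => angVec β R w₀ v₀ k s
    let c : Fin 3 → ℝ := ![P 1 * m 2 - P 2 * m 1, P 2 * m 0 - P 0 * m 2, P 0 * m 1 - P 1 * m 0]
    ∀ k, ((P 0 ^ 2 + P 1 ^ 2 + P 2 ^ 2) * ‖w‖ ^ 2 - W ^ 2) * (v 0 * R s k 1 - v 1 * R s k 0) =
      (P 0 ^ 2 + P 1 ^ 2 + P 2 ^ 2) * (w 0 * v 0 + w 1 * v 1) * m k - W * q * c k -
        W * (w 0 * v 0 + w 1 * v 1) * P k := by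
  intro W w v q m c k
  obtain ⟨c0, c1, c2⟩ := SO3_cross (h.horizontal.mem_SO3 s hs)
  -- The cross product of P and M expanded in the moving frame; after this the claim is a polynomial
  -- identity in the coefficients.
  have hc : c k = q * w 0 * R s k 0 + q * w 1 * R s k 1 + (w 0 * v 0 + w 1 * v 1) * R s k 2 := by
    have p0 : P 0 = v 0 * R s 0 0 + v 1 * R s 0 1 - q * R s 0 2 := h.momentum_coord hs 0
    have p1 : P 1 = v 0 * R s 1 0 + v 1 * R s 1 1 - q * R s 1 2 := h.momentum_coord hs 1
    have p2 : P 2 = v 0 * R s 2 0 + v 1 * R s 2 1 - q * R s 2 2 := h.momentum_coord hs 2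
    have hm : ∀ k, m k = w 0 * R s k 1 - w 1 * R s k 0 := fun k => rfl
    fin_cases k
    · simp only [c, p1, p2, hm, Matrix.cons_val_zero, Fin.zero_eta]
      linear_combination q * w 0 * c0.1 + q * w 1 * c1.1 + (w 0 * v 0 + w 1 * v 1) * c2.1
    · simp only [c, p0, p2, hm, Matrix.cons_val_one, Matrix.cons_val_zero, Fin.mk_one]
      linear_combination q * w 0 * c0.2.1 + q * w 1 * c1.2.1 + (w 0 * v 0 + w 1 * v 1) * c2.2.1
    · simp only [c, p0, p1, hm, Matrix.cons_val, Fin.reduceFinMk]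
      linear_combination q * w 0 * c0.2.2 + q * w 1 * c1.2.2 + (w 0 * v 0 + w 1 * v 1) * c2.2.2
  have hP : P k = v 0 * R s k 0 + v 1 * R s k 1 - q * R s k 2 := h.momentum_coord hs k
  have hW : W = w 0 * v 1 - w 1 * v 0 := (wronskian_hypSol hβ w₀ v₀ s).symm
  have hsq : P 0 ^ 2 + P 1 ^ 2 + P 2 ^ 2 = v 0 ^ 2 + v 1 ^ 2 + q ^ 2 := by
    have hle := h.norm_le_one hβ hL s hs
    have hq : √(1 - ‖w‖ ^ 2) ^ 2 = 1 - ‖w‖ ^ 2 :=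
      Real.sq_sqrt (by nlinarith [norm_nonneg (hypSol β w₀ v₀ s)])
    rw [h.sq_momentum hβ hL hs, E2_norm_sq (hypSolDeriv β w₀ v₀ s)]
    linear_combination -β ^ 2 * hq
  have hmk : m k = w 0 * R s k 1 - w 1 * R s k 0 := rfl
  rw [hc, hP, hsq, hmk, hW, E2_norm_sq w]
  ring

end HasMomentum

end

/-! ### The explicit formulas -/

/-- Matrices of this shape are the image of ℂ under its regular representation, a continuous algebra
homomorphism, which commutes with the exponential. -/
theorem exp_conformal (a b : ℝ) :
    NormedSpace.exp (!![a, -b; b, a] : Matrix (Fin 2) (Fin 2) ℝ) =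
      Real.exp a • !![Real.cos b, -Real.sin b; Real.sin b, Real.cos b] := by
  let : NormedRing (Matrix (Fin 2) (Fin 2) ℝ) := Matrix.linftyOpNormedRing
  let φ : ℂ →ₐ[ℝ] Matrix (Fin 2) (Fin 2) ℝ := Algebra.leftMulMatrix Complex.basisOneI
  have hφ : ∀ z, φ z = !![z.re, -z.im; z.im, z.re] := Algebra.leftMulMatrix_complex
  have hc : Continuous φ := LinearMap.continuous_of_finiteDimensional φ.toLinearMap
  have h1 := NormedSpace.map_exp φ hc (⟨a, b⟩ : ℂ)
  rw [hφ ⟨a, b⟩, ← Complex.exp_eq_exp_ℂ, hφ] at h1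
  refine h1.symm.trans ?_
  rw [Complex.exp_re, Complex.exp_im]
  simp [Matrix.smul_of]

theorem eq_of_hasDerivAt_zero {f : ℝ → ℝ} {L : ℝ} (hf : ContinuousOn f (Icc 0 L))
    (hf' : ∀ s ∈ Ioo 0 L, HasDerivAt f 0 s) : ∀ s ∈ Icc 0 L, f s = f 0 := by
  intro s hs
  rcases hs.1.eq_or_lt with h0 | h0
  · rw [← h0]
  · obtain ⟨c, -, hc⟩ := exists_hasDerivAt_eq_slope f (fun _ => 0) h0
      (hf.mono (Icc_subset_Icc le_rfl hs.2)) fun t ht => hf' t ⟨ht.1, ht.2.trans_le hs.2⟩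
    rw [eq_div_iff (by linarith)] at hc
    linarith

/-- The linear system with conformal coefficient matrix. -/
theorem conformal_ode {Y Z a b : ℝ → ℝ} {L : ℝ} (hL : 0 < L) (hY : ContinuousOn Y (Icc 0 L))
    (hZ : ContinuousOn Z (Icc 0 L)) (ha : ContinuousOn a (Icc 0 L)) (hb : ContinuousOn b (Icc 0 L))
    (hY' : ∀ s ∈ Ioo 0 L, HasDerivAt Y (a s * Y s - b s * Z s) s)
    (hZ' : ∀ s ∈ Ioo 0 L, HasDerivAt Z (b s * Y s + a s * Z s) s) :
    ∀ s ∈ Icc 0 L,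
      Y s = Real.exp (∫ t in (0 : ℝ)..s, a t) * (Real.cos (∫ t in (0 : ℝ)..s, b t) * Y 0 -
        Real.sin (∫ t in (0 : ℝ)..s, b t) * Z 0) ∧
      Z s = Real.exp (∫ t in (0 : ℝ)..s, a t) * (Real.sin (∫ t in (0 : ℝ)..s, b t) * Y 0 +
        Real.cos (∫ t in (0 : ℝ)..s, b t) * Z 0) := by
  have prim : ∀ {f : ℝ → ℝ}, ContinuousOn f (Icc 0 L) →
      ContinuousOn (fun s => ∫ t in (0 : ℝ)..s, f t) (Icc 0 L) ∧
      ∀ s ∈ Ioo 0 L, HasDerivAt (fun s => ∫ t in (0 : ℝ)..s, f t) (f s) s := by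
    intro f hf
    have hi : IntervalIntegrable f volume 0 L :=
      ContinuousOn.intervalIntegrable (by rwa [uIcc_of_le hL.le])
    constructor
    · have := (hi.absolutelyContinuousOnInterval_intervalIntegral (c := 0)
        left_mem_uIcc).continuousOn
      rwa [uIcc_of_le hL.le] at this
    · intro s hs
      refine intervalIntegral.integral_hasDerivAt_right (hi.mono_set ?_)
        (ContinuousOn.stronglyMeasurableAtFilter isOpen_Ioo (hf.mono Ioo_subset_Icc_self) s hs)
        (hf.continuousAt (Icc_mem_nhds hs.1 hs.2))
      rw [uIcc_of_le hL.le, uIcc_of_le hs.1.le]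
      exact Icc_subset_Icc le_rfl hs.2.le
  obtain ⟨cA, dA⟩ := prim ha
  obtain ⟨cB, dB⟩ := prim hb
  set A : ℝ → ℝ := fun s => ∫ t in (0 : ℝ)..s, a t with hA
  set B : ℝ → ℝ := fun s => ∫ t in (0 : ℝ)..s, b t with hB
  have cE : ContinuousOn (fun s => Real.exp (-A s)) (Icc 0 L) := by fun_prop
  have cc' : ContinuousOn (fun s => Real.cos (B s)) (Icc 0 L) := by fun_prop
  have cs' : ContinuousOn (fun s => Real.sin (B s)) (Icc 0 L) := by fun_prop
  -- Undoing the scaling by exp A and the rotation by the angle B turns (Y, Z) into a constant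
  -- vector.
  have k1 := eq_of_hasDerivAt_zero (f := fun s => Real.exp (-A s) *
    (Real.cos (B s) * Y s + Real.sin (B s) * Z s)) (cE.mul ((cc'.mul hY).add (cs'.mul hZ)))
    fun s hs => by
      refine ((dA s hs).fun_neg.exp.fun_mul (((dB s hs).cos.fun_mul (hY' s hs)).fun_add
        ((dB s hs).sin.fun_mul (hZ' s hs)))).congr_deriv ?_
      ring
  have k2 := eq_of_hasDerivAt_zero (f := fun s => Real.exp (-A s) *
    (Real.cos (B s) * Z s - Real.sin (B s) * Y s)) (cE.mul ((cc'.mul hZ).sub (cs'.mul hY)))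
    fun s hs => by
      refine ((dA s hs).fun_neg.exp.fun_mul (((dB s hs).cos.fun_mul (hZ' s hs)).fun_sub
        ((dB s hs).sin.fun_mul (hY' s hs)))).congr_deriv ?_
      ring
  intro s hs
  have e1 := k1 s hs
  have e2 := k2 s hs
  have hA0 : A 0 = 0 := by simp [hA]
  have hB0 : B 0 = 0 := by simp [hB]
  simp only [hA0, hB0, neg_zero, Real.exp_zero, Real.cos_zero, Real.sin_zero, one_mul, zero_mul,
    add_zero, sub_zero, Real.exp_neg] at e1 e2
  have hcs := Real.sin_sq_add_cos_sq (B s)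
  change Y s = Real.exp (A s) * (Real.cos (B s) * Y 0 - Real.sin (B s) * Z 0) ∧
    Z s = Real.exp (A s) * (Real.sin (B s) * Y 0 + Real.cos (B s) * Z 0)
  rw [← e1, ← e2]
  have hE : Real.exp (A s) ≠ 0 := (Real.exp_pos _).ne'
  constructor
  · field_simp
    linear_combination -Y s * hcs
  · field_simp
    linear_combination -Z s * hcs

/-! ### The position in the coordinates given by R̃(0). -/

section

variable {β L : ℝ} {x : ℝ → E3} {R : ℝ → Mat3} {P : Fin 3 → ℝ} {w₀ v₀ : E2}

theorem E2_inner (u v : E2) : inner ℝ u v = u 0 * v 0 + u 1 * v 1 := by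
  simp [PiLp.inner_apply, Fin.sum_univ_two, mul_comm]

namespace HasMomentum

theorem sq_speed (hβ : 0 < β) (hL : 0 < L) (h : HasMomentum β L x R P w₀ v₀) :
    (cc β (hypSol β w₀ v₀) * β) ^ 2 = ‖v₀‖ ^ 2 + rt β (hypSol β w₀ v₀) 0 ^ 2 := by
  obtain ⟨p0, p1, p2⟩ := h.momentum_eq hβ hL
  rw [mul_pow, h.sq_cc hβ hL, p0, p1, p2, E2_norm_sq]
  ring

theorem tildeR0_transpose_mul (hβ : 0 < β) (hL : 0 < L) (h : HasMomentum β L x R P w₀ v₀) :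
    (tildeR0 β (hypSol β w₀ v₀))ᵀ * tildeR0 β (hypSol β w₀ v₀) = 1 := by
  -- For a square matrix it is enough that the rows, which are explicit, are orthonormal.
  rw [mul_eq_one_comm]
  have hC : cc β (hypSol β w₀ v₀) * β ≠ 0 := (mul_pos (h.cc_pos hβ hL) hβ).ne'
  have hsq := h.sq_speed hβ hL
  rw [tildeR0, deriv_hypSol hβ, hypSolDeriv_zero]
  split_ifs with hv
  · ext i j
    fin_cases i <;> fin_cases j <;> simp [Matrix.mul_apply, Fin.sum_univ_three]
  · have hn : ‖v₀‖ ≠ 0 := norm_ne_zero_iff.2 hv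
    have hn2 := E2_norm_sq v₀
    generalize cc β (hypSol β w₀ v₀) * β = C at *
    generalize rt β (hypSol β w₀ v₀) 0 = Q at *
    generalize ‖v₀‖ = n at *
    ext i j
    simp only [Matrix.mul_apply, Fin.sum_univ_three, Matrix.transpose_apply, Matrix.smul_apply]
    fin_cases i <;> fin_cases j <;> simp <;> field_simp
    · linear_combination -hsq - hn2
    · ring
    · linear_combination Q * hn2
    · ring
    · linear_combination -hn2
    · ring
    · linear_combination Q * hn2
    · ring
    · linear_combination -n ^ 2 * hsq - Q ^ 2 * hn2

theorem tildeX_eq (w : ℝ → E2) : tildeX β w 0 = 0 := by simp [tildeX]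

/-- The position in the rotated coordinate system, in terms of the angular momentum. -/
theorem tildeR0_mulVec (hβ : 0 < β) (hL : 0 < L) (h : HasMomentum β L x R P w₀ v₀) (hv : v₀ ≠ 0)
    {s : ℝ} (hs : s ∈ Icc 0 L) :
    tildeR0 β (hypSol β w₀ v₀) *ᵥ (x s).ofLp =
      ![tildeX β (hypSol β w₀ v₀) s, angVec β R w₀ v₀ 2 s / ‖v₀‖,
        (v₀ 0 * (angVec β R w₀ v₀ 1 s - w₀ 0) - v₀ 1 * (angVec β R w₀ v₀ 0 s + w₀ 1)) /
          (cc β (hypSol β w₀ v₀) * β * ‖v₀‖)] := by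
  obtain ⟨p0, p1, p2⟩ := h.momentum_eq hβ hL
  have hc := (h.cc_pos hβ hL).ne'
  have hin := h.inner_momentum hβ hL s hs
  -- The first row of R̃(0) is parallel to P; the other two are orthogonal to P, so their products
  -- with x can be read off x × P.
  obtain ⟨c0, c1, c2⟩ := h.cross_momentum hβ hL s hs
  rw [p0, p1, p2] at hin
  rw [p1, p2] at c0
  rw [p0, p2] at c1
  rw [p0, p1] at c2
  have hn : ‖v₀‖ ≠ 0 := norm_ne_zero_iff.2 hv
  have hn2 := E2_norm_sq v₀
  rw [tildeR0, deriv_hypSol hβ, hypSolDeriv_zero, if_neg hv, ← c0, ← c1, ← c2, tildeX]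
  have hβ' := hβ.ne'
  generalize (∫ τ in (0 : ℝ)..s, √(1 - ‖hypSol β w₀ v₀ τ‖ ^ 2)) = X at *
  generalize cc β (hypSol β w₀ v₀) = C at *
  generalize rt β (hypSol β w₀ v₀) 0 = Q at *
  generalize ‖v₀‖ = n at *
  ext i
  fin_cases i <;>
    simp [Matrix.mulVec, dotProduct, Fin.sum_univ_three] <;> field_simp
  · linear_combination -hin
  · ring
  · linear_combination x s 2 * hn2

theorem tildeCurve_formula (hβ : 0 < β) (hL : 0 < L) (h : HasMomentum β L x R P w₀ v₀) {s : ℝ}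
    (heq : tildeR0 β (hypSol β w₀ v₀) *ᵥ (x s).ofLp =
      tildeCurve β (hypSol β w₀ v₀) s - tildeCurve β (hypSol β w₀ v₀) 0) :
    (x s).ofLp = (tildeR0 β (hypSol β w₀ v₀))ᵀ *ᵥ
      (tildeCurve β (hypSol β w₀ v₀) s - tildeCurve β (hypSol β w₀ v₀) 0) := by
  rw [← heq, Matrix.mulVec_mulVec, h.tildeR0_transpose_mul hβ hL, Matrix.one_mulVec]

/-- Here P = −𝔠β e_z and W = 0, so M is explicit and x × P gives the first two coordinates of x
directly. -/
theorem formula_of_deriv_eq_zero (hβ : 0 < β) (hL : 0 < L) (h : HasMomentum β L x R P w₀ v₀)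
    (hv : v₀ = 0) {s : ℝ} (hs : s ∈ Icc 0 L) :
    tildeR0 β (hypSol β w₀ v₀) *ᵥ (x s).ofLp =
      tildeCurve β (hypSol β w₀ v₀) s - tildeCurve β (hypSol β w₀ v₀) 0 := by
  obtain ⟨p0, p1, p2⟩ := h.momentum_eq hβ hL
  have hcp := h.cc_pos hβ hL
  have hc := hcp.ne'
  have hβ' := hβ.ne'
  have hin := h.inner_momentum hβ hL s hs
  obtain ⟨c0, c1, c2⟩ := h.cross_momentum hβ hL s hs
  obtain ⟨a0, a1, a2⟩ := h.angVec_of_wronskian_eq_zero hβ hL (by simp [hv]) s hs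
  have hQ : rt β (hypSol β w₀ v₀) 0 = cc β (hypSol β w₀ v₀) * β := by
    have := h.sq_speed hβ hL
    rw [hv, norm_zero] at this
    rw [hv]
    refine ((sq_eq_sq₀ (Real.sqrt_nonneg _) ?_).1 ?_)
    · rw [← hv]; positivity
    · change rt β (hypSol β w₀ 0) 0 ^ 2 = _
      rw [this]; ring
  rw [p0, p1, p2, hQ, hv] at hin
  rw [p1, p2, hQ, a0, hv] at c0
  rw [p0, p2, hQ, a1, hv] at c1
  have hd : deriv (hypSol β w₀ v₀) 0 = 0 := by rw [deriv_hypSol hβ, hypSolDeriv_zero, hv]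
  simp only [tildeCurve, tildeR0, tildeYZ, hd, if_true, tildeX, hypSol_zero]
  subst hv
  generalize (∫ τ in (0 : ℝ)..s, √(1 - ‖hypSol β w₀ 0 τ‖ ^ 2)) = X at *
  generalize cc β (hypSol β w₀ 0) = C at *
  simp at hin c0 c1
  ext i
  fin_cases i <;>
    simp [Matrix.mulVec, dotProduct, Fin.sum_univ_three] <;> field_simp
  · have : β * (C * x s 2 - X) = 0 := by linear_combination hin
    rcases mul_eq_zero.1 this with h0 | h0
    · exact absurd h0 hβ'
    · linear_combination h0
  · linear_combination -c0
  · linear_combination -c1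

theorem formula_of_wronskian_eq_zero (hβ : 0 < β) (hL : 0 < L) (h : HasMomentum β L x R P w₀ v₀)
    (hv : v₀ ≠ 0) (hW : WW (hypSol β w₀ v₀) = 0) {s : ℝ} (hs : s ∈ Icc 0 L) :
    tildeR0 β (hypSol β w₀ v₀) *ᵥ (x s).ofLp =
      tildeCurve β (hypSol β w₀ v₀) s - tildeCurve β (hypSol β w₀ v₀) 0 := by
  have hW' := hW
  rw [WW_hypSol hβ] at hW'
  obtain ⟨a0, a1, a2⟩ := h.angVec_of_wronskian_eq_zero hβ hL hW' s hs
  have hd : deriv (hypSol β w₀ v₀) 0 = v₀ := by rw [deriv_hypSol hβ, hypSolDeriv_zero]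
  rw [h.tildeR0_mulVec hβ hL hv hs, a0, a1, a2]
  simp only [tildeCurve, tildeX_eq, tildeYZ, hd, if_neg hv, if_pos hW, hypSol_zero, E2_inner]
  ext i
  fin_cases i <;> simp
  ring

/-- The part of M orthogonal to P is tracked by two coordinates Y and Z. The decomposition of M' in
`angVec_deriv_identity` shows that (Y, Z)' = A (Y, Z), and the increments of Y and Z are the
coordinates of x sought. -/
theorem formula_of_wronskian_ne_zero (hβ : 0 < β) (hL : 0 < L) (h : HasMomentum β L x R P w₀ v₀)
    (hv : v₀ ≠ 0) (hW : WW (hypSol β w₀ v₀) ≠ 0) :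
    ∀ s ∈ Icc 0 L, tildeR0 β (hypSol β w₀ v₀) *ᵥ (x s).ofLp =
      tildeCurve β (hypSol β w₀ v₀) s - tildeCurve β (hypSol β w₀ v₀) 0 := by
  have hd : deriv (hypSol β w₀ v₀) 0 = v₀ := by rw [deriv_hypSol hβ, hypSolDeriv_zero]
  obtain ⟨p0, p1, p2⟩ := h.momentum_eq hβ hL
  have hcp := h.cc_pos hβ hL
  have hn : ‖v₀‖ ≠ 0 := norm_ne_zero_iff.2 hv
  have hn2 := E2_norm_sq v₀
  have hsq := h.sq_speed hβ hL
  have hCpos : 0 < cc β (hypSol β w₀ v₀) * β := mul_pos hcp hβ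
  have hden := fun s hs => h.denA_pos hβ hL hW (s := s) hs
  set w := hypSol β w₀ v₀ with hw
  set C := cc β w * β with hC
  set n := ‖v₀‖ with hnn
  set Q := rt β w 0 with hQ
  set m := angVec β R w₀ v₀ with hm
  have hPsq : P 0 ^ 2 + P 1 ^ 2 + P 2 ^ 2 = C ^ 2 := by rw [hC, mul_pow, h.sq_cc hβ hL]
  have mcont : ∀ k, ContinuousOn (m k) (Icc 0 L) := fun k => by
    have := (h.ac_angVec k).continuousOn
    rwa [uIcc_of_le hL.le] at this
  -- With ρ₂, ρ₃ the last two rows of R̃(0), Y = ρ₃·M/(𝔠β) and Z = −ρ₂·M/(𝔠β). The quarter turn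
  -- reflects that x enters through x × P.
  set Y : ℝ → ℝ := fun s => (Q * v₀ 0 * m 0 s + Q * v₀ 1 * m 1 s + n ^ 2 * m 2 s) / (n * C ^ 2)
    with hY
  set Z : ℝ → ℝ := fun s => (v₀ 0 * m 1 s - v₀ 1 * m 0 s) / (n * C) with hZ
  have e00 : ∀ s, matA β w s 0 0 = 1 / denA β w s * inner ℝ (w s) (deriv w s) := fun s => by
    simp [matA]
  have e01 : ∀ s, matA β w s 0 1 = -(1 / denA β w s * (WW w / C * rt β w s)) := fun s => by
    simp [matA, hC]
  have e10 : ∀ s, matA β w s 1 0 = 1 / denA β w s * (WW w / C * rt β w s) := fun s => by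
    simp [matA, hC]
  have e11 : ∀ s, matA β w s 1 1 = 1 / denA β w s * inner ℝ (w s) (deriv w s) := fun s => by
    simp [matA]
  have wcont : Continuous w := continuous_hypSol hβ w₀ v₀
  have vcont : Continuous (deriv w) := by
    rw [funext (deriv_hypSol hβ w₀ v₀)]; exact continuous_hypSolDeriv hβ w₀ v₀
  have dcont : ContinuousOn (fun s => 1 / denA β w s) (Icc 0 L) := by
    refine continuousOn_const.div (Continuous.continuousOn ?_) fun s hs => (hden s hs).ne'
    unfold denA
    fun_prop
  have rcont : Continuous (rt β w) := by unfold rt; fun_prop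
  have hder : ∀ s ∈ Ioo 0 L, HasDerivAt Y (1 / denA β w s * inner ℝ (w s) (deriv w s) * Y s -
      1 / denA β w s * (WW w / C * rt β w s) * Z s) s ∧
      HasDerivAt Z (1 / denA β w s * (WW w / C * rt β w s) * Y s +
        1 / denA β w s * inner ℝ (w s) (deriv w s) * Z s) s := by
    intro s hs
    have hs' := Ioo_subset_Icc_self hs
    have hmd := h.angVec_hasDerivAt hβ hL s hs
    have hid := h.angVec_deriv_identity hβ hL hs'
    have hD := h.denA_mul hβ hL s
    have hDne := (hden s hs').ne'
    have hinner : inner ℝ (w s) (deriv w s) =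
        w s 0 * hypSolDeriv β w₀ v₀ s 0 + w s 1 * hypSolDeriv β w₀ v₀ s 1 := by
      rw [E2_inner, hw, deriv_hypSol hβ]
    simp only [] at hid
    rw [← h.rt_eq hβ hL hs', ← hinner, ← WW_hypSol hβ] at hid
    rw [← WW_hypSol hβ] at hD
    have i0 := hid 0
    have i1 := hid 1
    have i2 := hid 2
    simp only [Matrix.cons_val_zero, Matrix.cons_val_one, Matrix.cons_val] at i0 i1 i2
    rw [hPsq] at i0 i1 i2 hD
    have hm0 := hmd 0
    have hm1 := hmd 1
    have hm2 := hmd 2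
    rw [p0, p1, p2] at i0 i1 i2
    change HasDerivAt (m 0) _ s at hm0
    change HasDerivAt (m 1) _ s at hm1
    change HasDerivAt (m 2) _ s at hm2
    change _ = _ * m 0 s - _ * (_ * m 2 s - _ * m 1 s) - _ at i0
    change _ = _ * m 1 s - _ * (_ * m 0 s - _ * m 2 s) - _ at i1
    change _ = _ * m 2 s - _ * (_ * m 1 s - _ * m 0 s) - _ at i2
    rw [← hw] at i0 i1 i2 hD
    generalize hypSolDeriv β w₀ v₀ s 0 * R s 0 1 - hypSolDeriv β w₀ v₀ s 1 * R s 0 0 = d0 at *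
    generalize hypSolDeriv β w₀ v₀ s 0 * R s 1 1 - hypSolDeriv β w₀ v₀ s 1 * R s 1 0 = d1 at *
    generalize hypSolDeriv β w₀ v₀ s 0 * R s 2 1 - hypSolDeriv β w₀ v₀ s 1 * R s 2 0 = d2 at *
    generalize inner ℝ (w s) (deriv w s) = ip at *
    generalize denA β w s = D at *
    generalize rt β w s = q at *
    generalize WW w = W at *
    have hC2 : C ^ 2 ≠ 0 := by positivity
    have hE : C ^ 2 * ‖w s‖ ^ 2 - W ^ 2 = D * C ^ 2 := by rw [hD]; ring
    rw [hE] at i0 i1 i2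
    -- Projection to the plane orthogonal to P removes the P-term of M', and the cross product with
    -- P acts there as a multiple of a quarter turn; this yields the conformal form.
    have k1 : D * (Q * v₀ 0 * d0 + Q * v₀ 1 * d1 + n ^ 2 * d2) =
        ip * (Q * v₀ 0 * m 0 s + Q * v₀ 1 * m 1 s + n ^ 2 * m 2 s) -
          W * q * (v₀ 0 * m 1 s - v₀ 1 * m 0 s) := by
      refine mul_left_cancel₀ hC2 ?_
      linear_combination Q * v₀ 0 * i0 + Q * v₀ 1 * i1 + n ^ 2 * i2 +
        W * q * (v₀ 0 * m 1 s - v₀ 1 * m 0 s) * hsq + W * ip * Q * hn2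
    have k2 : C ^ 2 * (D * (v₀ 0 * d1 - v₀ 1 * d0)) =
        C ^ 2 * ip * (v₀ 0 * m 1 s - v₀ 1 * m 0 s) +
          W * q * (Q * v₀ 0 * m 0 s + Q * v₀ 1 * m 1 s + n ^ 2 * m 2 s) := by
      linear_combination v₀ 0 * i1 - v₀ 1 * i0 - W * q * m 2 s * hn2
    have hC0 : C ≠ 0 := hCpos.ne'
    constructor
    · refine ((((hm0.const_mul (Q * v₀ 0)).fun_add (hm1.const_mul (Q * v₀ 1))).fun_add
        (hm2.const_mul (n ^ 2))).div_const (n * C ^ 2)).congr_deriv ?_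
      simp only [hY, hZ]
      field_simp
      linear_combination k1
    · refine (((hm1.const_mul (v₀ 0)).fun_sub (hm0.const_mul (v₀ 1))).div_const
        (n * C)).congr_deriv ?_
      simp only [hY, hZ]
      field_simp
      linear_combination k2
  have sol := conformal_ode hL (Y := Y) (Z := Z)
    (a := fun s => 1 / denA β w s * inner ℝ (w s) (deriv w s))
    (b := fun s => 1 / denA β w s * (WW w / C * rt β w s))
    (ContinuousOn.div_const (((continuousOn_const.mul (mcont 0)).add
      (continuousOn_const.mul (mcont 1))).add (continuousOn_const.mul (mcont 2))) _)
    (ContinuousOn.div_const ((continuousOn_const.mul (mcont 1)).sub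
      (continuousOn_const.mul (mcont 0))) _)
    (dcont.mul (wcont.inner vcont).continuousOn)
    (dcont.mul (continuous_const.mul rcont).continuousOn)
    (fun s hs => (hder s hs).1) (fun s hs => (hder s hs).2)
  obtain ⟨m00, m10, m20⟩ := h.angVec_zero
  have hWval : WW w = w₀ 0 * v₀ 1 - w₀ 1 * v₀ 0 := WW_hypSol hβ w₀ v₀
  have hC0 : C ≠ 0 := hCpos.ne'
  have hCC : cc β w ^ 2 * β ^ 2 = C ^ 2 := by rw [hC]; ring
  -- The vector to which exp(∫A) is applied in `tildeYZ` is (Y, Z) at 0, where M = (−w₂, w₁, 0).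
  have hY0 : 1 / (cc β w ^ 2 * β ^ 2 * n) * (WW w * Q) = Y 0 := by
    simp only [hY, hm]
    rw [m00, m10, m20, hWval, hCC]
    field_simp
    ring
  have hZ0 : 1 / (cc β w ^ 2 * β ^ 2 * n) * (C * inner ℝ (w 0) v₀) = Z 0 := by
    simp only [hZ, hm]
    rw [m00, m10, hCC, E2_inner, hw, hypSol_zero]
    field_simp
    ring
  have hYZ : ∀ s ∈ Icc 0 L, tildeYZ β w s = ![Y s, Z s] := by
    intro s hs
    have hI : intA β w s = !![∫ t in (0 : ℝ)..s, 1 / denA β w t * inner ℝ (w t) (deriv w t),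
        -∫ t in (0 : ℝ)..s, 1 / denA β w t * (WW w / C * rt β w t);
        ∫ t in (0 : ℝ)..s, 1 / denA β w t * (WW w / C * rt β w t),
        ∫ t in (0 : ℝ)..s, 1 / denA β w t * inner ℝ (w t) (deriv w t)] := by
      ext i j
      fin_cases i <;> fin_cases j <;> simp only [intA, Matrix.of_apply, Fin.zero_eta, Fin.mk_one]
      · simp only [e00]; rfl
      · simp only [e01, intervalIntegral.integral_neg]; rfl
      · simp only [e10]; rfl
      · simp only [e11]; rfl
    rw [tildeYZ, hd, if_neg hv, if_neg hW, hI, exp_conformal, (sol s hs).1, (sol s hs).2,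
      ← hY0, ← hZ0]
    ext i
    fin_cases i <;> simp <;> ring
  intro s hs
  rw [h.tildeR0_mulVec hβ hL hv hs, ← hw, ← hC, ← hnn, ← hm]
  simp only [tildeCurve, tildeX_eq, hYZ s hs, hYZ 0 ⟨le_rfl, hL.le⟩]
  have hmW := h.angVec_inner_momentum hβ hs
  rw [p0, p1, p2, ← hWval] at hmW
  have hY0' : Y 0 = Q * WW w / (n * C ^ 2) := by
    rw [← hY0, hCC]; field_simp
  -- M·P = W eliminates the first two components of M from Y, so that Y(s) − Y(0) is M₃/‖w'(0)‖, the
  -- second coordinate in `tildeR0_mulVec`.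
  have hYs : Y s = (Q * WW w + C ^ 2 * m 2 s) / (n * C ^ 2) := by
    simp only [hY]
    congr 1
    linear_combination Q * hmW - m 2 s * hsq
  have hZ0' : Z 0 = (v₀ 0 * w₀ 0 + v₀ 1 * w₀ 1) / (n * C) := by
    simp only [hZ, hm]
    rw [m00, m10]
    ring
  ext i
  fin_cases i
  · simp
  · simp only [hY0', hYs, Fin.mk_one, Matrix.cons_val_one, Matrix.cons_val_zero, Pi.sub_apply]
    field_simp
    ring
  · simp only [hZ0', Fin.reduceFinMk, Matrix.cons_val, Pi.sub_apply, Matrix.cons_val_zero,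
      Matrix.cons_val_one]
    simp only [hZ]
    field_simp
    ring

theorem position_formula (hβ : 0 < β) (hL : 0 < L) (h : HasMomentum β L x R P w₀ v₀) :
    ∀ s ∈ Icc 0 L, (x s).ofLp = (tildeR0 β (hypSol β w₀ v₀))ᵀ *ᵥ
      (tildeCurve β (hypSol β w₀ v₀) s - tildeCurve β (hypSol β w₀ v₀) 0) := by
  intro s hs
  refine h.tildeCurve_formula hβ hL ?_
  by_cases hv : v₀ = 0
  · exact h.formula_of_deriv_eq_zero hβ hL hv hs
  · by_cases hW : WW (hypSol β w₀ v₀) = 0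
    · exact h.formula_of_wronskian_eq_zero hβ hL hv hW hs
    · exact h.formula_of_wronskian_ne_zero hβ hL hv hW s hs

end HasMomentum

end

end SE3Geod

end

theorem mainTheorem1 (β L : ℝ) (hβ : 0 < β) (hL : 0 < L)
    (x : ℝ → SE3Geod.E3) (R : ℝ → SE3Geod.Mat3)
    (hγ : SE3Geod.IsCusplessGeodesic β L x R) :
    ∃ w : ℝ → SE3Geod.E2,
      -- `w` is the normalized curvature of the geodesic
      (∀ᵐ s ∂(volume.restrict (Icc 0 L)), w s = SE3Geod.normalizedCurvature β x R s) ∧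
      (∀ s, w s = Real.cosh (β * s) • w 0 + (Real.sinh (β * s) / β) • deriv w 0) ∧
      -- the quantities in the formulas are well defined
      (∀ s ∈ Ioo 0 L, ‖w s‖ < 1) ∧
      0 < SE3Geod.cc β w ∧
      (SE3Geod.WW w ≠ 0 → ∀ s ∈ Icc 0 L, 0 < SE3Geod.denA β w s) ∧
      -- the formula for the spatial part
      ∀ s ∈ Icc 0 L, (x s).ofLp =
        (SE3Geod.tildeR0 β w)ᵀ *ᵥ (SE3Geod.tildeCurve β w s - SE3Geod.tildeCurve β w 0) := by
  obtain ⟨P, w₀, v₀, h⟩ := hγ.exists_hasMomentum hβ hL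
  refine ⟨SE3Geod.hypSol β w₀ v₀, h.ae_eq, fun s => ?_, h.norm_lt_one hβ hL, h.cc_pos hβ hL,
    fun hW s hs => h.denA_pos hβ hL hW hs, h.position_formula hβ hL⟩
  rw [SE3Geod.deriv_hypSol hβ, SE3Geod.hypSol_zero, SE3Geod.hypSolDeriv_zero]
  rfl
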